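/- All trees are finite, and a $c$-colored tree is a tree whose vertices carry colors from $\{1,\dots,c\}$ (not necessarily properly). The view at distance $d$ of a vertex $v$ is the colored graph formed by all vertices at distance at most $d$ from $v$ and all edges with at least one endpoint at distance at most $d-1$ from $v$, with $v$ marked as its center. A local checker in $\mathcal{L}_{c,d}$ is an arbitrary accept/reject decision on views at distance $d$ in $c$-colored graphs that depends only on the isomorphism class of the (rooted, colored) view. It accepts a $c$-colored tree if it accepts the view of each of its vertices. It has exact diameter $f$ if, for every $n$, every accepted tree with $n$ vertices has diameter $f(n)$. Let $S_{c,1}(n)=c^2/9$, $S_{c,2}(n)=(cn^c)^{2/(2c+1)}$, $S_{c,3}(n)=36n/\log^2 n$, and $S_{c,d}(n)=4n/g_d(\log n)$ for $d>3$, where $g_d$ is the inverse (for large arguments) of $x\mapsto x/\log^{(d-3)}x$, the logarithm being iterated $d-3$ times. **Theorem.** Let $c,d\ge 1$. For every function $f:\mathbb{N}\to\mathbb{N}$ with $f(n)=O(S_{c,d}(n))$ there is a local checker $L\in\mathcal{L}_{c,d}$ of exact diameter $f$, and $L$ can be chosen so as to accept trees of all attainable sizes in the following sense. 1. If $d\ge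 2$, there are $\kappa>0$ and $n_0$, depending only on $c$ and $d$ (not on $f$), such that $L$ accepts at least one tree with $n$ vertices, necessarily of diameter $f(n)$, for every $n\ge n_0$ with $2\le f(n)\le \kappa\, S_{c,d}(n)$. 2. If $d=1$ and $c\ge 2$, there are an absolute constant $\kappa>0$ and an $n_0$ depending only on $c$ such that $L$ accepts at least one tree with $n$ vertices, necessarily of diameter $f(n)$, for every $n\ge n_0$ with $2\le f(n)\le \max(2,\kappa\, c^2/9)$. In particular, if $d\ge2$ and $2\le f(n)\le\kappa\,S_{c,d}(n)$ for all $n\ge n_0$, then $L$ accepts trees of every size $n\ge n_0$, all of diameter exactly $f(n)$. -/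

import Mathlib

/-- A graph with vertices colored by `c` colors (the coloring need not be proper) and a marked
vertex, the center. -/
structure RootedColoredGraph (c : ℕ) where
  V : Type
  graph : SimpleGraph V
  color : V → Fin c
  root : V

/-- Isomorphism of rooted colored graphs. -/
def RootedColoredGraph.Isomorphic {c : ℕ} (A B : RootedColoredGraph c) : Prop :=
  ∃ e : A.graph ≃g B.graph, (∀ v, B.color (e v) = A.color v) ∧ e A.root = B.root

/-- The view at distance `d` of `v`: all vertices at distance at most `d` from `v`, and all edges
with at least one endpoint at distance at most `d - 1` (that is, less than `d`) from `v`; the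
vertex `v` is marked as the center. -/
def view {c : ℕ} {V : Type} (G : SimpleGraph V) (color : V → Fin c) (d : ℕ) (v : V) :
    RootedColoredGraph c where
  V := {w : V // G.edist v w ≤ (d : ℕ∞)}
  graph :=
    { Adj := fun a b => G.Adj a.1 b.1 ∧
        (G.edist v a.1 < (d : ℕ∞) ∨ G.edist v b.1 < (d : ℕ∞))
      symm := ⟨fun _ _ h => ⟨h.1.symm, h.2.symm⟩⟩
      loopless := ⟨fun _ h => h.1.ne rfl⟩ }
  color := fun w => color w.1
  root := ⟨v, by simp⟩

/-- A finite tree with vertices colored by `c` colors. -/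
structure ColoredTree (c : ℕ) where
  V : Type
  [fintype : Fintype V]
  graph : SimpleGraph V
  isTree : graph.IsTree
  color : V → Fin c

attribute [instance] ColoredTree.fintype

/-- The number of vertices of a tree. -/
def ColoredTree.order {c : ℕ} (T : ColoredTree c) : ℕ := Fintype.card T.V

/-- A local checker at distance `d` with `c` colors: an arbitrary accept/reject decision on views.
Networks are anonymous, so the decision depends only on the isomorphism class of the view. -/
structure LocalChecker (c d : ℕ) where
  accept : RootedColoredGraph c → Prop
  accept_iff_of_isomorphic : ∀ A B, A.Isomorphic B → (accept A ↔ accept B)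

namespace LocalChecker

variable {c d : ℕ}

/-- The class of colored trees such that the checker accepts the view at distance `d` of
every vertex. -/
def acceptedClass (L : LocalChecker c d) : Set (ColoredTree c) :=
  {T | ∀ v : T.V, L.accept (view T.graph T.color d v)}

/-- Every accepted tree with `n` vertices has diameter `f n`. -/
def HasExactDiameter (L : LocalChecker c d) (f : ℕ → ℕ) : Prop :=
  ∀ n : ℕ, ∀ T ∈ L.acceptedClass, T.order = n → T.graph.diam = f n

/-- Some tree with `n` vertices is accepted. -/
def AcceptsOrder (L : LocalChecker c d) (n : ℕ) : Prop :=
  ∃ T ∈ L.acceptedClass, T.order = n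

end LocalChecker

/-- The inverse `g_d` of `x ↦ x / log^{(d-3)} x` (for `d > 3`), the logarithm being iterated
`d - 3` times. That function is continuous and increasing on some `[x₀, ∞)` and tends to infinity
there, so for all large `y` the supremum below is the unique `x ≥ x₀` that is mapped to `y`. -/
noncomputable def gInv (d : ℕ) (y : ℝ) : ℝ :=
  sSup {x : ℝ | x / (Real.log^[d - 3]) x ≤ y}

/-- The threshold function `S_{c,d}(n)`; only `d ≥ 1` is meaningful. -/
noncomputable def threshold (c d : ℕ) (n : ℕ) : ℝ :=
  if d ≤ 1 then (c : ℝ) ^ 2 / 9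
  else if d = 2 then ((c : ℝ) * (n : ℝ) ^ c) ^ ((2 : ℝ) / (2 * (c : ℝ) + 1))
  else if d = 3 then 36 * (n : ℝ) / Real.log (n : ℝ) ^ 2
  else 4 * (n : ℝ) / gInv d (Real.log (n : ℝ))

/-! Fix a family F of trees whose diameter is f of their order, and let the checker accept exactly
the views that occur in members of F (`viewChecker`). Members are accepted, so everything rests on
local rigidity: a tree all of whose views occur in F, perhaps in different members, is isomorphic to
a member (`exists_checker_of_locallyRigid`).

The main members are comets: a center with N leaves and one long path. The length of the path fixes
the diameter, and N then adjusts the order. The path vertices carry labels, which are hanging trees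
of height e = d - 2 if d ≥ 2 and colors if d = 1. Consecutive labels determine their position and
direction, and the center shows where the path starts and how large N is. If d ≥ 2, trees with only
short branches at the root supply the small diameters; if d = 1, stars supply diameter 2.

Rigidity is `LabelSystem.Admissible.locallyRigid` and `PathColoring.Admissible.locallyRigid`. If
some vertex of T looks like the root of a member, the labels force T step by step down the path.
Otherwise each vertex points to the neighbor that plays the role of its parent. A tree has fewer
edges than vertices, so two neighbors point at each other
(`SimpleGraph.IsTree.exists_apply_apply_eq`). Reversed path edges are excluded by the labels. If d ≥
2, it remains that both branches at this edge are short enough to be seen completely, and then T is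
again a member.

The attainable diameters depend on the cost of labels. Write i = 4m + r and m = s² + t with 0 ≤ t ≤
2s. `walkCode` shows s at even i, t + s and the parity of s at odd i, and r always. Its values have
order √i, and two consecutive ones determine i. Hence c colors serve a path of length of order c² if
d = 1. If d = 2, a value x is encoded by multiplicities of the c colors with O(c x^(1/c)) vertices,
so a path of length k costs about k^(1 + 1/(2c)) up to factors in c.

If d ≥ 3, every label encodes its whole position by `treeCode`. A tree of height 1 lists the binary
digits 1, each position in unary; greater heights cut the number into 2^b blocks of b bits, tagged
and encoded recursively. Labels then have O(log n · log^(d-2) n) vertices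
(`exists_codeWeight_le_log`), and g_d(y) ≥ y log^(d-3) y (`mul_iterate_log_le_gInv`) shows that this
suffices. -/

open Finset

/-! ### Rooted colored trees and their graphs -/

/-- A finite rooted tree with colored vertices. -/
inductive RTree (c : ℕ) : Type
  | node (col : Fin c) (k : ℕ) (ch : Fin k → RTree c)

namespace RTree

variable {c : ℕ}

/-- The color of the root. -/
def rootColor : RTree c → Fin c
  | node col _ _ => col

/-- The list of subtrees at the children of the root. -/
def children : RTree c → List (RTree c)
  | node _ _ ch => List.ofFn ch

/-- The tree with given root color and list of child subtrees. -/
def mk (col : Fin c) (l : List (RTree c)) : RTree c := node col l.length l.get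

@[simp] theorem children_mk (col : Fin c) (l : List (RTree c)) : (mk col l).children = l := by
  simp [mk, children]

/-- The number of vertices. -/
def size : RTree c → ℕ
  | node _ _ ch => 1 + ∑ i, (ch i).size

theorem size_mk (col : Fin c) (l : List (RTree c)) : (mk col l).size = 1 + (l.map size).sum := by
  rw [mk, size, ← List.sum_ofFn]
  congr 2
  conv_rhs => rw [← List.ofFn_get l, List.map_ofFn]
  rfl

/-- The largest number of edges of a descending path from the root. -/
def height : RTree c → ℕ
  | node _ _ ch => univ.sup fun i => (ch i).height + 1

theorem height_le_iff {t : RTree c} {h : ℕ} :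
    t.height ≤ h ↔ ∀ s ∈ t.children, s.height + 1 ≤ h := by
  cases t with
  | node col k ch => simp [height, children, List.mem_ofFn]

theorem height_lt_of_mem_children {t s : RTree c} (hs : s ∈ t.children) : s.height < t.height :=
  height_le_iff.1 le_rfl s hs

theorem height_mk_eq {col : Fin c} {l : List (RTree c)} {h : ℕ} (hl : ∀ s ∈ l, s.height ≤ h)
    (hex : ∃ s ∈ l, s.height = h) : (mk col l).height = h + 1 := by
  apply le_antisymm
  · rw [height_le_iff]
    intro s hs
    rw [children_mk] at hs
    have := hl s hs
    omega
  · obtain ⟨s, hs, rfl⟩ := hex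
    exact height_lt_of_mem_children (t := mk col l) (by simpa using hs)

/-- The vertices of a rooted tree. -/
def Vert : RTree c → Type
  | node _ k ch => Option (Σ i : Fin k, (ch i).Vert)

/-- The vertices of a rooted tree form a finite type. -/
@[reducible] def vertFintype : (t : RTree c) → Fintype t.Vert
  | node _ k ch =>
    haveI := fun i => (ch i).vertFintype
    inferInstanceAs (Fintype (Option (Σ i : Fin k, (ch i).Vert)))

instance (t : RTree c) : Fintype t.Vert := t.vertFintype

theorem card_vert : ∀ t : RTree c, Fintype.card t.Vert = t.size
  | node col k ch => by
    have h : Fintype.card (node col k ch).Vert = Fintype.card (Option (Σ i : Fin k, (ch i).Vert)) :=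
      Fintype.card_congr (Equiv.refl _)
    rw [h, Fintype.card_option, Fintype.card_sigma, size, add_comm]
    congr 1
    exact Finset.sum_congr rfl fun i _ => card_vert (ch i)

/-- The root. -/
def root : (t : RTree c) → t.Vert
  | node _ _ _ => none

/-- The parent of a vertex; the root has none. -/
def parent : (t : RTree c) → t.Vert → Option t.Vert
  | node _ k ch => Option.map (α := Σ i : Fin k, (ch i).Vert)
      fun y => ((ch y.1).parent y.2).map (Sigma.mk y.1)
termination_by structural t => t

/-- The subtree hanging from a vertex. -/
def subtree : (t : RTree c) → t.Vert → RTree c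
  | node col k ch => fun x =>
      Option.elim (α := Σ i : Fin k, (ch i).Vert) x (node col k ch) fun y => (ch y.1).subtree y.2
termination_by structural t => t

/-- The distance of a vertex from the root. -/
def depth : (t : RTree c) → t.Vert → ℕ
  | node _ k ch => fun x =>
      Option.elim (α := Σ i : Fin k, (ch i).Vert) x 0 fun y => (ch y.1).depth y.2 + 1
termination_by structural t => t

@[simp] theorem subtree_root (t : RTree c) : t.subtree t.root = t := by cases t; rfl
@[simp] theorem depth_root (t : RTree c) : t.depth t.root = 0 := by cases t; rfl
@[simp] theorem parent_root (t : RTree c) : t.parent t.root = none := by cases t; rfl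

/-- The vertex `y` of the `i`-th child subtree as a vertex of the whole tree. -/
def inChild {col : Fin c} {k : ℕ} {ch : Fin k → RTree c} (i : Fin k) (y : (ch i).Vert) :
    (node col k ch).Vert :=
  some (⟨i, y⟩ : Σ i : Fin k, (ch i).Vert)

section inChild

variable {col : Fin c} {k : ℕ} {ch : Fin k → RTree c}

theorem eq_root_or_inChild (x : (node col k ch).Vert) :
    x = (node col k ch).root ∨ ∃ i, ∃ y : (ch i).Vert, x = inChild i y := by
  rcases (x : Option (Σ i : Fin k, (ch i).Vert)) with _ | ⟨i, y⟩
  · exact Or.inl rfl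
  · exact Or.inr ⟨i, y, rfl⟩

theorem fst_eq_of_inChild_eq {i j : Fin k} {y : (ch i).Vert} {z : (ch j).Vert}
    (h : (inChild i y : (node col k ch).Vert) = inChild j z) : i = j :=
  congrArg Sigma.fst (Option.some.inj h)

theorem inChild_injective (i : Fin k) :
    Function.Injective (inChild i : (ch i).Vert → (node col k ch).Vert) := fun _ _ h =>
  eq_of_heq (Sigma.mk.inj (Option.some.inj h)).2

theorem inChild_ne_root (i : Fin k) (y : (ch i).Vert) :
    (inChild i y : (node col k ch).Vert) ≠ (node col k ch).root := by
  intro h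
  exact Option.some_ne_none _ h

theorem parent_inChild (i : Fin k) (y : (ch i).Vert) :
    (node col k ch).parent (inChild i y) =
      some (((ch i).parent y).elim (node col k ch).root (inChild i)) := by
  rcases hy : (ch i).parent y with _ | q <;>
  · change some (((ch i).parent y).map (Sigma.mk (β := fun i => (ch i).Vert) i)) = _
    rw [hy]
    rfl

theorem subtree_inChild (i : Fin k) (y : (ch i).Vert) :
    (node col k ch).subtree (inChild i y) = (ch i).subtree y := rfl

theorem depth_inChild (i : Fin k) (y : (ch i).Vert) :
    (node col k ch).depth (inChild i y) = (ch i).depth y + 1 := rfl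

end inChild

theorem eq_root_of_parent_eq_none {t : RTree c} {x : t.Vert} (h : t.parent x = none) :
    x = t.root := by
  cases t with
  | node col k ch =>
    obtain rfl | ⟨i, y, rfl⟩ := eq_root_or_inChild x
    · rfl
    · rw [parent_inChild] at h
      cases h

theorem parent_inChild_eq_root {col : Fin c} {k : ℕ} {ch : Fin k → RTree c} {i : Fin k}
    {y : (ch i).Vert} (h : (node col k ch).parent (inChild i y) = some (node col k ch).root) :
    y = (ch i).root := by
  rw [parent_inChild] at h
  rcases hy : (ch i).parent y with _ | q
  · exact eq_root_of_parent_eq_none hy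
  · rw [hy] at h
    exact absurd (Option.some.inj h) (inChild_ne_root i q)

theorem parent_inChild_eq_inChild {col : Fin c} {k : ℕ} {ch : Fin k → RTree c} {i j : Fin k}
    {y : (ch i).Vert} {x : (ch j).Vert}
    (h : (node col k ch).parent (inChild i y) = some (inChild j x)) :
    ∃ y' : (ch j).Vert, (inChild i y : (node col k ch).Vert) = inChild j y' ∧
      (ch j).parent y' = some x := by
  rw [parent_inChild] at h
  rcases hy : (ch i).parent y with _ | q
  · rw [hy] at h
    exact absurd (Option.some.inj h).symm (inChild_ne_root j x)
  · rw [hy] at h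
    have h := Option.some.inj h
    obtain rfl := fst_eq_of_inChild_eq h
    obtain rfl := inChild_injective i h
    exact ⟨y, rfl, hy⟩

theorem depth_eq_of_parent : ∀ {t : RTree c} {x p : t.Vert}, t.parent x = some p →
    t.depth x = t.depth p + 1
  | node col k ch, x, p, h => by
    obtain rfl | ⟨i, y, rfl⟩ := eq_root_or_inChild x
    · rw [parent_root] at h
      cases h
    · obtain rfl | ⟨j, z, rfl⟩ := eq_root_or_inChild p
      · rw [parent_inChild_eq_root h, depth_inChild, depth_root, depth_root]
      · obtain ⟨y', hy', h'⟩ := parent_inChild_eq_inChild h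
        rw [hy', depth_inChild, depth_inChild, depth_eq_of_parent h']

/-- Adjacency is defined through `parent`, shapes through lists of children; this is the dictionary
between the two. -/
theorem exists_children_equiv : ∀ {t : RTree c} (x : t.Vert) {col : Fin c} {k : ℕ}
    {ch : Fin k → RTree c}, t.subtree x = node col k ch →
    ∃ σ : Fin k ≃ {y // t.parent y = some x}, ∀ i, t.subtree (σ i) = ch i
  | node col k ch, x, col', k', ch', h => by
    obtain rfl | ⟨i, x, rfl⟩ := eq_root_or_inChild x
    · rw [subtree_root] at h
      injection h with h1 h2 h3
      subst h2
      obtain rfl := eq_of_heq h3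
      refine ⟨Equiv.ofBijective (fun i => ⟨inChild i (ch i).root, ?_⟩) ⟨?_, ?_⟩, ?_⟩
      · rw [parent_inChild, parent_root, Option.elim_none]
      · intro i j hij
        exact fst_eq_of_inChild_eq (congrArg Subtype.val hij)
      · rintro ⟨y, hy⟩
        obtain rfl | ⟨i, y, rfl⟩ := eq_root_or_inChild y
        · rw [parent_root] at hy
          cases hy
        · exact ⟨i, Subtype.ext (congrArg (inChild i) (parent_inChild_eq_root hy).symm)⟩
      · intro i
        exact subtree_root _
    · rw [subtree_inChild] at h
      obtain ⟨σ, hσ⟩ := exists_children_equiv x h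
      refine ⟨Equiv.ofBijective (fun j => ⟨inChild i (σ j), ?_⟩) ⟨?_, ?_⟩, ?_⟩
      · rw [parent_inChild, (σ j).2, Option.elim_some]
      · intro j j' hij
        exact σ.injective (Subtype.ext (inChild_injective i (congrArg Subtype.val hij)))
      · rintro ⟨y, hy⟩
        obtain rfl | ⟨i', y, rfl⟩ := eq_root_or_inChild y
        · rw [parent_root] at hy
          cases hy
        · obtain ⟨y', hy', h'⟩ := parent_inChild_eq_inChild hy
          refine ⟨σ.symm ⟨y', h'⟩, Subtype.ext (Eq.trans ?_ hy'.symm)⟩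
          exact congrArg (fun z => inChild i (Subtype.val z)) (σ.apply_symm_apply ⟨y', h'⟩)
      · intro j
        exact hσ j

theorem subtree_mem_children {t : RTree c} {x p : t.Vert} (h : t.parent x = some p) :
    t.subtree x ∈ (t.subtree p).children := by
  rcases hs : t.subtree p with ⟨col, k, ch⟩
  obtain ⟨σ, hσ⟩ := exists_children_equiv p hs
  have := hσ (σ.symm ⟨x, h⟩)
  rw [Equiv.apply_symm_apply] at this
  rw [this]
  simp [children]

/-- The underlying graph of a rooted tree. -/
def graph (t : RTree c) : SimpleGraph t.Vert where
  Adj x y := t.parent x = some y ∨ t.parent y = some x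
  symm := ⟨fun _ _ h => h.symm⟩
  loopless := ⟨fun x h => by
    have h : t.parent x = some x := h.elim id id
    have := depth_eq_of_parent h
    omega⟩

theorem graph_adj {t : RTree c} {x y : t.Vert} :
    t.graph.Adj x y ↔ t.parent x = some y ∨ t.parent y = some x := Iff.rfl

/-- The color of a vertex. -/
def color (t : RTree c) (x : t.Vert) : Fin c := (t.subtree x).rootColor

theorem reachable_root (t : RTree c) (x : t.Vert) : t.graph.Reachable x t.root := by
  induction h : t.depth x generalizing x with
  | zero =>
    rcases hp : t.parent x with _ | p
    · rw [eq_root_of_parent_eq_none hp]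
    · have := depth_eq_of_parent hp
      omega
  | succ n ih =>
    rcases hp : t.parent x with _ | p
    · rw [eq_root_of_parent_eq_none hp]
    · have := depth_eq_of_parent hp
      exact (SimpleGraph.Adj.reachable (Or.inl hp)).trans (ih p (by omega))

theorem graph_connected (t : RTree c) : t.graph.Connected :=
  { preconnected := fun x y => (t.reachable_root x).trans (t.reachable_root y).symm
    nonempty := ⟨t.root⟩ }

theorem graph_isTree (t : RTree c) : t.graph.IsTree := by
  classical
  rw [SimpleGraph.isTree_iff_connected_and_card]
  refine ⟨t.graph_connected, le_antisymm ?_ t.graph_connected.card_vert_le_card_edgeSet_add_one⟩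
  -- Every edge joins a vertex other than the root to its parent, so there are at most n - 1 edges.
  -- The default of `getD` never occurs, as only the root lacks a parent.
  let F : {x // x ≠ t.root} → t.graph.edgeSet := fun x =>
    ⟨s(x.1, (t.parent x.1).getD x.1), by
      rcases hp : t.parent x.1 with _ | p
      · exact absurd (eq_root_of_parent_eq_none hp) x.2
      · exact Or.inl hp⟩
  have hF : Function.Surjective F := by
    have key : ∀ x y : t.Vert, t.parent x = some y → ∃ z, (F z).1 = s(x, y) := by
      intro x y h
      refine ⟨⟨x, ?_⟩, ?_⟩
      · rintro rfl; simp at h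
      · simp [F, h]
    rintro ⟨ed, he⟩
    induction ed with
    | h x y =>
      rcases he with h | h
      · obtain ⟨z, hz⟩ := key x y h
        exact ⟨z, Subtype.ext hz⟩
      · obtain ⟨z, hz⟩ := key y x h
        exact ⟨z, Subtype.ext (hz.trans Sym2.eq_swap)⟩
  have h1 := Nat.card_le_card_of_surjective F hF
  have h2 : Nat.card {x // x ≠ t.root} + 1 = Nat.card t.Vert := by
    rw [Nat.card_eq_fintype_card, Nat.card_eq_fintype_card, Fintype.card_subtype_compl,
      Fintype.card_subtype_eq]
    have : 0 < Fintype.card t.Vert := Fintype.card_pos_iff.2 ⟨t.root⟩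
    omega
  omega

/-- A rooted tree as a colored tree. -/
def toColoredTree (t : RTree c) : ColoredTree c where
  V := t.Vert
  graph := t.graph
  isTree := t.graph_isTree
  color := t.color

theorem order_toColoredTree (t : RTree c) : t.toColoredTree.order = t.size := t.card_vert

end RTree

/-! ### Equal multisets of values and bijections -/

theorem exists_equiv_of_map_univ_eq {α β γ : Type*} [Fintype α] [Fintype β] (f : α → γ) (g : β → γ)
    (h : (univ : Finset α).val.map f = (univ : Finset β).val.map g) :
    ∃ e : α ≃ β, ∀ a, g (e a) = f a := by
  classical
  have hc : ∀ x, Fintype.card {a // f a = x} = Fintype.card {b // g b = x} := by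
    intro x
    have := congrArg (Multiset.count x) h
    rw [Multiset.count_map, Multiset.count_map] at this
    rw [Fintype.card_subtype, Fintype.card_subtype]
    simpa [Finset.card, Finset.filter, eq_comm] using this
  let E : (x : γ) → {a // f a = x} ≃ {b // g b = x} := fun x => Fintype.equivOfCardEq (hc x)
  refine ⟨(Equiv.sigmaFiberEquiv f).symm.trans
    ((Equiv.sigmaCongrRight E).trans (Equiv.sigmaFiberEquiv g)), fun a => ?_⟩
  exact (E (f a) ⟨a, rfl⟩).2

theorem exists_equiv_of_map_val_eq {α β γ : Type*} {s : Finset α} {t : Finset β} {f : α → γ}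
    {g : β → γ} (h : s.val.map f = t.val.map g) : ∃ e : s ≃ t, ∀ a : s, g (e a) = f a := by
  apply exists_equiv_of_map_univ_eq (fun a : s => f a) (fun b : t => g b)
  rw [univ_eq_attach, univ_eq_attach, attach_val, attach_val]
  have h1 := congrArg (Multiset.map f) (Multiset.attach_map_val s.val)
  have h2 := congrArg (Multiset.map g) (Multiset.attach_map_val t.val)
  rw [Multiset.map_map] at h1 h2
  exact h1.trans (h.trans h2.symm)

theorem map_val_eq_of_equiv {α β γ : Type*} {s : Finset α} {t : Finset β} {f : α → γ}
    {g : β → γ} (e : s ≃ t) (h : ∀ a : s, g (e a) = f a) : s.val.map f = t.val.map g := by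
  refine Multiset.map_eq_map_of_bij_of_nodup f g s.2 t.2 (fun a ha => e ⟨a, ha⟩) ?_ ?_ ?_ ?_
  · intro a ha
    exact (e ⟨a, ha⟩).2
  · intro a ha b hb hab
    exact congrArg Subtype.val (e.injective (Subtype.ext hab))
  · intro b hb
    exact ⟨e.symm ⟨b, hb⟩, (e.symm ⟨b, hb⟩).2, by simp⟩
  · intro a ha
    exact (h ⟨a, ha⟩).symm

/-! ### Truncated isomorphism types of trees and branches -/

/-- Isomorphism types of rooted colored trees, cut off at depth `h`. -/
def Shape (c : ℕ) : ℕ → Type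
  | 0 => Fin c
  | h + 1 => Fin c × Multiset (Shape c h)

namespace Shape

variable {c : ℕ}

/-- Cutting off the last level. -/
def trunc : {h : ℕ} → Shape c (h + 1) → Shape c h
  | 0, s => s.1
  | _ + 1, s => (s.1, s.2.map trunc)

/-- No vertex lies at the last level. -/
def Closed : {h : ℕ} → Shape c h → Prop
  | 0, _ => False
  | _ + 1, s => ∀ r ∈ s.2, Closed r

theorem trunc_succ {h : ℕ} (a : Fin c) (m : Multiset (Shape c (h + 1))) :
    trunc (h := h + 1) (a, m) = (a, m.map trunc) := rfl

theorem closed_succ {h : ℕ} {a : Fin c} {m : Multiset (Shape c h)} :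
    Closed (h := h + 1) (a, m) ↔ ∀ r ∈ m, Closed r := Iff.rfl

end Shape

namespace RTree

variable {c : ℕ}

/-- The shape of a rooted tree at depth `h`. -/
def shape : (h : ℕ) → RTree c → Shape c h
  | 0, t => t.rootColor
  | h + 1, t => (t.rootColor, (t.children : Multiset (RTree c)).map (shape h))

theorem shape_succ (h : ℕ) (t : RTree c) :
    t.shape (h + 1) = (t.rootColor, (t.children : Multiset (RTree c)).map (shape h)) := rfl

theorem trunc_shape (h : ℕ) (t : RTree c) : (t.shape (h + 1)).trunc = t.shape h := by
  induction h generalizing t with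
  | zero => rfl
  | succ h ih =>
    rw [shape_succ, shape_succ, Shape.trunc_succ, Multiset.map_map]
    exact Prod.ext rfl (Multiset.map_congr (s := (t.children : Multiset (RTree c))) rfl
      fun s _ => ih s)

theorem closed_shape_iff (h : ℕ) (t : RTree c) : (t.shape h).Closed ↔ t.height < h := by
  induction h generalizing t with
  | zero => simp [Shape.Closed]
  | succ h ih =>
    rw [Nat.lt_succ_iff, height_le_iff, shape_succ, Shape.closed_succ]
    simp [ih]

end RTree

section Branch

variable {c : ℕ} {V : Type} [Fintype V] (G : SimpleGraph V) (col : V → Fin c)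

open Classical in
/-- The neighbors of `v` other than `p`; in particular, all neighbors if `p = v`. -/
noncomputable def nbr (p v : V) : Finset V := univ.filter fun w => G.Adj v w ∧ w ≠ p

/-- The shape at depth `h` of the branch at `v` on the side away from `p`, or of the whole graph
seen from `v` if `p = v`. -/
noncomputable def branch : (h : ℕ) → V → V → Shape c h
  | 0, _, v => col v
  | h + 1, p, v => (col v, (nbr G p v).val.map (branch h v))

/-- The branch at `v` on the side away from `p` is isomorphic to a given rooted tree. -/
def Represents : RTree c → V → V → Prop
  | RTree.node a k ch, p, v => col v = a ∧
      ∃ σ : Fin k ≃ {w // w ∈ nbr G p v}, ∀ i, Represents (ch i) v (σ i)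

variable {G col}

theorem mem_nbr {p v w : V} : w ∈ nbr G p v ↔ G.Adj v w ∧ w ≠ p := by simp [nbr]

theorem mem_nbr_self {v w : V} : w ∈ nbr G v v ↔ G.Adj v w := by
  rw [mem_nbr]
  exact ⟨fun h => h.1, fun h => ⟨h, h.ne'⟩⟩

theorem branch_succ (h : ℕ) (p v : V) :
    branch G col (h + 1) p v = (col v, (nbr G p v).val.map (branch G col h v)) := rfl

/-- Cancelling one term in this identity is how the branch at v away from w is read off from the
view of v. -/
theorem map_nbr_self {γ : Type*} (f : V → γ) {v w : V} (h : G.Adj v w) :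
    (nbr G v v).val.map f = f w ::ₘ (nbr G w v).val.map f := by
  classical
  have h1 : nbr G v v = Finset.cons w (nbr G w v) (by simp [mem_nbr]) := by
    ext x
    rw [mem_nbr_self, mem_cons, mem_nbr]
    constructor
    · intro hx
      by_cases hxw : x = w
      · exact Or.inl hxw
      · exact Or.inr ⟨hx, hxw⟩
    · rintro (rfl | hx)
      · exact h
      · exact hx.1
  rw [h1, cons_val, Multiset.map_cons]

theorem trunc_branch (h : ℕ) (p v : V) :
    (branch G col (h + 1) p v).trunc = branch G col h p v := by
  induction h generalizing p v with
  | zero => rfl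
  | succ h ih =>
    rw [branch_succ, branch_succ, Shape.trunc_succ, Multiset.map_map]
    refine Prod.ext rfl ?_
    exact Multiset.map_congr rfl fun s _ => ih _ s

theorem represents_iff {t : RTree c} {p v : V} :
    Represents G col t p v ↔ col v = t.rootColor ∧ ∃ τ : V → RTree c,
      (nbr G p v).val.map τ = (t.children : Multiset (RTree c)) ∧
      ∀ w ∈ nbr G p v, Represents G col (τ w) v w := by
  classical
  cases t with
  | node a k ch =>
    have hch : ((RTree.node a k ch).children : Multiset (RTree c)) =
        (univ : Finset (Fin k)).val.map ch := by
      rw [Fin.univ_val_map]; rfl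
    rw [Represents, hch]
    refine and_congr_right fun _ => ⟨?_, ?_⟩
    · rintro ⟨σ, hσ⟩
      refine ⟨fun w => if hw : w ∈ nbr G p v then ch (σ.symm ⟨w, hw⟩) else RTree.node a k ch,
        ?_, ?_⟩
      · refine (map_val_eq_of_equiv (s := univ)
          ((Equiv.subtypeUnivEquiv fun x => Finset.mem_univ x).trans σ) ?_).symm
        intro i
        simp
      · intro w hw
        simp only [dif_pos hw]
        have := hσ (σ.symm ⟨w, hw⟩)
        rwa [Equiv.apply_symm_apply] at this
    · rintro ⟨τ, hτ, h⟩
      obtain ⟨e, he⟩ := exists_equiv_of_map_val_eq hτ.symm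
      refine ⟨(Equiv.subtypeUnivEquiv fun x => Finset.mem_univ x).symm.trans e, fun i => ?_⟩
      have := h _ (e ⟨i, mem_univ i⟩).2
      rw [he] at this
      exact this

theorem Represents.branch_eq {t : RTree c} {p v : V} (h : Represents G col t p v) (n : ℕ) :
    branch G col n p v = t.shape n := by
  induction n generalizing t p v with
  | zero => exact (represents_iff.1 h).1
  | succ n ih =>
    obtain ⟨hc, τ, hτ, h⟩ := represents_iff.1 h
    rw [branch_succ, RTree.shape_succ, hc, ← hτ, Multiset.map_map]
    refine Prod.ext rfl ?_
    exact Multiset.map_congr rfl fun w hw => ih (h w hw)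

/-- As n exceeds the height, the truncated shape also records that the lowest vertices have no
children, so nothing is hidden below it. -/
theorem represents_of_branch_eq {n : ℕ} {t : RTree c} {p v : V}
    (h : branch G col n p v = t.shape n) (ht : t.height < n) : Represents G col t p v := by
  classical
  induction n generalizing t p v with
  | zero => omega
  | succ n ih =>
    rw [branch_succ, RTree.shape_succ] at h
    have h1 := congrArg Prod.fst h
    have h2 : (nbr G p v).val.map (branch G col n v) =
      (t.children : Multiset (RTree c)).map (RTree.shape n) := congrArg Prod.snd h
    cases t with
    | node a k ch =>
      have hch : ((RTree.node a k ch).children : Multiset (RTree c)) =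
          (univ : Finset (Fin k)).val.map ch := by
        rw [Fin.univ_val_map]; rfl
      rw [hch, Multiset.map_map] at h2
      obtain ⟨e, he⟩ := exists_equiv_of_map_val_eq h2.symm
      refine ⟨h1, (Equiv.subtypeUnivEquiv fun x => Finset.mem_univ x).symm.trans e, fun i => ?_⟩
      refine ih (he ⟨i, mem_univ i⟩) ?_
      have := RTree.height_lt_of_mem_children (t := RTree.node a k ch) (s := ch i)
        (by simp [RTree.children])
      omega

theorem exists_represents_of_closed {n : ℕ} {p v : V} (h : (branch G col n p v).Closed) :
    ∃ t : RTree c, t.height < n ∧ Represents G col t p v := by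
  induction n generalizing p v with
  | zero => exact h.elim
  | succ n ih =>
    have h' : ∀ w ∈ nbr G p v, ∃ t : RTree c, t.height < n ∧ Represents G col t v w := by
      intro w hw
      exact ih (h _ (Multiset.mem_map_of_mem (branch G col n v) hw))
    have : Nonempty (RTree c) := ⟨RTree.mk (col v) []⟩
    choose! τ hτ using h'
    refine ⟨RTree.mk (col v) ((nbr G p v).val.map τ).toList, ?_, ?_⟩
    · rw [Nat.lt_succ_iff, RTree.height_le_iff, RTree.children_mk]
      intro s hs
      rw [Multiset.mem_toList, Multiset.mem_map] at hs
      obtain ⟨w, hw, rfl⟩ := hs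
      exact (hτ w hw).1
    · rw [represents_iff]
      refine ⟨rfl, τ, ?_, fun w hw => (hτ w hw).2⟩
      rw [RTree.children_mk, Multiset.coe_toList]

/-- Views at distance `d` determine branch shapes at depth `d`. -/
theorem branch_eq_of_isomorphic {V' : Type} [Fintype V'] {G' : SimpleGraph V'} {col' : V' → Fin c}
    {d : ℕ} {v : V} {x : V'} (h : (view G col d v).Isomorphic (view G' col' d x)) :
    branch G col d v v = branch G' col' d x x := by
  obtain ⟨e, hcol, hroot⟩ := h
  -- Here j bounds the distance from the center on both sides. While j < d, the view contains all
  -- edges at w, so neighborhoods correspond completely.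
  have key : ∀ (n j : ℕ) (p w : (view G col d v).V), j + n ≤ d → G.edist v w.1 ≤ (j : ℕ∞) →
      G'.edist x (e w).1 ≤ (j : ℕ∞) →
      branch G col n p.1 w.1 = branch G' col' n (e p).1 (e w).1 := by
    intro n
    induction n with
    | zero =>
      intro j p w _ _ _
      exact (hcol w).symm
    | succ n ih =>
      intro j p w hj h1 h2
      have hlt : (j : ℕ∞) < (d : ℕ∞) := by exact_mod_cast (by omega : j < d)
      have hj1 : ((j + 1 : ℕ) : ℕ∞) ≤ (d : ℕ∞) := by exact_mod_cast (by omega : j + 1 ≤ d)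
      have step : ∀ u, G.Adj w.1 u → G.edist v u ≤ ((j + 1 : ℕ) : ℕ∞) := by
        intro u hu
        refine (G.edist_triangle (v := w.1)).trans ?_
        rw [SimpleGraph.edist_eq_one_iff_adj.2 hu]
        push_cast
        gcongr
      have step' : ∀ u, G'.Adj (e w).1 u → G'.edist x u ≤ ((j + 1 : ℕ) : ℕ∞) := by
        intro u hu
        refine (G'.edist_triangle (v := (e w).1)).trans ?_
        rw [SimpleGraph.edist_eq_one_iff_adj.2 hu]
        push_cast
        gcongr
      rw [branch_succ, branch_succ]
      refine Prod.ext (hcol w).symm ?_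
      refine Multiset.map_eq_map_of_bij_of_nodup _ _ (nbr G p.1 w.1).2
        (nbr G' (e p).1 (e w).1).2
        (fun u hu => (e ⟨u, (step u (mem_nbr.1 hu).1).trans hj1⟩).1) ?_ ?_ ?_ ?_
      · intro u hu
        have hu' := mem_nbr.1 hu
        refine mem_nbr.2 ⟨?_, ?_⟩
        · exact (e.map_rel_iff.2 (show (view G col d v).graph.Adj w ⟨u, _⟩ from
            ⟨hu'.1, Or.inl (h1.trans_lt hlt)⟩)).1
        · intro h
          have := e.injective (Subtype.ext h)
          exact hu'.2 (congrArg Subtype.val this)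
      · intro u hu u' hu' h
        have := e.injective (Subtype.ext h)
        exact congrArg Subtype.val this
      · intro u hu
        have hu' := mem_nbr.1 hu
        let u0 : (view G' col' d x).V := ⟨u, (step' u hu'.1).trans hj1⟩
        have hadj : (view G col d v).graph.Adj w (e.symm u0) := by
          rw [← e.map_rel_iff, RelIso.apply_symm_apply]
          exact ⟨hu'.1, Or.inl (h2.trans_lt hlt)⟩
        refine ⟨(e.symm u0).1, mem_nbr.2 ⟨hadj.1, ?_⟩, ?_⟩
        · intro h
          have h3 : e.symm u0 = p := Subtype.ext h
          have h4 : u0 = e p := by rw [← h3, RelIso.apply_symm_apply]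
          exact hu'.2 (congrArg Subtype.val h4)
        · exact congrArg Subtype.val (e.apply_symm_apply u0)
      · intro u hu
        have hu' := mem_nbr.1 hu
        refine ih (j + 1) w ⟨u, (step u hu'.1).trans hj1⟩ (by omega) (step u hu'.1) ?_
        refine step' _ ?_
        exact (e.map_rel_iff.2 (show (view G col d v).graph.Adj w ⟨u, _⟩ from
            ⟨hu'.1, Or.inl (h1.trans_lt hlt)⟩)).1
  have h0 := key d 0 (view G col d v).root (view G col d v).root (by omega)
    (by simp [view]) (by rw [hroot]; simp [view])
  rw [hroot] at h0
  exact h0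

end Branch

namespace RTree

variable {c : ℕ}

theorem nbr_eq_of_parent {t : RTree c} {x p w : t.Vert}
    (h : t.parent x = some p ∨ t.parent x = none ∧ p = x) :
    w ∈ nbr t.graph p x ↔ t.parent w = some x := by
  rw [mem_nbr, graph_adj]
  constructor
  · rintro ⟨h1 | h1, h2⟩
    · rcases h with h | h
      · rw [h1] at h
        exact absurd (Option.some.inj h) h2
      · rw [h1] at h
        cases h.1
    · exact h1
  · intro hw
    refine ⟨Or.inr hw, ?_⟩
    have := depth_eq_of_parent hw
    rintro rfl
    rcases h with h | ⟨_, rfl⟩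
    · have := depth_eq_of_parent h
      omega
    · omega

theorem represents_subtree (t : RTree c) {x p : t.Vert}
    (h : t.parent x = some p ∨ t.parent x = none ∧ p = x) :
    Represents t.graph t.color (t.subtree x) p x := by
  induction hs : t.subtree x generalizing x p with
  | node col k ch ih =>
    obtain ⟨σ, hσ⟩ := exists_children_equiv x hs
    refine ⟨by rw [color, hs]; rfl,
      σ.trans (Equiv.subtypeEquivRight fun w => (nbr_eq_of_parent h).symm), fun i => ?_⟩
    exact ih i (Or.inl (σ i).2) (hσ i)

theorem represents_self (t : RTree c) : Represents t.graph t.color t t.root t.root := by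
  have := t.represents_subtree (x := t.root) (p := t.root) (Or.inr ⟨t.parent_root, rfl⟩)
  rwa [subtree_root] at this

end RTree

/-! ### Representation by a rooted tree implies isomorphism -/

section Iso

variable {c : ℕ} {V : Type} [Fintype V] {G : SimpleGraph V} {col : V → Fin c}

/-- The map unfolds the tree along walks that never turn back: the children of x go bijectively to
the neighbors of its image other than the image of its parent, where p stands in for the parent of
the root. -/
theorem Represents.exists_map {t : RTree c} {p v : V} (h : Represents G col t p v) :
    ∃ φ : t.Vert → V, φ t.root = v ∧
      (∀ x y, t.parent y = some x → φ y ∈ nbr G ((t.parent x).elim p φ) (φ x)) ∧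
      (∀ x y y', t.parent y = some x → t.parent y' = some x → φ y = φ y' → y = y') ∧
      (∀ x, ∀ w ∈ nbr G ((t.parent x).elim p φ) (φ x), ∃ y, t.parent y = some x ∧ φ y = w) := by
  induction t generalizing p v with
  | node a k ch ih =>
    obtain ⟨_, σ, hσ⟩ := h
    choose ψ hroot hadj hinj hsurj using fun i => ih i (hσ i)
    let φ : (RTree.node a k ch).Vert → V := fun x =>
      Option.elim (α := Σ i : Fin k, (ch i).Vert) x v fun y => ψ y.1 y.2
    have hφ0 : φ (RTree.node a k ch).root = v := rfl
    have hφ : ∀ i (y : (ch i).Vert), φ (RTree.inChild i y) = ψ i y := fun _ _ => rfl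
    have hpar : ∀ i (x : (ch i).Vert),
        ((RTree.node a k ch).parent (RTree.inChild i x)).elim p φ = ((ch i).parent x).elim v (ψ i) := by
      intro i x
      rw [RTree.parent_inChild]
      rcases (ch i).parent x with _ | q <;> rfl
    refine ⟨φ, hφ0, ?_, ?_, ?_⟩
    · intro x y hxy
      obtain rfl | ⟨i, y, rfl⟩ := RTree.eq_root_or_inChild y
      · rw [RTree.parent_root] at hxy
        cases hxy
      · obtain rfl | ⟨j, x, rfl⟩ := RTree.eq_root_or_inChild x
        · rw [RTree.parent_inChild_eq_root hxy, hφ, hroot, RTree.parent_root, hφ0]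
          exact (σ i).2
        · obtain ⟨y', hy', h'⟩ := RTree.parent_inChild_eq_inChild hxy
          rw [hy', hpar, hφ, hφ]
          exact hadj j x y' h'
    · intro x y y' h1 h2 h
      obtain rfl | ⟨i, y, rfl⟩ := RTree.eq_root_or_inChild y
      · rw [RTree.parent_root] at h1
        cases h1
      obtain rfl | ⟨i', y', rfl⟩ := RTree.eq_root_or_inChild y'
      · rw [RTree.parent_root] at h2
        cases h2
      obtain rfl | ⟨j, x, rfl⟩ := RTree.eq_root_or_inChild x
      · obtain rfl := RTree.parent_inChild_eq_root h1
        obtain rfl := RTree.parent_inChild_eq_root h2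
        rw [hφ, hφ, hroot, hroot] at h
        obtain rfl := σ.injective (Subtype.ext h)
        rfl
      · obtain ⟨z, hz, h1'⟩ := RTree.parent_inChild_eq_inChild h1
        obtain ⟨z', hz', h2'⟩ := RTree.parent_inChild_eq_inChild h2
        rw [hz, hz'] at h ⊢
        rw [hφ, hφ] at h
        rw [hinj j x z z' h1' h2' h]
    · intro x w hw
      obtain rfl | ⟨j, x, rfl⟩ := RTree.eq_root_or_inChild x
      · rw [RTree.parent_root, hφ0] at hw
        refine ⟨RTree.inChild (σ.symm ⟨w, hw⟩) (RTree.root _), ?_, ?_⟩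
        · rw [RTree.parent_inChild, RTree.parent_root, Option.elim_none]
        · rw [hφ, hroot, Equiv.apply_symm_apply]
      · rw [hpar, hφ] at hw
        obtain ⟨y, hy, rfl⟩ := hsurj j x w hw
        refine ⟨RTree.inChild j y, ?_, hφ j y⟩
        rw [RTree.parent_inChild, hy, Option.elim_some]

theorem SimpleGraph.IsTree.eq_of_dist_add_one_eq {V : Type*} {G : SimpleGraph V} (hG : G.IsTree)
    {z v p w : V} (hp : G.Adj v p)
    (hw : G.Adj v w) (h1 : G.dist z p + 1 = G.dist z v) (h2 : G.dist z w + 1 = G.dist z v) :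
    p = w := by
  have key : ∀ u, G.Adj v u → G.dist z u + 1 = G.dist z v →
      ∃ q : G.Walk z v, q.IsPath ∧ q.penultimate = u := by
    intro u hu hd
    obtain ⟨q, hq⟩ := hG.connected.exists_walk_length_eq_dist z u
    refine ⟨q.concat hu.symm, ?_, by simp⟩
    apply SimpleGraph.Walk.isPath_of_length_eq_dist
    rw [SimpleGraph.Walk.length_concat, hq, hd]
  obtain ⟨q, hq, rfl⟩ := key p hp h1
  obtain ⟨q', hq', rfl⟩ := key w hw h2
  have := (hG.existsUnique_path z v).unique hq hq'
  rw [this]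

/-- In a tree, a walk that never turns back keeps moving away from its start, so depth becomes
distance from z. Equal images then have equal parent images, which yields injectivity by induction;
surjectivity follows from connectedness. -/
theorem Represents.nonempty_iso {t : RTree c} {z : V} (hG : G.IsTree)
    (h : Represents G col t z z) : Nonempty (t.graph ≃g G) := by
  obtain ⟨φ, hroot, hadj, hinj, hsurj⟩ := h.exists_map
  have hadj' : ∀ x y, t.parent y = some x → G.Adj (φ x) (φ y) := fun x y hxy =>
    (mem_nbr.1 (hadj x y hxy)).1
  have hdist : ∀ x, G.dist z (φ x) = t.depth x := by
    intro x
    induction hn : t.depth x using Nat.strong_induction_on generalizing x with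
    | _ n ih =>
      rcases hx : t.parent x with _ | p
      · obtain rfl := RTree.eq_root_of_parent_eq_none hx
        rw [RTree.depth_root] at hn
        rw [hroot, ← hn, SimpleGraph.dist_self]
      · have hd := RTree.depth_eq_of_parent hx
        have h1 := ih _ (by omega) p rfl
        have h2 := hG.dist_eq_dist_add_one_of_adj z (hadj' p x hx)
        rcases h2 with h2 | h2
        · exfalso
          rcases hp : t.parent p with _ | q
          · obtain rfl := RTree.eq_root_of_parent_eq_none hp
            rw [hroot, SimpleGraph.dist_self] at h2
            omega
          · have hd' := RTree.depth_eq_of_parent hp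
            have h3 := ih _ (by omega) q rfl
            have h4 := hG.eq_of_dist_add_one_eq (z := z) (hadj' q p hp).symm (hadj' p x hx)
              (by omega) (by omega)
            have h5 := (mem_nbr.1 (hadj p x hx)).2
            rw [hp] at h5
            exact h5 h4.symm
        · omega
  have hφinj : Function.Injective φ := by
    intro x y hxy
    induction hn : t.depth x generalizing x y with
    | zero =>
      have h1 := hdist x
      have h2 := hdist y
      rw [hxy] at h1
      have key : ∀ u, t.depth u = 0 → u = t.root := by
        intro u hu
        rcases hp : t.parent u with _ | p
        · exact RTree.eq_root_of_parent_eq_none hp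
        · have := RTree.depth_eq_of_parent hp
          omega
      rw [key x hn, key y (by omega)]
    | succ n ih =>
      have h1 := hdist x
      have h2 := hdist y
      rw [hxy] at h1
      rcases hp : t.parent x with _ | p
      · rw [RTree.eq_root_of_parent_eq_none hp, RTree.depth_root] at hn
        omega
      rcases hq : t.parent y with _ | q
      · have : t.depth y = 0 := by rw [RTree.eq_root_of_parent_eq_none hq, RTree.depth_root]
        omega
      have hd1 := RTree.depth_eq_of_parent hp
      have hd2 := RTree.depth_eq_of_parent hq
      have h3 := hdist p
      have h4 := hdist q
      have h5 : φ p = φ q := by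
        refine hG.eq_of_dist_add_one_eq (z := z) (v := φ y) ?_ (hadj' q y hq).symm
          (by omega) (by omega)
        rw [← hxy]
        exact (hadj' p x hp).symm
      obtain rfl := ih h5 (by omega)
      exact hinj p x y hp hq hxy
  have hcover : ∀ x w, G.Adj (φ x) w → ∃ y, t.graph.Adj x y ∧ φ y = w := by
    intro x w hw
    by_cases hwp : w = (t.parent x).elim z φ
    · rcases hp : t.parent x with _ | p
      · rw [hp] at hwp
        rw [RTree.eq_root_of_parent_eq_none hp, hroot, hwp] at hw
        exact absurd rfl hw.ne
      · rw [hp] at hwp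
        exact ⟨p, Or.inl hp, hwp.symm⟩
    · obtain ⟨y, hy, rfl⟩ := hsurj x w (mem_nbr.2 ⟨hw, hwp⟩)
      exact ⟨y, Or.inr hy, rfl⟩
  have hφsurj : Function.Surjective φ := by
    intro w
    obtain ⟨q⟩ := hG.connected.preconnected z w
    have : ∀ (u w : V) (q : G.Walk u w), (∃ x, φ x = u) → ∃ x, φ x = w := by
      intro u w q
      induction q with
      | nil => exact id
      | cons h _ ih =>
        rintro ⟨x, rfl⟩
        obtain ⟨y, _, hy⟩ := hcover x _ h
        exact ih ⟨y, hy⟩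
    exact this z w q ⟨t.root, hroot⟩
  refine ⟨⟨Equiv.ofBijective φ ⟨hφinj, hφsurj⟩, ?_⟩⟩
  intro x y
  change G.Adj (φ x) (φ y) ↔ t.graph.Adj x y
  constructor
  · intro hxy
    obtain ⟨y', hy', h⟩ := hcover x _ hxy
    rwa [hφinj h] at hy'
  · rintro (hxy | hxy)
    · exact (hadj' y x hxy).symm
    · exact hadj' x y hxy

theorem SimpleGraph.Hom.edist_le {V W : Type*} {G : SimpleGraph V} {H : SimpleGraph W}
    (e : G →g H) (u v : V) : H.edist (e u) (e v) ≤ G.edist u v := by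
  by_cases h : G.Reachable u v
  · obtain ⟨p, hp⟩ := h.exists_walk_length_eq_edist
    rw [← hp, ← SimpleGraph.Walk.length_map e p]
    exact SimpleGraph.edist_le _
  · rw [SimpleGraph.edist_eq_top_of_not_reachable h]
    exact le_top

theorem SimpleGraph.Iso.edist_eq {V W : Type*} {G : SimpleGraph V} {H : SimpleGraph W}
    (e : G ≃g H) (u v : V) : H.edist (e u) (e v) = G.edist u v := by
  refine le_antisymm (SimpleGraph.Hom.edist_le e.toHom u v) ?_
  simpa using SimpleGraph.Hom.edist_le e.symm.toHom (e u) (e v)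

theorem SimpleGraph.Iso.diam_eq {W V : Type*} {G : SimpleGraph V} {H : SimpleGraph W}
    (e : G ≃g H) : G.diam = H.diam := by
  rw [SimpleGraph.diam, SimpleGraph.diam]
  congr 1
  apply le_antisymm
  · refine SimpleGraph.ediam_le_of_edist_le fun u v => ?_
    rw [← e.edist_eq]
    exact SimpleGraph.edist_le_ediam
  · refine SimpleGraph.ediam_le_of_edist_le fun u v => ?_
    rw [← e.symm.edist_eq]
    exact SimpleGraph.edist_le_ediam

/-- Two colored trees represented by the same rooted tree have the same order and diameter. -/
theorem order_and_diam_eq {T T' : ColoredTree c} {t : RTree c} {z : T.V} {z' : T'.V}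
    (h : Represents T.graph T.color t z z) (h' : Represents T'.graph T'.color t z' z') :
    T.order = T'.order ∧ T.graph.diam = T'.graph.diam := by
  obtain ⟨e⟩ := h.nonempty_iso T.isTree
  obtain ⟨e'⟩ := h'.nonempty_iso T'.isTree
  exact ⟨(Fintype.card_congr e.toEquiv).symm.trans (Fintype.card_congr e'.toEquiv),
    e.diam_eq.symm.trans e'.diam_eq⟩

end Iso

/-! ### Distances and diameters in rooted trees -/

theorem SimpleGraph.Connected.abs_sub_le_dist {V : Type*} {G : SimpleGraph V} (hG : G.Connected)
    {f : V → ℤ} (hf : ∀ u v, G.Adj u v → |f u - f v| ≤ 1) (u v : V) :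
    |f u - f v| ≤ G.dist u v := by
  obtain ⟨p, hp⟩ := hG.exists_walk_length_eq_dist u v
  rw [← hp]
  clear hp
  induction p with
  | nil => simp
  | @cons u v w h p ih =>
    rw [SimpleGraph.Walk.length_cons]
    have := hf _ _ h
    have := abs_sub_le (f u) (f v) (f w)
    push_cast
    omega

namespace RTree

variable {c : ℕ}

theorem depth_le_height : ∀ (t : RTree c) (x : t.Vert), t.depth x ≤ t.height
  | node col k ch, x => by
    obtain rfl | ⟨i, y, rfl⟩ := eq_root_or_inChild x
    · simp
    · rw [depth_inChild]
      have := (ch i).depth_le_height y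
      have := height_lt_of_mem_children (t := node col k ch) (s := ch i) (by simp [children])
      omega

theorem exists_depth_eq_height : ∀ t : RTree c, ∃ x : t.Vert, t.depth x = t.height
  | node col k ch => by
    by_cases hk : (univ : Finset (Fin k)).Nonempty
    · obtain ⟨i, _, hi⟩ := Finset.exists_mem_eq_sup univ hk fun i => (ch i).height + 1
      obtain ⟨y, hy⟩ := (ch i).exists_depth_eq_height
      exact ⟨inChild i y, by rw [depth_inChild, hy, height, hi]⟩
    · refine ⟨root _, ?_⟩
      rw [Finset.not_nonempty_iff_eq_empty] at hk
      rw [depth_root, height, hk, Finset.sup_empty]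
      rfl

theorem dist_root_le_depth (t : RTree c) (x : t.Vert) : t.graph.dist x t.root ≤ t.depth x := by
  induction hn : t.depth x generalizing x with
  | zero =>
    rcases hp : t.parent x with _ | p
    · rw [eq_root_of_parent_eq_none hp, SimpleGraph.dist_self]
    · have := depth_eq_of_parent hp
      omega
  | succ n ih =>
    rcases hp : t.parent x with _ | p
    · rw [eq_root_of_parent_eq_none hp, SimpleGraph.dist_self]
      omega
    · have hd := depth_eq_of_parent hp
      have h1 := ih p (by omega)
      have h2 : t.graph.dist x p = 1 := SimpleGraph.dist_eq_one_iff_adj.2 (Or.inl hp)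
      have h3 := t.graph_connected.dist_triangle (u := x) (v := p) (w := t.root)
      omega

theorem dist_le_two_mul_height (t : RTree c) (x y : t.Vert) :
    t.graph.dist x y ≤ 2 * t.height := by
  have h1 := t.dist_root_le_depth x
  have h2 := t.dist_root_le_depth y
  have h3 := t.graph_connected.dist_triangle (u := x) (v := t.root) (w := y)
  rw [SimpleGraph.dist_comm (u := t.root)] at h3
  have := t.depth_le_height x
  have := t.depth_le_height y
  omega

section

variable {col : Fin c} {k : ℕ} {ch : Fin k → RTree c}

theorem adj_inChild {i : Fin k} {x y : (ch i).Vert} (h : (ch i).graph.Adj x y) :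
    (node col k ch).graph.Adj (inChild i x) (inChild i y) := by
  rcases h with h | h
  · exact Or.inl (by rw [parent_inChild, h, Option.elim_some])
  · exact Or.inr (by rw [parent_inChild, h, Option.elim_some])

theorem dist_inChild_le (i : Fin k) (x y : (ch i).Vert) :
    (node col k ch).graph.dist (inChild i x) (inChild i y) ≤ (ch i).graph.dist x y := by
  obtain ⟨p, hp⟩ := (ch i).graph_connected.exists_walk_length_eq_dist x y
  let F : (ch i).graph →g (node col k ch).graph := ⟨inChild i, adj_inChild⟩
  rw [← hp, ← SimpleGraph.Walk.length_map F p]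
  exact SimpleGraph.dist_le _

theorem dist_node_le {D : ℕ} (h1 : ∀ i, ∀ x y : (ch i).Vert, (ch i).graph.dist x y ≤ D)
    (h2 : ∀ i j, i ≠ j → (ch i).height + (ch j).height + 2 ≤ D) (h3 : ∀ i, (ch i).height + 1 ≤ D)
    (x y : (node col k ch).Vert) : (node col k ch).graph.dist x y ≤ D := by
  have key : ∀ (i) (x : (ch i).Vert),
      (node col k ch).graph.dist (inChild i x) (root _) ≤ (ch i).height + 1 := by
    intro i x
    have := dist_root_le_depth (node col k ch) (inChild i x)
    rw [depth_inChild] at this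
    have := (ch i).depth_le_height x
    omega
  obtain rfl | ⟨i, x, rfl⟩ := eq_root_or_inChild x <;>
    obtain rfl | ⟨j, y, rfl⟩ := eq_root_or_inChild y
  · simp
  · rw [SimpleGraph.dist_comm]
    exact (key j y).trans (h3 j)
  · exact (key i x).trans (h3 i)
  · by_cases hij : i = j
    · subst hij
      exact (dist_inChild_le i x y).trans (h1 i x y)
    · have := (node col k ch).graph_connected.dist_triangle (u := inChild i x) (v := root _)
        (w := inChild j y)
      rw [SimpleGraph.dist_comm (u := root _)] at this
      have := key i x
      have := key j y
      have := h2 i j hij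
      omega

-- Signed depth, positive inside the i-th child subtree and negative elsewhere, changes by at most
-- one along an edge.
open Classical in
theorem le_dist_inChild {i j : Fin k} (hij : i ≠ j) (x : (ch i).Vert) (y : (ch j).Vert) :
    (ch i).depth x + (ch j).depth y + 2 ≤
      (node col k ch).graph.dist (inChild i x) (inChild j y) := by
  let f : (node col k ch).Vert → ℤ := fun z =>
    if ∃ w : (ch i).Vert, z = inChild i w then (node col k ch).depth z else -(node col k ch).depth z
  have hin : ∀ w : (ch i).Vert, f (inChild i w) = (node col k ch).depth (inChild i w) := fun w =>
    if_pos ⟨w, rfl⟩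
  have hpar : ∀ u v, (node col k ch).parent u = some v → |f u - f v| ≤ 1 := by
    intro u v h
    have hd := depth_eq_of_parent h
    obtain rfl | ⟨l, v, rfl⟩ := eq_root_or_inChild v
    · simp only [f, depth_root] at hd ⊢
      rw [abs_le]
      split_ifs <;> omega
    · have hiff : (∃ w : (ch i).Vert, u = inChild i w) ↔
          ∃ w : (ch i).Vert, (inChild l v : (node col k ch).Vert) = inChild i w := by
        obtain rfl | ⟨l', u, rfl⟩ := eq_root_or_inChild u
        · rw [parent_root] at h
          cases h
        · obtain ⟨u', hu', _⟩ := parent_inChild_eq_inChild h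
          rw [hu']
          constructor
          · rintro ⟨w, hw⟩
            obtain rfl := fst_eq_of_inChild_eq hw
            exact ⟨v, rfl⟩
          · rintro ⟨w, hw⟩
            obtain rfl := fst_eq_of_inChild_eq hw
            exact ⟨u', rfl⟩
      simp only [f, hiff]
      rw [abs_le]
      split_ifs <;> omega
  have hf : ∀ u v, (node col k ch).graph.Adj u v → |f u - f v| ≤ 1 := by
    rintro u v (h | h)
    · exact hpar u v h
    · rw [abs_sub_comm]
      exact hpar v u h
  have h1 := (node col k ch).graph_connected.abs_sub_le_dist hf (inChild i x) (inChild j y)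
  have h2 : f (inChild j y) = -(node col k ch).depth (inChild j y) :=
    if_neg fun ⟨w, hw⟩ => hij (fst_eq_of_inChild_eq hw).symm
  rw [hin, h2, depth_inChild, depth_inChild, abs_le] at h1
  push_cast at h1
  omega

end

theorem diam_eq_of_dist {V : Type*} [Finite V] {G : SimpleGraph V} (hG : G.Connected) {D : ℕ}
    (h1 : ∀ x y, G.dist x y ≤ D) (h2 : ∃ x y, D ≤ G.dist x y) : G.diam = D := by
  have := hG.nonempty
  apply le_antisymm
  · obtain ⟨u, v, h⟩ := G.exists_dist_eq_diam
    rw [← h]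
    exact h1 u v
  · obtain ⟨x, y, h⟩ := h2
    exact h.trans (SimpleGraph.dist_le_diam (SimpleGraph.connected_iff_ediam_ne_top.1 hG))

/-- A longest path runs from the bottom of s through the root to the bottom of a highest other
branch. The bound on distances is kept as a separate conclusion because it feeds the induction along
a path. -/
theorem diam_mk_cons {col : Fin c} {s : RTree c} {l : List (RTree c)} {e : ℕ}
    (hs : ∀ x y, s.graph.dist x y ≤ s.height + e + 2) (hes : e ≤ s.height)
    (hl : ∀ r ∈ l, r.height ≤ e) (hex : ∃ r ∈ l, r.height = e) :
    (∀ x y, (mk col (s :: l)).graph.dist x y ≤ s.height + e + 2) ∧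
      (mk col (s :: l)).graph.diam = s.height + e + 2 := by
  have h0 : ∀ i : Fin l.length, ((s :: l).get i.succ).height ≤ e := fun i =>
    hl _ (by simp)
  have hle : ∀ x y, (mk col (s :: l)).graph.dist x y ≤ s.height + e + 2 := by
    refine dist_node_le ?_ ?_ ?_
    · intro i
      induction i using Fin.cases with
      | zero => exact hs
      | succ i =>
        intro x y
        have := dist_le_two_mul_height _ x y
        have := h0 i
        omega
    · intro i j hij
      induction i using Fin.cases with
      | zero =>
        induction j using Fin.cases with
        | zero => exact absurd rfl hij
        | succ j =>
          have := h0 j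
          have : ((s :: l).get 0).height = s.height := rfl
          omega
      | succ i =>
        have := h0 i
        induction j using Fin.cases with
        | zero =>
          have : ((s :: l).get 0).height = s.height := rfl
          omega
        | succ j =>
          have := h0 j
          omega
    · intro i
      induction i using Fin.cases with
      | zero =>
        have : ((s :: l).get 0).height = s.height := rfl
        omega
      | succ i =>
        have := h0 i
        omega
  refine ⟨hle, diam_eq_of_dist (graph_connected _) hle ?_⟩
  obtain ⟨r, hr, hre⟩ := hex
  obtain ⟨i, rfl⟩ := List.get_of_mem hr
  obtain ⟨x, hx⟩ := s.exists_depth_eq_height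
  obtain ⟨y, hy⟩ := (l.get i).exists_depth_eq_height
  refine ⟨inChild (ch := (s :: l).get) (0 : Fin (l.length + 1)) x,
    inChild (ch := (s :: l).get) i.succ y, ?_⟩
  have := le_dist_inChild (col := col) (ch := (s :: l).get) (i := (0 : Fin (l.length + 1)))
    (j := i.succ) (Fin.succ_ne_zero i).symm x y
  refine le_trans ?_ this
  change _ ≤ s.depth x + (l.get i).depth y + 2
  omega

end RTree

/-! ### Checkers from locally rigid families -/

section General

variable {c : ℕ}

theorem RootedColoredGraph.Isomorphic.refl (A : RootedColoredGraph c) : A.Isomorphic A :=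
  ⟨SimpleGraph.Iso.refl, fun _ => rfl, rfl⟩

theorem RootedColoredGraph.Isomorphic.symm {A B : RootedColoredGraph c} (h : A.Isomorphic B) :
    B.Isomorphic A := by
  obtain ⟨e, h1, h2⟩ := h
  refine ⟨e.symm, fun v => ?_, ?_⟩
  · rw [← h1, RelIso.apply_symm_apply]
  · rw [← h2, RelIso.symm_apply_apply]

theorem RootedColoredGraph.Isomorphic.trans {A B C : RootedColoredGraph c} (h : A.Isomorphic B)
    (h' : B.Isomorphic C) : A.Isomorphic C := by
  obtain ⟨e, h1, h2⟩ := h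
  obtain ⟨e', h1', h2'⟩ := h'
  exact ⟨e.trans e', fun v => by rw [← h1, ← h1']; rfl, by rw [← h2', ← h2]; rfl⟩

/-- The checker that accepts precisely the views occurring in a given family of trees. -/
def viewChecker (d : ℕ) (F : Set (RTree c)) : LocalChecker c d where
  accept A := ∃ t ∈ F, ∃ x : t.Vert, A.Isomorphic (view t.graph t.color d x)
  accept_iff_of_isomorphic _ _ h :=
    ⟨fun ⟨t, ht, x, hx⟩ => ⟨t, ht, x, h.symm.trans hx⟩, fun ⟨t, ht, x, hx⟩ => ⟨t, ht, x, h.trans hx⟩⟩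

/-- Each vertex of `T` has a branch shape at depth `d` that occurs in the family `F`. -/
def LocallyIn (d : ℕ) (F : Set (RTree c)) (T : ColoredTree c) : Prop :=
  ∀ v : T.V, ∃ t ∈ F, ∃ x : t.Vert,
    branch T.graph T.color d v v = branch t.graph t.color d x x

/-- A tree whose branch shapes at depth `d` all occur in the family `F` is isomorphic to a member
of `F`. -/
def LocallyRigid (d : ℕ) (F : Set (RTree c)) : Prop :=
  ∀ T : ColoredTree c, LocallyIn d F T → ∃ t ∈ F, ∃ (s : RTree c) (z : T.V) (x : t.Vert),
    Represents T.graph T.color s z z ∧ Represents t.graph t.color s x x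

/-- The checker accepts the views that occur in F. By rigidity an accepted tree shares order and
diameter with a member, for which the diameter is right by assumption. -/
theorem exists_checker_of_locallyRigid {d : ℕ} {F : Set (RTree c)} (hF : LocallyRigid d F)
    {f : ℕ → ℕ} (hf : ∀ t ∈ F, t.graph.diam = f t.size) :
    ∃ L : LocalChecker c d, L.HasExactDiameter f ∧ ∀ t ∈ F, L.AcceptsOrder t.size := by
  refine ⟨viewChecker d F, ?_, ?_⟩
  · rintro n T hT rfl
    have hloc : LocallyIn d F T := by
      intro v
      obtain ⟨t, ht, x, hx⟩ := hT v
      exact ⟨t, ht, x, branch_eq_of_isomorphic hx⟩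
    obtain ⟨t, ht, s, z, x, h1, h2⟩ := hF T hloc
    obtain ⟨ho, hd⟩ := order_and_diam_eq (T' := t.toColoredTree) h1 h2
    rw [ho, hd, t.order_toColoredTree, ← hf t ht]
    rfl
  · intro t ht
    exact ⟨t.toColoredTree, fun v => ⟨t, ht, v, RootedColoredGraph.Isomorphic.refl _⟩,
      t.order_toColoredTree⟩

/-- Otherwise v ↦ {v, up v} would inject the vertices into the edges, of which there is one fewer.
-/
theorem SimpleGraph.IsTree.exists_apply_apply_eq {V : Type*} [Finite V] {G : SimpleGraph V}
    (hG : G.IsTree) {up : V → V} (hup : ∀ v, G.Adj v (up v)) : ∃ v, up (up v) = v := by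
  by_contra hcon
  push Not at hcon
  let F : V → G.edgeSet := fun v => ⟨s(v, up v), hup v⟩
  have hF : Function.Injective F := by
    intro v w h
    have h : s(v, up v) = s(w, up w) := congrArg Subtype.val h
    rw [Sym2.eq_iff] at h
    rcases h with h | h
    · exact h.1
    · refine absurd ?_ (hcon v)
      rw [h.2, ← h.1]
  have h1 := Nat.card_le_card_of_injective F hF
  have h2 := (SimpleGraph.isTree_iff_connected_and_card.1 hG).2
  omega

theorem exists_map_eq_of_map_eq {α β γ : Type*} [Nonempty β] {s : Finset α} {m : List β}
    {f : α → γ} {g : β → γ} (h : s.val.map f = (m : Multiset β).map g) :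
    ∃ τ : α → β, s.val.map τ = (m : Multiset β) ∧ ∀ w ∈ s, f w = g (τ w) := by
  classical
  have hm : (m : Multiset β) = (univ : Finset (Fin m.length)).val.map m.get := by
    rw [Fin.univ_val_map, List.ofFn_get]
  rw [hm, Multiset.map_map] at h
  obtain ⟨e, he⟩ := exists_equiv_of_map_val_eq h
  refine ⟨fun w => if hw : w ∈ s then m.get (e ⟨w, hw⟩).1 else Classical.arbitrary β, ?_, ?_⟩
  · rw [hm]
    refine map_val_eq_of_equiv e ?_
    rintro ⟨w, hw⟩
    simp [hw]
  · intro w hw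
    simp only [dif_pos hw]
    exact (he ⟨w, hw⟩).symm

section Match

variable {V V' : Type} [Fintype V] [Fintype V'] {G : SimpleGraph V} {G' : SimpleGraph V'}
  {col : V → Fin c} {col' : V' → Fin c}

/-- Vertices with the same shape at depth `e + 2` have the same branches at depth `e + 1` on both
sides of corresponding edges. -/
theorem exists_nbr_equiv_of_branch_eq {e : ℕ} {v : V} {x : V'}
    (h : branch G col (e + 2) v v = branch G' col' (e + 2) x x) :
    ∃ σ : nbr G v v ≃ nbr G' x x, ∀ w : nbr G v v,
      branch G col (e + 1) v w = branch G' col' (e + 1) x (σ w) ∧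
      branch G col (e + 1) w v = branch G' col' (e + 1) (σ w) x := by
  rw [branch_succ, branch_succ] at h
  have hcol : col v = col' x := congrArg Prod.fst h
  have h2 : (nbr G v v).val.map (branch G col (e + 1) v) =
    (nbr G' x x).val.map (branch G' col' (e + 1) x) := congrArg Prod.snd h
  obtain ⟨σ, hσ⟩ := exists_equiv_of_map_val_eq h2
  refine ⟨σ, fun w => ⟨(hσ w).symm, ?_⟩⟩
  -- The backward branch is what remains at v after removing w, which must be cancelled at depth e.
  -- Hence the backward view reaches depth e + 1.
  have h3 : (nbr G v v).val.map (branch G col e v) =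
      (nbr G' x x).val.map (branch G' col' e x) := by
    have := congrArg (Multiset.map Shape.trunc) h2
    rw [Multiset.map_map, Multiset.map_map] at this
    simpa only [Function.comp_def, trunc_branch] using this
  have h4 : branch G col e v w = branch G' col' e x (σ w) := by
    rw [← trunc_branch e v, ← trunc_branch e x, hσ]
  rw [map_nbr_self _ (mem_nbr_self.1 w.2), map_nbr_self _ (mem_nbr_self.1 (σ w).2), h4,
    Multiset.cons_inj_right] at h3
  rw [branch_succ, branch_succ, hcol, h3]

theorem Represents.of_both_sides {s r : RTree c} {p x : V} (hadj : G.Adj x p)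
    (hs : Represents G col s p x) (hr : Represents G col r x p) :
    Represents G col (RTree.mk s.rootColor (r :: s.children)) x x := by
  classical
  obtain ⟨h1, τ, hτ, h2⟩ := represents_iff.1 hs
  have hne : ∀ w ∈ nbr G p x, w ≠ p := fun w hw => (mem_nbr.1 hw).2
  refine represents_iff.2 ⟨h1, Function.update τ p r, ?_, ?_⟩
  · rw [map_nbr_self _ hadj, Function.update_self, RTree.children_mk, ← Multiset.cons_coe, ← hτ]
    congr 1
    exact Multiset.map_congr rfl fun w hw => Function.update_of_ne (hne w hw) _ _
  · intro w hw
    by_cases hwp : w = p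
    · subst hwp
      rwa [Function.update_self]
    · rw [Function.update_of_ne hwp]
      exact h2 w (mem_nbr.2 ⟨mem_nbr_self.1 hw, hwp⟩)

end Match

end General

/-! ### Label systems and comets -/

section Multisets

variable {α : Type*}

/-- Halving all multiplicities and rounding down recovers m, whatever the extra element is. This is
the use of doubling the labels. -/
theorem eq_of_cons_add_self_eq {ν ν' : α} {m m' : Multiset α}
    (h : ν ::ₘ (m + m) = ν' ::ₘ (m' + m')) : m = m' := by
  classical
  ext a
  have := congrArg (Multiset.count a) h
  simp only [Multiset.count_cons, Multiset.count_add] at this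
  split_ifs at this <;> omega

theorem cons_add_self_ne {ν : α} {m m' : Multiset α} : ν ::ₘ (m + m) ≠ m' + m' := by
  intro h
  have := congrArg Multiset.card h
  simp only [Multiset.card_cons, Multiset.card_add] at this
  omega

theorem eq_of_add_self_eq {m m' : Multiset α} (h : m + m = m' + m') : m = m' := by
  classical
  ext a
  have := congrArg (Multiset.count a) h
  simp only [Multiset.count_add] at this
  omega

end Multisets

/-- Labels for the vertices of a long path: the `i`-th label is a nonempty list of trees of height
`e`, and any two consecutive labels determine their position and order. -/
structure LabelSystem (c e : ℕ) where
  label : ℕ → List (RTree c)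
  color : Fin c
  label_ne_nil : ∀ i, label i ≠ []
  height_eq : ∀ i, ∀ s ∈ label i, s.height = e
  eq_of_consecutive : ∀ i j, (label i : Multiset (RTree c)).map (RTree.shape e) =
      (label j : Multiset (RTree c)).map (RTree.shape e) →
    (label (i + 1) : Multiset (RTree c)).map (RTree.shape e) =
      (label (j + 1) : Multiset (RTree c)).map (RTree.shape e) → i = j
  not_reversed : ∀ i j, (label i : Multiset (RTree c)).map (RTree.shape e) =
      (label (j + 1) : Multiset (RTree c)).map (RTree.shape e) →
    (label (i + 1) : Multiset (RTree c)).map (RTree.shape e) ≠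
      (label j : Multiset (RTree c)).map (RTree.shape e)

namespace LabelSystem

variable {c e : ℕ} (A : LabelSystem c e)

/-- The shapes occurring in a label. -/
def shapes (i : ℕ) : Multiset (Shape c e) := (A.label i : Multiset (RTree c)).map (RTree.shape e)

/-- The single vertex. -/
def leaf : RTree c := RTree.mk A.color []

/-- Each label is used twice, so that one additional branch does not conceal it. -/
def doubled (i : ℕ) : List (RTree c) := A.label i ++ A.label i

/-- The labeled path with `a + 1` vertices. -/
def spine : ℕ → RTree c
  | 0 => RTree.mk A.color (A.doubled 0)
  | a + 1 => RTree.mk A.color (spine a :: A.doubled (a + 1))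

/-- The trees of small height at the center. -/
def crown (N : ℕ) : List (RTree c) := A.doubled 0 ++ List.replicate N A.leaf

/-- A center with `N` leaves, from which a labeled path with `k + 1` vertices emanates. -/
def comet (k N : ℕ) : RTree c := RTree.mk A.color (A.spine k :: A.crown N)

open Classical in
/-- The number of leaves at the center exceeds what is possible at the end of the path. -/
def Valid (k N : ℕ) : Prop := ∀ j j', A.shapes j = A.shapes k → j ≤ j' + 1 → j' ≤ j + 1 →
  2 * (A.shapes j').count (A.leaf.shape e) + 1 < N

theorem coe_doubled_map (i : ℕ) :
    (A.doubled i : Multiset (RTree c)).map (RTree.shape e) = A.shapes i + A.shapes i := by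
  rw [doubled, ← Multiset.coe_add, Multiset.map_add]
  rfl

theorem coe_crown_map (N : ℕ) : (A.crown N : Multiset (RTree c)).map (RTree.shape e) =
    A.shapes 0 + A.shapes 0 + Multiset.replicate N (A.leaf.shape e) := by
  rw [crown, ← Multiset.coe_add, Multiset.map_add, coe_doubled_map, Multiset.coe_replicate,
    Multiset.map_replicate]

theorem height_of_mem_doubled {i : ℕ} {s : RTree c} (hs : s ∈ A.doubled i) : s.height = e := by
  rw [doubled, List.mem_append, or_self] at hs
  exact A.height_eq i s hs

theorem exists_mem_doubled (i : ℕ) : ∃ s, s ∈ A.doubled i := by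
  obtain ⟨s, hs⟩ := List.exists_mem_of_ne_nil _ (A.label_ne_nil i)
  exact ⟨s, List.mem_append_left _ hs⟩

theorem height_leaf : A.leaf.height = 0 := by
  rw [← Nat.le_zero, RTree.height_le_iff, leaf, RTree.children_mk]
  simp

theorem height_of_mem_crown {N : ℕ} {s : RTree c} (hs : s ∈ A.crown N) : s.height ≤ e := by
  rw [crown, List.mem_append] at hs
  rcases hs with hs | hs
  · exact (A.height_of_mem_doubled hs).le
  · rw [List.eq_of_mem_replicate hs, height_leaf]
    exact Nat.zero_le _

theorem height_spine (a : ℕ) : (A.spine a).height = a + e + 1 := by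
  induction a with
  | zero =>
    rw [spine, RTree.height_mk_eq (h := e) fun s hs => (A.height_of_mem_doubled hs).le]
    · omega
    · obtain ⟨s, hs⟩ := A.exists_mem_doubled 0
      exact ⟨s, hs, A.height_of_mem_doubled hs⟩
  | succ a ih =>
    rw [spine, RTree.height_mk_eq (h := a + e + 1)]
    · omega
    · intro s hs
      rw [List.mem_cons] at hs
      rcases hs with rfl | hs
      · exact ih.le
      · rw [A.height_of_mem_doubled hs]
        omega
    · exact ⟨_, List.mem_cons_self, ih⟩

theorem rootColor_spine (a : ℕ) : (A.spine a).rootColor = A.color := by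
  cases a <;> rfl

theorem doubled_eq_cons (i : ℕ) : ∃ s l, A.doubled i = s :: l ∧ s.height = e ∧
    (∀ r ∈ l, r.height ≤ e) ∧ ∃ r ∈ l, r.height = e := by
  obtain ⟨s, l, hl⟩ := List.exists_cons_of_ne_nil (A.label_ne_nil i)
  have hd : A.doubled i = s :: (l ++ s :: l) := by rw [doubled, hl]; rfl
  refine ⟨s, l ++ s :: l, hd, A.height_of_mem_doubled (i := i) (by simp [hd]), fun r hr => ?_,
    s, by simp, A.height_of_mem_doubled (i := i) (by simp [hd])⟩
  exact (A.height_of_mem_doubled (i := i) (by rw [hd]; exact List.mem_cons_of_mem _ hr)).le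

theorem dist_spine_le (a : ℕ) : ∀ x y, (A.spine a).graph.dist x y ≤ a + 2 * e + 2 := by
  induction a with
  | zero =>
    obtain ⟨s, l, h, hs, hl, hex⟩ := A.doubled_eq_cons 0
    rw [spine, h]
    intro x y
    refine ((RTree.diam_mk_cons (e := e) (fun x y => ?_) hs.ge hl hex).1 x y).trans (by omega)
    have := s.dist_le_two_mul_height x y
    omega
  | succ a ih =>
    rw [spine]
    have hh := A.height_spine a
    obtain ⟨r, hr⟩ := A.exists_mem_doubled (a + 1)
    intro x y
    refine ((RTree.diam_mk_cons (e := e) (fun x y => ?_) (by omega)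
      (fun r hr => (A.height_of_mem_doubled hr).le) ⟨r, hr, A.height_of_mem_doubled hr⟩).1
      x y).trans (by omega)
    have := ih x y
    omega

theorem diam_comet (k N : ℕ) : (A.comet k N).graph.diam = k + 2 * e + 3 := by
  have hh := A.height_spine k
  obtain ⟨r, hr⟩ := A.exists_mem_doubled 0
  rw [comet, (RTree.diam_mk_cons (e := e) (fun x y => ?_) (by omega)
      (fun r hr => A.height_of_mem_crown hr)
      ⟨r, List.mem_append_left _ hr, A.height_of_mem_doubled hr⟩).2]
  · omega
  · have := A.dist_spine_le k x y
    omega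

/-- What is seen of a path vertex from the next vertex. -/
def IsLower (a : ℕ) (m : Multiset (Shape c e)) : Prop :=
  m = A.shapes a + A.shapes a ∨ ∃ ν, m = ν ::ₘ (A.shapes a + A.shapes a)

/-- What is seen from the path vertex of index `a` of the next vertex, in a comet. -/
def IsUpper (a k N : ℕ) (m : Multiset (Shape c e)) : Prop :=
  (a < k ∧ ∃ ν, m = ν ::ₘ (A.shapes (a + 1) + A.shapes (a + 1))) ∨
  (a = k ∧ m = A.shapes 0 + A.shapes 0 + Multiset.replicate N (A.leaf.shape e))

variable {A}

/-- The parity of the cardinality tells whether an extra element is present. -/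
theorem IsLower.eq {a b : ℕ} {m : Multiset (Shape c e)} (h : A.IsLower a m) (h' : A.IsLower b m) :
    A.shapes a = A.shapes b := by
  rcases h with rfl | ⟨ν, rfl⟩ <;> rcases h' with h' | ⟨ν', h'⟩
  · exact eq_of_add_self_eq h'
  · exact absurd h'.symm cons_add_self_ne
  · exact absurd h' cons_add_self_ne
  · exact eq_of_cons_add_self_eq h'

open Classical in
theorem IsLower.count_le {a : ℕ} {m : Multiset (Shape c e)} (h : A.IsLower a m) (s : Shape c e) :
    m.count s ≤ 2 * (A.shapes a).count s + 1 := by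
  rcases h with rfl | ⟨ν, rfl⟩
  · rw [Multiset.count_add]
    omega
  · rw [Multiset.count_cons, Multiset.count_add]
    split_ifs <;> omega

theorem IsLower.of_cons (a : ℕ) (ν : Shape c e) :
    A.IsLower a (ν ::ₘ (A.shapes a + A.shapes a)) := Or.inr ⟨ν, rfl⟩

open Classical in
theorem le_count_replicate (m : Multiset (Shape c e)) (N : ℕ) (s : Shape c e) :
    N ≤ (m + Multiset.replicate N s).count s := by
  rw [Multiset.count_add, Multiset.count_replicate_self]
  omega

/-- This excludes an edge that is a path edge in both directions. If both upper ends are path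
vertices, two consecutive labels are reversed. If one is a center, its leaves would have to fit at a
path vertex next to one with the same label as the end of the path; this is why `Valid` ranges over
all j with that label. -/
theorem not_isUpper_of_reversed {a b k k' N N' : ℕ} {m m' : Multiset (Shape c e)}
    (hV : A.Valid k N) (hV' : A.Valid k' N') (h1 : A.IsLower a m) (h2 : A.IsUpper a k N m')
    (h3 : A.IsLower b m') (h4 : A.IsUpper b k' N' m) : False := by
  classical
  rcases h2 with ⟨hak, ν, rfl⟩ | ⟨rfl, rfl⟩ <;> rcases h4 with ⟨hbk, ν', rfl⟩ | ⟨rfl, rfl⟩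
  · exact A.not_reversed a b (h1.eq (IsLower.of_cons _ _)) ((IsLower.of_cons _ _).eq h3)
  · have := (le_count_replicate _ _ _).trans (h1.count_le (A.leaf.shape e))
    have := hV' (a + 1) a ((IsLower.of_cons _ _).eq h3) (by omega) (by omega)
    omega
  · have := (le_count_replicate _ _ _).trans (h3.count_le (A.leaf.shape e))
    have := hV (b + 1) b ((IsLower.of_cons _ _).eq h1) (by omega) (by omega)
    omega
  -- With a center at both ends, the bounds chain to N' < N < N'.
  · have := (le_count_replicate _ _ _).trans (h1.count_le (A.leaf.shape e))
    have := (le_count_replicate _ _ _).trans (h3.count_le (A.leaf.shape e))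
    have := hV a a rfl (by omega) (by omega)
    have := hV' b b rfl (by omega) (by omega)
    omega

/-- Two path vertices are located by their consecutive labels. A center cannot pass for a path
vertex because it has too many leaves, and the cardinality of its crown reveals N. -/
theorem IsUpper.resolve {a b k k' N N' : ℕ} {m m' : Multiset (Shape c e)}
    (hV : A.Valid k N) (hV' : A.Valid k' N') (h1 : A.IsLower a m) (h2 : A.IsUpper a k N m')
    (h3 : A.IsLower b m) (h4 : A.IsUpper b k' N' m') :
    (a < k ∧ b < k' ∧ a = b) ∨ (a = k ∧ b = k' ∧ N = N') := by
  classical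
  have hab := h1.eq h3
  rcases h2 with ⟨hak, ν, rfl⟩ | ⟨rfl, rfl⟩ <;> rcases h4 with ⟨hbk, ν', h4⟩ | ⟨rfl, h4⟩
  · exact Or.inl ⟨hak, hbk, A.eq_of_consecutive a b hab (eq_of_cons_add_self_eq h4)⟩
  · exfalso
    have h5 := (IsLower.of_cons (A := A) (a + 1) ν).count_le (A.leaf.shape e)
    rw [h4] at h5
    have := (le_count_replicate _ _ _).trans h5
    have := hV' a (a + 1) hab (by omega) (by omega)
    omega
  · exfalso
    have h5 := (IsLower.of_cons (A := A) (b + 1) ν').count_le (A.leaf.shape e)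
    rw [← h4] at h5
    have := (le_count_replicate _ _ _).trans h5
    have := hV b (b + 1) hab.symm (by omega) (by omega)
    omega
  · refine Or.inr ⟨rfl, rfl, ?_⟩
    have := congrArg Multiset.card h4
    simpa using this

theorem exists_mem_shapes (A : LabelSystem c e) (i : ℕ) :
    ∃ s ∈ A.shapes i, ¬ s.Closed := by
  obtain ⟨s, hs⟩ := List.exists_mem_of_ne_nil _ (A.label_ne_nil i)
  refine ⟨s.shape e, Multiset.mem_map_of_mem _ hs, ?_⟩
  rw [RTree.closed_shape_iff, A.height_eq i s hs]
  exact lt_irrefl e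

theorem IsLower.not_closed {a : ℕ} {m : Multiset (Shape c e)} (h : A.IsLower a m) (x : Fin c) :
    ¬ Shape.Closed (h := e + 1) (x, m) := by
  obtain ⟨s, hs, hs'⟩ := A.exists_mem_shapes a
  rw [Shape.closed_succ]
  intro H
  refine hs' (H s ?_)
  rcases h with rfl | ⟨ν, rfl⟩
  · exact Multiset.mem_add.2 (Or.inl hs)
  · exact Multiset.mem_cons_of_mem (Multiset.mem_add.2 (Or.inl hs))

theorem IsUpper.not_closed {a k N : ℕ} {m : Multiset (Shape c e)} (h : A.IsUpper a k N m)
    (x : Fin c) : ¬ Shape.Closed (h := e + 1) (x, m) := by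
  rcases h with ⟨_, ν, rfl⟩ | ⟨_, rfl⟩
  · exact (IsLower.of_cons (a + 1) ν).not_closed x
  · obtain ⟨s, hs, hs'⟩ := A.exists_mem_shapes 0
    rw [Shape.closed_succ]
    intro H
    exact hs' (H s (Multiset.mem_add.2 (Or.inl (Multiset.mem_add.2 (Or.inl hs)))))

theorem shape_spine (A : LabelSystem c e) (a : ℕ) :
    ∃ m, (A.spine a).shape (e + 1) = (A.color, m) ∧ A.IsLower a m := by
  cases a with
  | zero =>
    refine ⟨_, rfl, Or.inl ?_⟩
    rw [spine, RTree.children_mk, coe_doubled_map]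
  | succ a =>
    refine ⟨_, rfl, Or.inr ⟨(A.spine a).shape e, ?_⟩⟩
    rw [spine, RTree.children_mk, ← Multiset.cons_coe, Multiset.map_cons, coe_doubled_map]

end LabelSystem

/-! ### Local rigidity of families of comets -/

namespace LabelSystem

variable {c e : ℕ} {A : LabelSystem c e}

theorem children_comet (k N : ℕ) : (A.comet k N).children = A.spine k :: A.crown N :=
  RTree.children_mk _ _

theorem children_spine_zero : (A.spine 0).children = A.doubled 0 := RTree.children_mk _ _

theorem children_spine_succ (a : ℕ) :
    (A.spine (a + 1)).children = A.spine a :: A.doubled (a + 1) := RTree.children_mk _ _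

section Upper

variable {V : Type} [Fintype V] {G : SimpleGraph V} {col : V → Fin c}

/-- The neighbors of v show the upper neighbor, the lower path vertex and the doubled label.
Cancelling the lower one leaves u as the single extra element. -/
theorem exists_isUpper_of_spine {a k N : ℕ} (hak : a < k) {u v w : V} (hu : G.Adj v u)
    (hw : G.Adj v w) (hcol : col v = A.color)
    (hmap : (nbr G u v).val.map (branch G col e v) =
      ((A.spine (a + 1)).children : Multiset (RTree c)).map (RTree.shape e))
    (hbr : branch G col e v w = (A.spine a).shape e) :
    ∃ m, branch G col (e + 1) w v = (A.color, m) ∧ A.IsUpper a k N m := by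
  have h1 := map_nbr_self (branch G col e v) hu
  rw [map_nbr_self (branch G col e v) hw, hmap, hbr, children_spine_succ,
    ← Multiset.cons_coe, Multiset.map_cons, coe_doubled_map, Multiset.cons_swap,
    Multiset.cons_inj_right] at h1
  exact ⟨_, by rw [branch_succ, hcol, h1], Or.inl ⟨hak, _, rfl⟩⟩

theorem exists_isUpper_of_comet {k N : ℕ} {v w : V} (hw : G.Adj v w) (hcol : col v = A.color)
    (hmap : (nbr G v v).val.map (branch G col e v) =
      ((A.comet k N).children : Multiset (RTree c)).map (RTree.shape e))
    (hbr : branch G col e v w = (A.spine k).shape e) :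
    ∃ m, branch G col (e + 1) w v = (A.color, m) ∧ A.IsUpper k k N m := by
  rw [map_nbr_self (branch G col e v) hw, hbr, children_comet,
    ← Multiset.cons_coe, Multiset.map_cons, coe_crown_map, Multiset.cons_inj_right] at hmap
  exact ⟨_, by rw [branch_succ, hcol, hmap], Or.inr ⟨rfl, rfl⟩⟩

end Upper

theorem comet_cases {k N : ℕ} {x p : (A.comet k N).Vert} (h : (A.comet k N).parent x = some p) :
    ((A.comet k N).subtree x).height ≤ e ∨ ∃ a, (A.comet k N).subtree x = A.spine a ∧
      ((a = k ∧ p = (A.comet k N).root) ∨ (a < k ∧ (A.comet k N).subtree p = A.spine (a + 1) ∧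
        ∃ q, (A.comet k N).parent p = some q)) := by
  induction hn : (A.comet k N).depth x using Nat.strong_induction_on generalizing x p with
  | _ n ih =>
    have hmem := RTree.subtree_mem_children h
    rcases hp : (A.comet k N).parent p with _ | q
    · obtain rfl := RTree.eq_root_of_parent_eq_none hp
      rw [RTree.subtree_root, children_comet, List.mem_cons] at hmem
      rcases hmem with hmem | hmem
      · exact Or.inr ⟨k, hmem, Or.inl ⟨rfl, rfl⟩⟩
      · exact Or.inl (A.height_of_mem_crown hmem)
    · have hd := RTree.depth_eq_of_parent h
      rcases ih _ (by omega) hp rfl with h1 | ⟨a, ha, h1⟩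
      · have := RTree.height_lt_of_mem_children hmem
        exact Or.inl (by omega)
      · rw [ha] at hmem
        cases a with
        | zero =>
          rw [children_spine_zero] at hmem
          exact Or.inl (A.height_of_mem_doubled hmem).le
        | succ a =>
          rw [children_spine_succ, List.mem_cons] at hmem
          rcases hmem with hmem | hmem
          · exact Or.inr ⟨a, hmem, Or.inr ⟨by omega, ha, q, rfl⟩⟩
          · exact Or.inl (A.height_of_mem_doubled hmem).le

theorem exists_isUpper_comet {k N a : ℕ} {x p : (A.comet k N).Vert}
    (h : (A.comet k N).parent x = some p) (ha : (A.comet k N).subtree x = A.spine a)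
    (hp : (a = k ∧ p = (A.comet k N).root) ∨ (a < k ∧ (A.comet k N).subtree p = A.spine (a + 1) ∧
        ∃ q, (A.comet k N).parent p = some q)) :
    ∃ m, branch (A.comet k N).graph (A.comet k N).color (e + 1) x p = (A.color, m) ∧
      A.IsUpper a k N m := by
  have hx := ((A.comet k N).represents_subtree (Or.inl h)).branch_eq e
  rw [ha] at hx
  rcases hp with ⟨rfl, rfl⟩ | ⟨hak, hp, q, hq⟩
  · refine exists_isUpper_of_comet (Or.inr h) ?_ ?_ hx
    · rw [RTree.color, RTree.subtree_root]
      rfl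
    · exact congrArg Prod.snd ((A.comet a N).represents_self.branch_eq (e + 1))
  · refine exists_isUpper_of_spine hak (Or.inl hq) (Or.inr h) ?_ ?_ hx
    · rw [RTree.color, hp, rootColor_spine]
    · have := ((A.comet k N).represents_subtree (Or.inl hq)).branch_eq (e + 1)
      rw [hp] at this
      exact congrArg Prod.snd this

/-- The members of the family are comets with enough leaves and trees of small height. -/
def Admissible (A : LabelSystem c e) (F : Set (RTree c)) : Prop :=
  ∀ t ∈ F, (∀ s ∈ t.children, s.height ≤ e) ∨ ∃ k N, A.Valid k N ∧ t = A.comet k N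

theorem Admissible.cases {F : Set (RTree c)} (hF : A.Admissible F) {t : RTree c} (ht : t ∈ F)
    {x p : t.Vert} (h : t.parent x = some p) :
    (branch t.graph t.color (e + 1) p x).Closed ∨
    ∃ a k N m m', t.subtree x = A.spine a ∧ A.Valid k N ∧ t = A.comet k N ∧ (a = k → p = t.root) ∧
      branch t.graph t.color (e + 1) p x = (A.color, m) ∧ A.IsLower a m ∧
      branch t.graph t.color (e + 1) x p = (A.color, m') ∧ A.IsUpper a k N m' := by
  have hbr := (t.represents_subtree (Or.inl h)).branch_eq (e + 1)
  have hclosed : (t.subtree x).height ≤ e → (branch t.graph t.color (e + 1) p x).Closed := by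
    intro h
    rw [hbr, RTree.closed_shape_iff]
    omega
  rcases hF t ht with hs | ⟨k, N, hV, rfl⟩
  · refine Or.inl (hclosed ?_)
    have key : ∀ (n : ℕ) (x p : t.Vert), t.depth x = n → t.parent x = some p →
        (t.subtree x).height ≤ e := by
      intro n
      induction n with
      | zero =>
        intro x p hn hp
        have := RTree.depth_eq_of_parent hp
        omega
      | succ n ih =>
        intro x p hn hp
        have hd := RTree.depth_eq_of_parent hp
        have hmem := RTree.subtree_mem_children hp
        rcases hq : t.parent p with _ | q
        · rw [RTree.eq_root_of_parent_eq_none hq, RTree.subtree_root] at hmem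
          exact hs _ hmem
        · have := ih p q (by omega) hq
          have := RTree.height_lt_of_mem_children hmem
          omega
    exact key _ x p rfl h
  · rcases comet_cases h with h1 | ⟨a, ha, h1⟩
    · exact Or.inl (hclosed h1)
    · obtain ⟨m', hm', hup⟩ := exists_isUpper_comet h ha h1
      rw [ha] at hbr
      obtain ⟨m, hm, hlo⟩ := A.shape_spine a
      refine Or.inr ⟨a, k, N, m, m', ha, hV, rfl, ?_, hbr.trans hm, hlo, hm', hup⟩
      intro hak
      rcases h1 with h1 | h1
      · exact h1.2
      · omega

section Rigid

variable {F : Set (RTree c)} {T : ColoredTree c}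

/-- A path edge of `T` is a path edge in the member of the family that models its lower end. -/
theorem Admissible.exists_of_isLower (hF : A.Admissible F) (hT : LocallyIn (e + 2) F T)
    {a k N : ℕ} {m m' : Multiset (Shape c e)} (hV : A.Valid k N) {u w : T.V}
    (hadj : T.graph.Adj w u) (hlo : A.IsLower a m) (hup : A.IsUpper a k N m')
    (h1 : branch T.graph T.color (e + 1) u w = (A.color, m))
    (h2 : branch T.graph T.color (e + 1) w u = (A.color, m')) :
    ∃ k' N' b, A.comet k' N' ∈ F ∧ A.Valid k' N' ∧
      ((a < k ∧ b < k' ∧ a = b) ∨ (a = k ∧ b = k' ∧ N = N')) ∧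
      ∃ y p : (A.comet k' N').Vert, (A.comet k' N').parent y = some p ∧
        (A.comet k' N').subtree y = A.spine b ∧
        branch T.graph T.color (e + 2) w w =
          branch (A.comet k' N').graph (A.comet k' N').color (e + 2) y y ∧
        branch T.graph T.color (e + 1) w u =
          branch (A.comet k' N').graph (A.comet k' N').color (e + 1) y p := by
  obtain ⟨t, ht, y, hy⟩ := hT w
  obtain ⟨σ, hσ⟩ := exists_nbr_equiv_of_branch_eq hy
  obtain ⟨h3, h4⟩ := hσ ⟨u, mem_nbr_self.2 hadj⟩
  have hp := mem_nbr_self.1 (σ ⟨u, mem_nbr_self.2 hadj⟩).2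
  generalize (σ ⟨u, mem_nbr_self.2 hadj⟩ : t.Vert) = p at h3 h4 hp
  dsimp only at h3 h4
  -- The vertex that models u is the parent or a child of y; in the second case the path edge would
  -- be reversed.
  rcases hp with hp | hp
  · rcases hF.cases ht hp with hcl | ⟨b, k', N', r, r', hb, hV', rfl, _, h5, hlo', h6, hup'⟩
    · rw [← h4, h1] at hcl
      exact absurd hcl (hlo.not_closed _)
    · have h7 : m = r := congrArg Prod.snd (h1.symm.trans (h4.trans h5))
      have h8 : m' = r' := congrArg Prod.snd (h2.symm.trans (h3.trans h6))
      subst h7 h8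
      exact ⟨k', N', b, ht, hV', hup.resolve hV hV' hlo hlo' hup', y, p, hp, hb, hy, h3⟩
  · exfalso
    rcases hF.cases ht hp with hcl | ⟨b, k', N', r, r', hb, hV', rfl, _, h5, hlo', h6, hup'⟩
    · rw [← h3, h2] at hcl
      exact hup.not_closed _ hcl
    · have h7 : m = r' := congrArg Prod.snd (h1.symm.trans (h4.trans h6))
      have h8 : m' = r := congrArg Prod.snd (h2.symm.trans (h3.trans h5))
      subst h7 h8
      exact not_isUpper_of_reversed hV hV' hlo hup hlo' hup'

/-- The branches toward u and p agree and cancel, so the view of w shows what lies below it to the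
full depth e + 1. -/
theorem map_nbr_eq_of_branch_eq {a : ℕ} {u w : T.V} (hadj : T.graph.Adj w u) {t : RTree c}
    {y p : t.Vert} (hp : t.parent y = some p) (ha : t.subtree y = A.spine a)
    (h1 : branch T.graph T.color (e + 2) w w = branch t.graph t.color (e + 2) y y)
    (h2 : branch T.graph T.color (e + 1) w u = branch t.graph t.color (e + 1) y p) :
    T.color w = (A.spine a).rootColor ∧
    (nbr T.graph u w).val.map (branch T.graph T.color (e + 1) w) =
      ((A.spine a).children : Multiset (RTree c)).map (RTree.shape (e + 1)) := by
  have h3 := (t.represents_subtree (Or.inl hp)).branch_eq (e + 2)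
  rw [ha] at h3
  have h4 : (nbr T.graph w w).val.map (branch T.graph T.color (e + 1) w) =
    (nbr t.graph y y).val.map (branch t.graph t.color (e + 1) y) := congrArg Prod.snd h1
  rw [map_nbr_self _ hadj, map_nbr_self _ (show t.graph.Adj y p from Or.inl hp), h2,
    Multiset.cons_inj_right] at h4
  exact ⟨(congrArg Prod.fst h1).trans (congrArg Prod.fst h3), h4.trans (congrArg Prod.snd h3)⟩

/-- The view of w shows its label trees completely, as they have height e, and shows the next path
vertex down. By `exists_of_isLower` that vertex has a model at the right index, but perhaps in
another comet, so the induction must leave k and N free. -/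
theorem Admissible.represents_spine (hF : A.Admissible F) (hT : LocallyIn (e + 2) F T)
    {a k N : ℕ} (hV : A.Valid k N) (hak : a ≤ k) {u w : T.V} (hadj : T.graph.Adj w u)
    {y p : (A.comet k N).Vert} (hp : (A.comet k N).parent y = some p)
    (ha : (A.comet k N).subtree y = A.spine a)
    (h1 : branch T.graph T.color (e + 2) w w =
      branch (A.comet k N).graph (A.comet k N).color (e + 2) y y)
    (h2 : branch T.graph T.color (e + 1) w u =
      branch (A.comet k N).graph (A.comet k N).color (e + 1) y p) :
    Represents T.graph T.color (A.spine a) u w := by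
  induction a generalizing k N u w with
  | zero =>
    obtain ⟨hcol, hmap⟩ := map_nbr_eq_of_branch_eq hadj hp ha h1 h2
    have : Nonempty (RTree c) := ⟨A.leaf⟩
    obtain ⟨τ, hτ, hτ'⟩ := exists_map_eq_of_map_eq hmap
    refine represents_iff.2 ⟨hcol, τ, hτ, fun w' hw' => ?_⟩
    refine represents_of_branch_eq (hτ' w' hw') ?_
    have hmem : τ w' ∈ ((A.spine 0).children : Multiset (RTree c)) := by
      rw [← hτ]
      exact Multiset.mem_map_of_mem τ hw'
    rw [Multiset.mem_coe, children_spine_zero] at hmem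
    rw [A.height_of_mem_doubled hmem]
    omega
  | succ a ih =>
    obtain ⟨hcol, hmap⟩ := map_nbr_eq_of_branch_eq hadj hp ha h1 h2
    have : Nonempty (RTree c) := ⟨A.leaf⟩
    obtain ⟨τ, hτ, hτ'⟩ := exists_map_eq_of_map_eq hmap
    refine represents_iff.2 ⟨hcol, τ, hτ, fun w' hw' => ?_⟩
    have hmem : τ w' ∈ ((A.spine (a + 1)).children : Multiset (RTree c)) := by
      rw [← hτ]
      exact Multiset.mem_map_of_mem τ hw'
    rw [Multiset.mem_coe, children_spine_succ, List.mem_cons] at hmem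
    rcases hmem with hmem | hmem
    · have hbr := hτ' w' hw'
      rw [hmem] at hbr ⊢
      obtain ⟨m, hm, hlo⟩ := A.shape_spine a
      have hw'' := (mem_nbr.1 hw').1
      have hmap' : (nbr T.graph u w).val.map (branch T.graph T.color e w) =
          ((A.spine (a + 1)).children : Multiset (RTree c)).map (RTree.shape e) := by
        have := congrArg (Multiset.map Shape.trunc) hmap
        rw [Multiset.map_map, Multiset.map_map] at this
        simpa only [Function.comp_def, trunc_branch, RTree.trunc_shape] using this
      obtain ⟨m', hm', hup⟩ := exists_isUpper_of_spine (A := A) (k := k) (N := N) (by omega) hadj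
        hw'' (hcol.trans (A.rootColor_spine _)) hmap'
        (by rw [← trunc_branch, hbr, RTree.trunc_shape])
      obtain ⟨k', N', b, _, hV', hres, y', p', hp', hb, h3, h4⟩ :=
        hF.exists_of_isLower hT hV hw''.symm hlo hup (hbr.trans hm) hm'
      obtain ⟨_, hbk, rfl⟩ | h := hres
      · exact ih hV' hbk.le hw''.symm hp' hb h3 h4
      · omega
    · refine represents_of_branch_eq (hτ' w' hw') ?_
      rw [A.height_of_mem_doubled hmem]
      omega

theorem Admissible.exists_represents_of_root (hF : A.Admissible F) (hT : LocallyIn (e + 2) F T)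
    {t : RTree c} (ht : t ∈ F) {z : T.V}
    (hz : branch T.graph T.color (e + 2) z z = branch t.graph t.color (e + 2) t.root t.root) :
    ∃ t ∈ F, Represents T.graph T.color t z z := by
  classical
  rw [t.represents_self.branch_eq] at hz
  rcases hF t ht with hs | ⟨k, N, hV, rfl⟩
  · refine ⟨t, ht, represents_of_branch_eq hz ?_⟩
    rw [Nat.lt_succ_iff, RTree.height_le_iff]
    intro s hmem
    exact Nat.succ_le_succ (hs s hmem)
  · have hcol : T.color z = A.color := congrArg Prod.fst hz
    have hmap : (nbr T.graph z z).val.map (branch T.graph T.color (e + 1) z) =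
      ((A.comet k N).children : Multiset (RTree c)).map (RTree.shape (e + 1)) :=
      congrArg Prod.snd hz
    have hmap' : (nbr T.graph z z).val.map (branch T.graph T.color e z) =
        ((A.comet k N).children : Multiset (RTree c)).map (RTree.shape e) := by
      have := congrArg (Multiset.map Shape.trunc) hmap
      rw [Multiset.map_map, Multiset.map_map] at this
      simpa only [Function.comp_def, trunc_branch, RTree.trunc_shape] using this
    have : Nonempty (RTree c) := ⟨A.leaf⟩
    obtain ⟨τ, hτ, hτ'⟩ := exists_map_eq_of_map_eq hmap
    have hmem : A.spine k ∈ (nbr T.graph z z).val.map τ := by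
      rw [hτ, children_comet]
      simp
    obtain ⟨w, hw, hwk⟩ := Multiset.mem_map.1 hmem
    have hbr := hτ' w hw
    rw [hwk] at hbr
    have hadj := mem_nbr_self.1 hw
    obtain ⟨m, hm, hlo⟩ := A.shape_spine k
    obtain ⟨m', hm', hup⟩ := exists_isUpper_of_comet hadj hcol hmap'
        (by rw [← trunc_branch, hbr, RTree.trunc_shape])
    obtain ⟨k', N', b, htF, hV', hres, y', p', hp', hb, h3, h4⟩ :=
        hF.exists_of_isLower hT hV hadj.symm hlo hup (hbr.trans hm) hm'
    -- The upper end of this edge is the center itself, so the model of w lies in a comet with the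
    -- same k and N.
    obtain h | ⟨_, rfl, rfl⟩ := hres
    · omega
    have hrep := hF.represents_spine hT hV' le_rfl hadj.symm hp' hb h3 h4
    refine ⟨_, htF, ?_⟩
    rw [map_nbr_self τ hadj, hwk, children_comet, ← Multiset.cons_coe,
      Multiset.cons_inj_right] at hτ
    have hne : ∀ v ∈ nbr T.graph w z, v ≠ w := fun v hv => (mem_nbr.1 hv).2
    refine represents_iff.2 ⟨hcol, Function.update τ w (A.spine b), ?_, ?_⟩
    · rw [map_nbr_self _ hadj, Function.update_self, children_comet, ← Multiset.cons_coe, ← hτ]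
      congr 1
      exact Multiset.map_congr rfl fun v hv => Function.update_of_ne (hne v hv) _ _
    · intro v hv
      by_cases hvw : v = w
      · subst hvw
        rwa [Function.update_self]
      · rw [Function.update_of_ne hvw]
        refine represents_of_branch_eq (hτ' v hv) ?_
        have hmem : τ v ∈ (A.crown N : Multiset (RTree c)) := by
          rw [← hτ]
          exact Multiset.mem_map_of_mem τ (mem_nbr.2 ⟨mem_nbr_self.1 hv, hvw⟩)
        have := A.height_of_mem_crown hmem
        omega

/-- If a root view occurs, the tree is rebuilt from there. Otherwise pointing to the modeled parent
yields an edge whose ends each regard the other as parent. -/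
theorem Admissible.locallyRigid (hF : A.Admissible F) : LocallyRigid (e + 2) F := by
  intro T hT
  by_cases hroot : ∃ t ∈ F, ∃ z : T.V,
      branch T.graph T.color (e + 2) z z = branch t.graph t.color (e + 2) t.root t.root
  · obtain ⟨t, ht, z, hz⟩ := hroot
    obtain ⟨t', ht', h⟩ := hF.exists_represents_of_root hT ht hz
    exact ⟨t', ht', t', z, t'.root, h, t'.represents_self⟩
  · have hup : ∀ v : T.V, ∃ u : T.V, T.graph.Adj v u ∧ ∃ t ∈ F, ∃ x p : t.Vert,
        t.parent x = some p ∧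
        branch T.graph T.color (e + 1) v u = branch t.graph t.color (e + 1) x p ∧
        branch T.graph T.color (e + 1) u v = branch t.graph t.color (e + 1) p x := by
      intro v
      obtain ⟨t, ht, x, hx⟩ := hT v
      rcases hp : t.parent x with _ | p
      · rw [RTree.eq_root_of_parent_eq_none hp] at hx
        exact absurd ⟨t, ht, v, hx⟩ hroot
      · obtain ⟨σ, hσ⟩ := exists_nbr_equiv_of_branch_eq hx
        have hp' : p ∈ nbr t.graph x x := mem_nbr_self.2 (Or.inl hp)
        obtain ⟨h1, h2⟩ := hσ (σ.symm ⟨p, hp'⟩)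
        rw [Equiv.apply_symm_apply] at h1 h2
        exact ⟨σ.symm ⟨p, hp'⟩, mem_nbr_self.1 (σ.symm ⟨p, hp'⟩).2, t, ht, x, p, hp, h1, h2⟩
    choose up hadj hmodel using hup
    obtain ⟨v, hv⟩ := T.isTree.exists_apply_apply_eq hadj
    obtain ⟨t, ht, x, p, hp, h1, h2⟩ := hmodel v
    obtain ⟨t', ht', y, q, hq, h3, h4⟩ := hmodel (up v)
    rw [hv] at h3 h4
    rcases hF.cases ht hp with hcl | ⟨a, k, N, m, m', ha, hV, rfl, _, hlo, hlo', hhi, hhi'⟩ <;>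
      rcases hF.cases ht' hq with hcl' | ⟨b, l, M, r, r', hb, hV', rfl, _, hlo2, hlo2', hhi2, hhi2'⟩
    -- Both branches at the edge are short, in T and in t alike. Both trees are therefore
    -- reassembled from the same pair of branches, although no vertex of T needs to be modeled by
    -- the root of t.
    · rw [← h4, h1] at hcl'
      obtain ⟨s', hs', hrep'⟩ := exists_represents_of_closed hcl'
      obtain ⟨s, hs, hrep⟩ := exists_represents_of_closed hcl
      have hTs : Represents T.graph T.color s (up v) v :=
        represents_of_branch_eq (h2.trans (hrep.branch_eq _)) hs
      have hTs' : Represents T.graph T.color s' v (up v) :=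
        represents_of_branch_eq (h1.trans (hrep'.branch_eq _)) hs'
      exact ⟨t, ht, _, v, x, Represents.of_both_sides (hadj v) hTs hTs',
        Represents.of_both_sides (Or.inl hp) hrep hrep'⟩
    · rw [← h2, h3, hhi2] at hcl
      exact absurd hcl (hhi2'.not_closed _)
    · rw [← h4, h1, hhi] at hcl'
      exact absurd hcl' (hhi'.not_closed _)
    · exfalso
      have h7 : m = r' := congrArg Prod.snd (hlo.symm.trans (h2.symm.trans (h3.trans hhi2)))
      have h8 : m' = r := congrArg Prod.snd (hhi.symm.trans (h1.symm.trans (h4.trans hlo2)))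
      subst h7 h8
      exact not_isUpper_of_reversed hV hV' hlo' hhi' hlo2' hhi2'

end Rigid

end LabelSystem

/-! ### Small diameters, and the checker of a label system -/

namespace RTree

variable {c : ℕ}

/-- The path of length `h`, rooted at one end. -/
def path (a : Fin c) : ℕ → RTree c
  | 0 => mk a []
  | h + 1 => mk a [path a h]

theorem height_path (a : Fin c) (h : ℕ) : (path a h).height = h := by
  induction h with
  | zero =>
    rw [← Nat.le_zero, height_le_iff, path, children_mk]
    simp
  | succ h ih =>
    rw [path, height_mk_eq (h := h)]
    · simp [ih]
    · exact ⟨_, List.mem_singleton_self _, ih⟩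

theorem size_path (a : Fin c) (h : ℕ) : (path a h).size = h + 1 := by
  induction h with
  | zero => rw [path, size_mk]; simp
  | succ h ih => rw [path, size_mk]; simp [ih, add_comm]

/-- A tree of prescribed order and diameter in which all branches at the root are short. -/
theorem exists_spider (a : Fin c) {D n : ℕ} (hD : 2 ≤ D) (hn : D + 1 ≤ n) :
    ∃ t : RTree c, t.size = n ∧ t.graph.diam = D ∧ ∀ s ∈ t.children, 2 * s.height + 1 ≤ D := by
  have h1 : ∀ r ∈ path a (D / 2 - 1) :: List.replicate (n - 1 - D) (mk a []),
      r.height ≤ D / 2 - 1 := by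
    intro r hr
    rw [List.mem_cons] at hr
    rcases hr with rfl | hr
    · rw [height_path]
    · rw [List.eq_of_mem_replicate hr]
      exact (height_path a 0).le.trans (Nat.zero_le _)
  -- The two legs, counted from the root, have ⌈D/2⌉ and ⌊D/2⌋ edges; leaves at the root make up the
  -- order.
  refine ⟨mk a (path a ((D + 1) / 2 - 1) :: path a (D / 2 - 1) ::
    List.replicate (n - 1 - D) (mk a [])), ?_, ?_, ?_⟩
  · have : (mk a [] : RTree c).size = 1 := size_path a 0
    rw [size_mk]
    simp [size_path, this]
    omega
  · rw [(diam_mk_cons (e := D / 2 - 1) ?_ ?_ h1 ⟨_, List.mem_cons_self, height_path _ _⟩).2,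
      height_path]
    · omega
    · intro x y
      have := dist_le_two_mul_height _ x y
      rw [height_path] at this ⊢
      omega
    · rw [height_path]
      omega
  · intro s hs
    rw [children_mk, List.mem_cons] at hs
    rcases hs with rfl | hs
    · rw [height_path]
      omega
    · have := h1 s hs
      omega

end RTree

namespace LabelSystem

variable {c e : ℕ} (A : LabelSystem c e)

/-- The number of vertices of a label. -/
def weight (i : ℕ) : ℕ := ((A.label i).map RTree.size).sum

theorem size_spine (k : ℕ) : (A.spine k).size = ∑ i ∈ range (k + 1), (1 + 2 * A.weight i) := by
  have hd : ∀ i, ((A.doubled i).map RTree.size).sum = 2 * A.weight i := by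
    intro i
    rw [doubled, List.map_append, List.sum_append, weight, two_mul]
  induction k with
  | zero => rw [spine, RTree.size_mk, hd]; simp
  | succ k ih =>
    rw [spine, RTree.size_mk, List.map_cons, List.sum_cons, hd, ih, sum_range_succ _ (k + 1)]
    ring

theorem size_comet (k N : ℕ) : (A.comet k N).size =
    1 + ∑ i ∈ range (k + 1), (1 + 2 * A.weight i) + 2 * A.weight 0 + N := by
  have hl : A.leaf.size = 1 := RTree.size_path _ 0
  rw [comet, RTree.size_mk, List.map_cons, List.sum_cons, size_spine, crown, List.map_append,
    List.sum_append, doubled, List.map_append, List.sum_append, List.map_replicate,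
    List.sum_replicate, hl, weight]
  simp only [smul_eq_mul]
  ring

/-- By `hsize`, a comet without its extra leaves uses at most half of the n vertices. The rest
become leaves, enough for `hvalid`. Diameters up to 2e + 2, too small for comets, come from spiders.
-/
theorem exists_checker {S : ℕ → ℝ} {κ : ℝ} {n₀ : ℕ} (hn₀ : 2 * e + 3 ≤ n₀)
    (hsize : ∀ n k : ℕ, n₀ ≤ n → (k : ℝ) ≤ κ * S n →
      2 * (1 + ∑ i ∈ range (k + 1), (1 + 2 * A.weight i) + 2 * A.weight 0) ≤ n)
    (hvalid : ∀ n k N : ℕ, n₀ ≤ n → (k : ℝ) ≤ κ * S n → n ≤ 2 * N → A.Valid k N) (f : ℕ → ℕ) :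
    ∃ L : LocalChecker c (e + 2), L.HasExactDiameter f ∧
      ∀ n : ℕ, n₀ ≤ n → 2 ≤ f n → (f n : ℝ) ≤ κ * S n → L.AcceptsOrder n := by
  let F : Set (RTree c) := {t | t.graph.diam = f t.size ∧
    ((∀ s ∈ t.children, s.height ≤ e) ∨ ∃ k N, A.Valid k N ∧ t = A.comet k N)}
  have hF : A.Admissible F := fun t ht => ht.2
  obtain ⟨L, hL, hacc⟩ := exists_checker_of_locallyRigid hF.locallyRigid (f := f)
    fun t ht => ht.1
  refine ⟨L, hL, fun n hn h2 hS => ?_⟩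
  suffices h : ∃ t ∈ F, t.size = n by
    obtain ⟨t, ht, rfl⟩ := h
    exact hacc t ht
  by_cases hD : f n ≤ 2 * e + 2
  · obtain ⟨t, ht, hd, hh⟩ := RTree.exists_spider A.color h2 (by omega : f n + 1 ≤ n)
    refine ⟨t, ⟨by rw [hd, ht], Or.inl fun s hs => ?_⟩, ht⟩
    have := hh s hs
    omega
  · obtain ⟨k, hk⟩ : ∃ k, f n = k + 2 * e + 3 := ⟨f n - (2 * e + 3), by omega⟩
    have hkS : (k : ℝ) ≤ κ * S n := by
      refine le_trans ?_ hS
      exact_mod_cast (by omega : k ≤ f n)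
    have h1 := hsize n k hn hkS
    set B := 1 + ∑ i ∈ range (k + 1), (1 + 2 * A.weight i) + 2 * A.weight 0 with hB
    have hsz : (A.comet k (n - B)).size = n := by
      rw [size_comet, ← hB]
      omega
    exact ⟨_, ⟨by rw [hsz, diam_comet, hk], Or.inr ⟨k, n - B, hvalid n k _ hn hkS (by omega), rfl⟩⟩,
      hsz⟩

end LabelSystem

/-! ### The code of order √i -/

/-- A sequence of order of growth `√i` in which any two consecutive terms determine their
position and order. -/
def walkCode (i : ℕ) : ℕ :=
  4 * (if i % 2 = 0 then Nat.sqrt (i / 4) else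
    2 * (i / 4 - Nat.sqrt (i / 4) * Nat.sqrt (i / 4) + Nat.sqrt (i / 4)) + Nat.sqrt (i / 4) % 2) +
  i % 4

theorem walkCode_mod (i : ℕ) : walkCode i % 4 = i % 4 := by
  rw [walkCode]
  omega

theorem walkCode_div (i : ℕ) : walkCode i / 4 =
    if i % 2 = 0 then Nat.sqrt (i / 4) else
    2 * (i / 4 - Nat.sqrt (i / 4) * Nat.sqrt (i / 4) + Nat.sqrt (i / 4)) +
      Nat.sqrt (i / 4) % 2 := by
  rw [walkCode]
  omega

theorem walkCode_le (i : ℕ) : walkCode i ≤ 24 * Nat.sqrt (i / 4) + 7 := by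
  have h := Nat.sqrt_le_add (i / 4)
  rw [walkCode]
  generalize Nat.sqrt (i / 4) * Nat.sqrt (i / 4) = q at *
  split_ifs <;> omega

/-- With i/4 = s² + t, the code stores t + s instead of t for the sake of this bound: it makes
neighboring codes comparable in size. -/
theorem le_walkCode (i : ℕ) : 4 * Nat.sqrt (i / 4) ≤ walkCode i := by
  rw [walkCode]
  split_ifs <;> omega

theorem walkCode_le_of_near {i j : ℕ} (h : i ≤ j + 1) : walkCode i ≤ 6 * walkCode j + 31 := by
  have h1 := walkCode_le i
  have h2 := le_walkCode j
  have h3 : Nat.sqrt (i / 4) ≤ Nat.sqrt (j / 4) + 1 :=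
    (Nat.sqrt_le_sqrt (by omega : i / 4 ≤ (j / 4).succ)).trans (Nat.sqrt_succ_le_succ_sqrt _)
  omega

/-- Residues modulo 4 grow by one along the path; a reversal would give 2 ≡ 0. -/
theorem walkCode_not_reversed {i j : ℕ} (h : walkCode i = walkCode (j + 1)) :
    walkCode (i + 1) ≠ walkCode j := by
  intro h'
  have h1 := walkCode_mod i
  have h2 := walkCode_mod j
  have h3 := walkCode_mod (i + 1)
  have h4 := walkCode_mod (j + 1)
  omega

/-- Of two consecutive codes one shows s and the other t + s, which gives i/4 = s² + t; the residue
modulo 4 does the rest. -/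
theorem eq_of_walkCode_eq {i j : ℕ} (h : walkCode i = walkCode j)
    (h' : walkCode (i + 1) = walkCode (j + 1)) : i = j := by
  have hm : i % 4 = j % 4 := by rw [← walkCode_mod, h, walkCode_mod]
  have hd := congrArg (· / 4) h
  have hd' := congrArg (· / 4) h'
  simp only [walkCode_div] at hd hd'
  suffices hs : Nat.sqrt (i / 4) = Nat.sqrt (j / 4) ∧
      i / 4 - Nat.sqrt (i / 4) * Nat.sqrt (i / 4) = j / 4 - Nat.sqrt (j / 4) * Nat.sqrt (j / 4) by
    have h1 := Nat.sqrt_le (i / 4)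
    have h2 := Nat.sqrt_le (j / 4)
    obtain ⟨hs1, hs2⟩ := hs
    rw [hs1] at hs2 h1
    omega
  -- Only here do the two codes belong to different values of i/4. The root may have grown by one in
  -- between, and the parity of s stored in the odd code decides this.
  by_cases hi : i % 4 = 3
  · have e1 : (i + 1) / 4 = i / 4 + 1 := by omega
    have e2 : (j + 1) / 4 = j / 4 + 1 := by omega
    rw [if_pos (by omega), if_pos (by omega), e1, e2] at hd'
    rw [if_neg (by omega), if_neg (by omega)] at hd
    have a1 := Nat.sqrt_succ_le_succ_sqrt (i / 4)
    have a2 := Nat.sqrt_succ_le_succ_sqrt (j / 4)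
    have a3 := Nat.sqrt_le_sqrt (Nat.le_succ (i / 4))
    have a4 := Nat.sqrt_le_sqrt (Nat.le_succ (j / 4))
    simp only [Nat.succ_eq_add_one] at a1 a2 a3 a4
    generalize i / 4 - Nat.sqrt (i / 4) * Nat.sqrt (i / 4) = q at *
    generalize j / 4 - Nat.sqrt (j / 4) * Nat.sqrt (j / 4) = r at *
    omega
  · have e1 : (i + 1) / 4 = i / 4 := by omega
    have e2 : (j + 1) / 4 = j / 4 := by omega
    rw [e1, e2] at hd'
    generalize i / 4 - Nat.sqrt (i / 4) * Nat.sqrt (i / 4) = q at *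
    generalize j / 4 - Nat.sqrt (j / 4) * Nat.sqrt (j / 4) = r at *
    rcases Nat.mod_two_eq_zero_or_one i with h2 | h2
    · rw [if_pos h2, if_pos (by omega)] at hd
      rw [if_neg (by omega), if_neg (by omega)] at hd'
      omega
    · rw [if_neg (by omega), if_neg (by omega)] at hd
      rw [if_pos (by omega), if_pos (by omega)] at hd'
      omega

/-! ### Distance 1: colored paths -/

/-- Colors for paths whose vertices are located by consecutive colors: `K` colors for the vertices
of the path, `K` for a center at its end, one for leaves and one for the center of a star. -/
structure PathColoring (c K : ℕ) where
  leafColor : Fin c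
  starColor : Fin c
  armColor : ℕ → Fin c
  centerColor : ℕ → Fin c
  leaf_ne_star : leafColor ≠ starColor
  arm_ne_leaf : ∀ i < K, armColor i ≠ leafColor
  arm_ne_star : ∀ i < K, armColor i ≠ starColor
  center_ne_leaf : ∀ i < K, centerColor i ≠ leafColor
  center_ne_star : ∀ i < K, centerColor i ≠ starColor
  arm_ne_center : ∀ i < K, ∀ j < K, armColor i ≠ centerColor j
  eq_of_consecutive : ∀ i j, i + 1 < K → j + 1 < K → armColor i = armColor j →
    armColor (i + 1) = armColor (j + 1) → i = j
  not_reversed : ∀ i j, i + 1 < K → j + 1 < K → armColor i = armColor (j + 1) →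
    armColor (i + 1) ≠ armColor j
  eq_of_center : ∀ i < K, ∀ j < K, armColor i = armColor j → centerColor i = centerColor j → i = j

namespace PathColoring

variable {c K : ℕ} (P : PathColoring c K)

/-- The single vertex. -/
def leaf : RTree c := RTree.mk P.leafColor []

/-- The colored path with `i + 1` vertices. -/
def arm : ℕ → RTree c
  | 0 => RTree.mk (P.armColor 0) []
  | i + 1 => RTree.mk (P.armColor (i + 1)) [arm i]

/-- The star with `N` leaves. -/
def star (N : ℕ) : RTree c := RTree.mk P.starColor (List.replicate N P.leaf)

/-- A center with `N` leaves, from which a colored path with `k + 1` vertices emanates. -/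
def comet (k N : ℕ) : RTree c := RTree.mk (P.centerColor k) (P.arm k :: List.replicate N P.leaf)

/-- The colors seen below a vertex of the path. -/
def lower : ℕ → Multiset (Fin c)
  | 0 => 0
  | i + 1 => {P.armColor i}

/-- The colors of a vertex and of its neighbors in members of the family `F`. -/
inductive LocalType (F : Set (RTree c)) : Fin c → Multiset (Fin c) → Prop
  | star (N : ℕ) (h : P.star N ∈ F) :
      LocalType F P.starColor (Multiset.replicate N P.leafColor)
  | center (k N : ℕ) (hk : k < K) (h : P.comet k N ∈ F) :
      LocalType F (P.centerColor k) (P.armColor k ::ₘ Multiset.replicate N P.leafColor)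
  | leafStar : LocalType F P.leafColor {P.starColor}
  | leafCenter (k : ℕ) (hk : k < K) : LocalType F P.leafColor {P.centerColor k}
  | armInner (i : ℕ) (hi : i + 1 < K) :
      LocalType F (P.armColor i) (P.armColor (i + 1) ::ₘ P.lower i)
  | armTop (i : ℕ) (hi : i < K) :
      LocalType F (P.armColor i) (P.centerColor i ::ₘ P.lower i)

/-- The members of the family are stars and comets. -/
def Admissible (F : Set (RTree c)) : Prop :=
  ∀ t ∈ F, (∃ N, t = P.star N) ∨ ∃ k N, k < K ∧ t = P.comet k N

variable {P}

theorem rootColor_arm (i : ℕ) : (P.arm i).rootColor = P.armColor i := by cases i <;> rfl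

theorem map_children_arm (i : ℕ) :
    ((P.arm i).children : Multiset (RTree c)).map RTree.rootColor = P.lower i := by
  cases i with
  | zero => rw [arm, RTree.children_mk]; rfl
  | succ i => rw [arm, RTree.children_mk, lower, ← rootColor_arm]; rfl

theorem map_color_nbr_root (t : RTree c) : (nbr t.graph t.root t.root).val.map t.color =
    (t.children : Multiset (RTree c)).map RTree.rootColor :=
  congrArg Prod.snd (t.represents_self.branch_eq 1)

theorem map_color_nbr {t : RTree c} {x p : t.Vert} (h : t.parent x = some p) :
    (nbr t.graph x x).val.map t.color =
      t.color p ::ₘ ((t.subtree x).children : Multiset (RTree c)).map RTree.rootColor := by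
  rw [map_nbr_self _ (show t.graph.Adj x p from Or.inl h)]
  congr 1
  exact congrArg Prod.snd ((t.represents_subtree (Or.inl h)).branch_eq 1)

theorem color_root (t : RTree c) : t.color t.root = t.rootColor := by
  rw [RTree.color, RTree.subtree_root]

theorem subtree_star {N : ℕ} {x p : (P.star N).Vert} (h : (P.star N).parent x = some p) :
    (P.star N).subtree x = P.leaf ∧ p = (P.star N).root := by
  induction hn : (P.star N).depth x using Nat.strong_induction_on generalizing x p with
  | _ n ih =>
    have hmem := RTree.subtree_mem_children h
    rcases hp : (P.star N).parent p with _ | q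
    · have hp := RTree.eq_root_of_parent_eq_none hp
      subst hp
      have hc : (P.star N).children = List.replicate N P.leaf := RTree.children_mk _ _
      rw [RTree.subtree_root, hc] at hmem
      exact ⟨List.eq_of_mem_replicate hmem, rfl⟩
    · have hd := RTree.depth_eq_of_parent h
      have := (ih _ (by omega) hp rfl).1
      rw [this, leaf, RTree.children_mk] at hmem
      cases hmem

theorem subtree_comet {k N : ℕ} {x p : (P.comet k N).Vert} (h : (P.comet k N).parent x = some p) :
    ((P.comet k N).subtree x = P.leaf ∧ p = (P.comet k N).root) ∨
    ((P.comet k N).subtree x = P.arm k ∧ p = (P.comet k N).root) ∨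
    ∃ i < k, (P.comet k N).subtree x = P.arm i ∧ (P.comet k N).subtree p = P.arm (i + 1) := by
  induction hn : (P.comet k N).depth x using Nat.strong_induction_on generalizing x p with
  | _ n ih =>
    have hmem := RTree.subtree_mem_children h
    have harm : ∀ j, (P.comet k N).subtree p = P.arm j → ∃ i, j = i + 1 ∧
        (P.comet k N).subtree x = P.arm i := by
      intro j hj
      rw [hj] at hmem
      cases j with
      | zero =>
        rw [arm, RTree.children_mk] at hmem
        cases hmem
      | succ j =>
        rw [arm, RTree.children_mk, List.mem_singleton] at hmem
        exact ⟨j, rfl, hmem⟩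
    rcases hp : (P.comet k N).parent p with _ | q
    · have hp := RTree.eq_root_of_parent_eq_none hp
      subst hp
      have hc : (P.comet k N).children = P.arm k :: List.replicate N P.leaf :=
        RTree.children_mk _ _
      rw [RTree.subtree_root, hc, List.mem_cons] at hmem
      rcases hmem with hmem | hmem
      · exact Or.inr (Or.inl ⟨hmem, rfl⟩)
      · exact Or.inl ⟨List.eq_of_mem_replicate hmem, rfl⟩
    · have hd := RTree.depth_eq_of_parent h
      rcases ih _ (by omega) hp rfl with h1 | h1 | ⟨j, hj, h1⟩
      · rw [h1.1, leaf, RTree.children_mk] at hmem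
        cases hmem
      · obtain ⟨i, hi, hx⟩ := harm k h1.1
        exact Or.inr (Or.inr ⟨i, by omega, hx, by rw [h1.1, hi]⟩)
      · obtain ⟨i, hi, hx⟩ := harm j h1.1
        exact Or.inr (Or.inr ⟨i, by omega, hx, by rw [h1.1, hi]⟩)

theorem Admissible.localType {F : Set (RTree c)} (hF : P.Admissible F) {t : RTree c} (ht : t ∈ F)
    (x : t.Vert) : P.LocalType F (t.color x) ((nbr t.graph x x).val.map t.color) := by
  rcases hx : t.parent x with _ | p
  · have hx := RTree.eq_root_of_parent_eq_none hx
    subst hx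
    rw [map_color_nbr_root, color_root]
    obtain ⟨N, rfl⟩ | ⟨k, N, hk, rfl⟩ := hF t ht
    · have hc : (P.star N).children = List.replicate N P.leaf := RTree.children_mk _ _
      rw [hc, Multiset.coe_replicate, Multiset.map_replicate]
      exact LocalType.star N ht
    · have hc : (P.comet k N).children = P.arm k :: List.replicate N P.leaf :=
        RTree.children_mk _ _
      rw [hc, ← Multiset.cons_coe, Multiset.map_cons, Multiset.coe_replicate,
        Multiset.map_replicate, rootColor_arm]
      exact LocalType.center k N hk ht
  · rw [map_color_nbr hx]
    obtain ⟨N, rfl⟩ | ⟨k, N, hk, rfl⟩ := hF t ht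
    · obtain ⟨h1, rfl⟩ := subtree_star hx
      rw [color_root, RTree.color, h1, leaf, RTree.children_mk]
      exact LocalType.leafStar
    · obtain ⟨h1, rfl⟩ | ⟨h1, rfl⟩ | ⟨i, hi, h1, h2⟩ := subtree_comet hx
      · rw [color_root, RTree.color, h1, leaf, RTree.children_mk]
        exact LocalType.leafCenter k hk
      · rw [color_root, RTree.color, h1, map_children_arm, rootColor_arm]
        exact LocalType.armTop k hk
      · rw [RTree.color, RTree.color, h1, h2, map_children_arm, rootColor_arm, rootColor_arm]
        exact LocalType.armInner i (by omega)

section Rigid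

variable {F : Set (RTree c)} {T : ColoredTree c}

theorem represents_leaf (hT : ∀ v, P.LocalType F (T.color v)
    ((nbr T.graph v v).val.map T.color)) {z w : T.V} (hadj : T.graph.Adj z w)
    (hw : T.color w = P.leafColor) : Represents T.graph T.color P.leaf z w := by
  have hdeg : Multiset.card ((nbr T.graph w w).val.map T.color) = 1 := by
    have := hT w
    generalize (nbr T.graph w w).val.map T.color = m at this
    generalize T.color w = a at this hw
    cases this with
    | star N h => exact absurd hw.symm P.leaf_ne_star
    | center k N hk h => exact absurd hw (P.center_ne_leaf k hk)
    | leafStar => rfl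
    | leafCenter k hk => rfl
    | armInner i hi => exact absurd hw (P.arm_ne_leaf i (by omega))
    | armTop i hi => exact absurd hw (P.arm_ne_leaf i hi)
  rw [map_nbr_self _ hadj.symm, Multiset.card_cons, Multiset.card_map, Nat.add_eq_right,
    Finset.card_val, Finset.card_eq_zero] at hdeg
  have : Nonempty (RTree c) := ⟨P.leaf⟩
  refine represents_iff.2 ⟨hw, fun _ => P.leaf, ?_, ?_⟩
  · rw [hdeg, leaf, RTree.children_mk]
    rfl
  · intro v hv
    rw [hdeg] at hv
    cases hv

/-- A vertex with the color of position i next to one with the color of i + 1 must itself model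
position i: the larger color cannot lie below it by `not_reversed` and is no center color, so
`eq_of_consecutive` applies. -/
theorem represents_arm (hT : ∀ v, P.LocalType F (T.color v)
    ((nbr T.graph v v).val.map T.color)) {i : ℕ} (hi : i < K) {u w : T.V}
    (hadj : T.graph.Adj w u) (hw : T.color w = P.armColor i)
    (hmap : (nbr T.graph u w).val.map T.color = P.lower i) :
    Represents T.graph T.color (P.arm i) u w := by
  have : Nonempty (RTree c) := ⟨P.leaf⟩
  induction i generalizing u w with
  | zero =>
    refine represents_iff.2 ⟨hw, fun _ => P.leaf, ?_, ?_⟩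
    · rw [arm, RTree.children_mk]
      rw [lower, Multiset.map_eq_zero] at hmap
      rw [hmap]
      rfl
    · intro v hv
      rw [lower, Multiset.map_eq_zero, Finset.val_eq_zero] at hmap
      rw [hmap] at hv
      cases hv
  | succ i ih =>
    refine represents_iff.2 ⟨hw, fun _ => P.arm i, ?_, ?_⟩
    · rw [arm, RTree.children_mk, Multiset.map_const']
      have := congrArg Multiset.card hmap
      rw [Multiset.card_map] at this
      rw [this]
      rfl
    · intro v hv
      have hcol : T.color v = P.armColor i := by
        have := Multiset.mem_map_of_mem T.color hv
        rw [hmap] at this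
        exact Multiset.mem_singleton.1 this
      have hvw := (mem_nbr.1 hv).1
      refine ih (by omega) hvw.symm hcol ?_
      have hm := map_nbr_self T.color hvw.symm
      rw [hw] at hm
      have := hT v
      generalize (nbr T.graph v v).val.map T.color = m at this hm
      generalize T.color v = a at this hcol
      have hmem : P.armColor (i + 1) ∈ m := by rw [hm]; exact Multiset.mem_cons_self _ _
      have hlow : ∀ j < K, P.armColor j = P.armColor i → P.armColor (i + 1) ∉ P.lower j := by
        intro j hj hji hmem
        cases j with
        | zero => cases hmem
        | succ j =>
          exact P.not_reversed i j hi hj hji.symm (Multiset.mem_singleton.1 hmem)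
      cases this with
      | star N h => exact absurd hcol.symm (P.arm_ne_star i (by omega))
      | center k N hk h => exact absurd hcol.symm (P.arm_ne_center i (by omega) k hk)
      | leafStar => exact absurd hcol.symm (P.arm_ne_leaf i (by omega))
      | leafCenter k hk => exact absurd hcol.symm (P.arm_ne_leaf i (by omega))
      | armInner j hj =>
        rw [Multiset.mem_cons] at hmem
        rcases hmem with h | h
        · obtain rfl := P.eq_of_consecutive i j hi hj hcol.symm h
          exact ((Multiset.cons_inj_right _).1 hm).symm
        · exact absurd h (hlow j (by omega) hcol)
      | armTop j hj =>
        rw [Multiset.mem_cons] at hmem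
        rcases hmem with h | h
        · exact absurd h (P.arm_ne_center _ hi j hj)
        · exact absurd h (hlow j hj hcol)

theorem represents_star (hT : ∀ v, P.LocalType F (T.color v)
    ((nbr T.graph v v).val.map T.color)) {N : ℕ} {z : T.V} (hz : T.color z = P.starColor)
    (hmap : (nbr T.graph z z).val.map T.color = Multiset.replicate N P.leafColor) :
    Represents T.graph T.color (P.star N) z z := by
  refine represents_iff.2 ⟨hz, fun _ => P.leaf, ?_, fun v hv => ?_⟩
  · have := congrArg Multiset.card hmap
    rw [Multiset.card_map, Multiset.card_replicate] at this
    rw [star, RTree.children_mk, Multiset.map_const', this, Multiset.coe_replicate]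
  · have h1 := Multiset.mem_map_of_mem T.color hv
    rw [hmap] at h1
    exact represents_leaf hT (mem_nbr_self.1 hv) (Multiset.eq_of_mem_replicate h1)

/-- The colors of the center and of the top of the path together identify k by `eq_of_center`; from
there `represents_arm` descends. -/
theorem represents_comet (hT : ∀ v, P.LocalType F (T.color v)
    ((nbr T.graph v v).val.map T.color)) {k N : ℕ} (hk : k < K) {z : T.V}
    (hz : T.color z = P.centerColor k)
    (hmap : (nbr T.graph z z).val.map T.color =
      P.armColor k ::ₘ Multiset.replicate N P.leafColor) :
    Represents T.graph T.color (P.comet k N) z z := by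
  classical
  obtain ⟨w, hw, hwk⟩ := Multiset.mem_map.1
    (show P.armColor k ∈ (nbr T.graph z z).val.map T.color by
      rw [hmap]; exact Multiset.mem_cons_self _ _)
  have hadj := mem_nbr_self.1 hw
  have harm : Represents T.graph T.color (P.arm k) z w := by
    refine represents_arm hT hk hadj.symm hwk ?_
    have hm := map_nbr_self T.color hadj.symm
    rw [hz] at hm
    have := hT w
    generalize (nbr T.graph w w).val.map T.color = m at this hm
    generalize T.color w = a at this hwk
    have hmem : P.centerColor k ∈ m := by rw [hm]; exact Multiset.mem_cons_self _ _
    have hlow : ∀ j < K, P.centerColor k ∉ P.lower j := by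
      intro j hj hmem
      cases j with
      | zero => cases hmem
      | succ j => exact P.arm_ne_center j (by omega) k hk (Multiset.mem_singleton.1 hmem).symm
    cases this with
    | star N h => exact absurd hwk.symm (P.arm_ne_star k hk)
    | center j N hj h => exact absurd hwk.symm (P.arm_ne_center k hk j hj)
    | leafStar => exact absurd hwk.symm (P.arm_ne_leaf k hk)
    | leafCenter j hj => exact absurd hwk.symm (P.arm_ne_leaf k hk)
    | armInner j hj =>
      rw [Multiset.mem_cons] at hmem
      rcases hmem with h | h
      · exact absurd h.symm (P.arm_ne_center _ hj k hk)
      · exact absurd h (hlow j (by omega))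
    | armTop j hj =>
      rw [Multiset.mem_cons] at hmem
      rcases hmem with h | h
      · obtain rfl := P.eq_of_center k hk j hj hwk.symm h
        exact ((Multiset.cons_inj_right _).1 hm).symm
      · exact absurd h (hlow j hj)
  rw [map_nbr_self _ hadj, hwk, Multiset.cons_inj_right] at hmap
  have hcard := congrArg Multiset.card hmap
  rw [Multiset.card_map, Multiset.card_replicate] at hcard
  have hne : ∀ v ∈ nbr T.graph w z, v ≠ w := fun v hv => (mem_nbr.1 hv).2
  refine represents_iff.2 ⟨hz, Function.update (fun _ => P.leaf) w (P.arm k), ?_, fun v hv => ?_⟩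
  · rw [map_nbr_self _ hadj, Function.update_self, comet, RTree.children_mk, ← Multiset.cons_coe]
    congr 1
    rw [Multiset.map_congr rfl fun v hv => Function.update_of_ne (hne v hv) _ _,
      Multiset.map_const', hcard, Multiset.coe_replicate]
  · by_cases hvw : v = w
    · subst hvw
      rwa [Function.update_self]
    · rw [Function.update_of_ne hvw]
      have hv := mem_nbr_self.1 hv
      have h1 := Multiset.mem_map_of_mem T.color
        (show v ∈ (nbr T.graph w z).val from mem_nbr.2 ⟨hv, hvw⟩)
      rw [hmap] at h1
      exact represents_leaf hT hv (Multiset.eq_of_mem_replicate h1)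

/-- A vertex with a center or star color already determines the whole tree. Without such colors
there are no leaf colors and no tops of paths either, so every vertex points to a neighbor one
position higher. Two vertices pointing at each other then violate `not_reversed`. -/
theorem Admissible.locallyRigid (hF : P.Admissible F) : LocallyRigid 1 F := by
  intro T hT
  have hT : ∀ v, P.LocalType F (T.color v) ((nbr T.graph v v).val.map T.color) := by
    intro v
    obtain ⟨t, ht, x, hx⟩ := hT v
    have h1 : T.color v = t.color x := congrArg Prod.fst hx
    have h2 : (nbr T.graph v v).val.map T.color = (nbr t.graph x x).val.map t.color :=
      congrArg Prod.snd hx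
    rw [h1, h2]
    exact hF.localType ht x
  suffices h : ∃ t ∈ F, ∃ z : T.V, Represents T.graph T.color t z z by
    obtain ⟨t, ht, z, hz⟩ := h
    exact ⟨t, ht, t, z, t.root, hz, t.represents_self⟩
  by_contra hcon
  push Not at hcon
  have hstar : ∀ z, T.color z ≠ P.starColor := by
    intro z hz
    have h1 := hT z
    generalize hm : (nbr T.graph z z).val.map T.color = m at h1
    generalize ha : T.color z = a at h1
    rw [ha] at hz
    cases h1 with
    | star N h => exact hcon _ h z (represents_star hT ha hm)
    | center j N hj h => exact P.center_ne_star j hj hz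
    | leafStar => exact P.leaf_ne_star hz
    | leafCenter j hj => exact P.leaf_ne_star hz
    | armInner j hj => exact P.arm_ne_star j (by omega) hz
    | armTop j hj => exact P.arm_ne_star j hj hz
  have hcenter : ∀ k < K, ∀ z, T.color z ≠ P.centerColor k := by
    intro k hk z hz
    have h1 := hT z
    generalize hm : (nbr T.graph z z).val.map T.color = m at h1
    generalize ha : T.color z = a at h1
    rw [ha] at hz
    cases h1 with
    | star N h => exact P.center_ne_star k hk hz.symm
    | center j N hj h => exact hcon _ h z (represents_comet hT hj ha hm)
    | leafStar => exact P.center_ne_leaf k hk hz.symm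
    | leafCenter j hj => exact P.center_ne_leaf k hk hz.symm
    | armInner j hj => exact P.arm_ne_center j (by omega) k hk hz
    | armTop j hj => exact P.arm_ne_center j hj k hk hz
  have hup : ∀ v, ∃ u, T.graph.Adj v u ∧ ∃ i, i + 1 < K ∧ T.color v = P.armColor i ∧
      T.color u = P.armColor (i + 1) := by
    intro v
    have h1 := hT v
    generalize hm : (nbr T.graph v v).val.map T.color = m at h1
    generalize ha : T.color v = a at h1
    have hex : ∀ b ∈ m, ∃ u, T.graph.Adj v u ∧ T.color u = b := by
      intro b hb
      rw [← hm] at hb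
      obtain ⟨u, hu, hub⟩ := Multiset.mem_map.1 hb
      exact ⟨u, mem_nbr_self.1 hu, hub⟩
    cases h1 with
    | star N h => exact absurd ha (hstar v)
    | center j N hj h => exact absurd ha (hcenter j hj v)
    | leafStar =>
      obtain ⟨u, _, hu⟩ := hex _ (Multiset.mem_singleton_self _)
      exact absurd hu (hstar u)
    | leafCenter j hj =>
      obtain ⟨u, _, hu⟩ := hex _ (Multiset.mem_singleton_self _)
      exact absurd hu (hcenter j hj u)
    | armInner j hj =>
      obtain ⟨u, hadj, hu⟩ := hex _ (Multiset.mem_cons_self _ _)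
      exact ⟨u, hadj, j, hj, rfl, hu⟩
    | armTop j hj =>
      obtain ⟨u, _, hu⟩ := hex _ (Multiset.mem_cons_self _ _)
      exact absurd hu (hcenter j hj u)
  choose up hadj hmodel using hup
  obtain ⟨v, hv⟩ := T.isTree.exists_apply_apply_eq hadj
  obtain ⟨i, hi, h1, h2⟩ := hmodel v
  obtain ⟨j, hj, h3, h4⟩ := hmodel (up v)
  rw [hv] at h4
  exact P.not_reversed i j hi hj (h1.symm.trans h4) (h2.symm.trans h3)

end Rigid

theorem height_leaf : P.leaf.height = 0 := RTree.height_path _ 0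

theorem size_leaf : P.leaf.size = 1 := RTree.size_path _ 0

theorem height_arm (i : ℕ) : (P.arm i).height = i := by
  induction i with
  | zero => exact RTree.height_path _ 0
  | succ i ih =>
    rw [arm, RTree.height_mk_eq (h := i)]
    · simp [ih]
    · exact ⟨_, List.mem_singleton_self _, ih⟩

theorem size_arm (i : ℕ) : (P.arm i).size = i + 1 := by
  induction i with
  | zero => exact RTree.size_path _ 0
  | succ i ih => rw [arm, RTree.size_mk]; simp [ih, add_comm]

theorem dist_arm_le (i : ℕ) : ∀ x y, (P.arm i).graph.dist x y ≤ i := by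
  induction i with
  | zero =>
    intro x y
    have := RTree.dist_le_two_mul_height _ x y
    rwa [height_arm] at this
  | succ i ih =>
    rw [arm]
    have h0 : ∀ j : Fin [P.arm i].length, [P.arm i].get j = P.arm i := by
      intro j
      have : [P.arm i].get j ∈ [P.arm i] := List.get_mem _ _
      exact List.mem_singleton.1 this
    refine RTree.dist_node_le ?_ ?_ ?_
    · intro j
      rw [h0]
      exact fun x y => (ih x y).trans (Nat.le_succ i)
    · intro j l hjl
      exact absurd (Fin.ext (by have := j.2; have := l.2; simp at *)) hjl
    · intro j
      rw [h0, height_arm]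

theorem diam_comet (k N : ℕ) : (P.comet k (N + 1)).graph.diam = k + 2 := by
  rw [comet, (RTree.diam_mk_cons (e := 0) (fun x y => ?_) (Nat.zero_le _) (fun r hr => ?_)
    ⟨P.leaf, by simp, height_leaf⟩).2, height_arm]
  · have := dist_arm_le (P := P) k x y
    rw [height_arm]
    omega
  · rw [List.eq_of_mem_replicate hr, height_leaf]

theorem diam_star (N : ℕ) : (P.star (N + 2)).graph.diam = 2 := by
  rw [star, List.replicate_succ, (RTree.diam_mk_cons (e := 0) (fun x y => ?_) (Nat.zero_le _)
    (fun r hr => ?_) ⟨P.leaf, by simp, height_leaf⟩).2, height_leaf]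
  · have := RTree.dist_le_two_mul_height _ x y
    rw [height_leaf] at this
    omega
  · rw [List.eq_of_mem_replicate hr, height_leaf]

theorem size_comet (k N : ℕ) : (P.comet k N).size = k + 2 + N := by
  rw [comet, RTree.size_mk]
  simp [size_arm, size_leaf]
  ring

theorem size_star (N : ℕ) : (P.star N).size = N + 1 := by
  rw [star, RTree.size_mk]
  simp [size_leaf, add_comm]

theorem exists_checker (P : PathColoring c K) (f : ℕ → ℕ) :
    ∃ L : LocalChecker c 1, L.HasExactDiameter f ∧
      ∀ n : ℕ, K + 3 ≤ n → 2 ≤ f n → f n ≤ max 2 (K + 1) → L.AcceptsOrder n := by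
  let F : Set (RTree c) := {t | t.graph.diam = f t.size ∧
    ((∃ N, t = P.star N) ∨ ∃ k N, k < K ∧ t = P.comet k N)}
  have hF : P.Admissible F := fun t ht => ht.2
  obtain ⟨L, hL, hacc⟩ := exists_checker_of_locallyRigid hF.locallyRigid (f := f)
    fun t ht => ht.1
  refine ⟨L, hL, fun n hn h2 hS => ?_⟩
  suffices h : ∃ t ∈ F, t.size = n by
    obtain ⟨t, ht, rfl⟩ := h
    exact hacc t ht
  by_cases hD : f n = 2
  · obtain ⟨N, rfl⟩ : ∃ N, n = N + 2 + 1 := ⟨n - 3, by omega⟩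
    have hs : (P.star (N + 2)).size = N + 2 + 1 := size_star _
    exact ⟨_, ⟨by rw [hs, diam_star, hD], Or.inl ⟨_, rfl⟩⟩, hs⟩
  · obtain ⟨k, hk⟩ : ∃ k, f n = k + 2 := ⟨f n - 2, by omega⟩
    have hkK : k < K := by omega
    obtain ⟨N, rfl⟩ : ∃ N, n = k + 2 + (N + 1) := ⟨n - k - 3, by omega⟩
    have hs : (P.comet k (N + 1)).size = k + 2 + (N + 1) := size_comet _ _
    exact ⟨_, ⟨by rw [hs, diam_comet, hk], Or.inr ⟨k, _, hkK, rfl⟩⟩, hs⟩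

end PathColoring

theorem walkCode_lt_of_le {c K i : ℕ} (hc : 500 ≤ c) (hK : K * 100000 ≤ c ^ 2) (hi : i ≤ K) :
    walkCode i < (c - 2) / 2 := by
  have h1 := walkCode_le i
  have h2 := Nat.sqrt_le (i / 4)
  -- The constant 632 is chosen so that 632² < 4 · 100000.
  have h3 : 632 * Nat.sqrt (i / 4) ≤ c := by
    by_contra! h
    have h4 : c * c <
        (632 * Nat.sqrt (i / 4)) * (632 * Nat.sqrt (i / 4)) := Nat.mul_self_lt_mul_self h
    have h5 : i / 4 * 4 ≤ K := by omega
    nlinarith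
  omega

/-- The vertices of the path are colored by their code, the center by that of the next position. -/
def walkColoring {c K : ℕ} (hc : 2 ≤ c)
    (hK : K = 0 ∨ ∀ i ≤ K, walkCode i < (c - 2) / 2) : PathColoring c K where
  leafColor := ⟨1, by omega⟩
  starColor := ⟨0, by omega⟩
  -- After two reserved colors, the path and the centers get disjoint ranges of (c - 2)/2 colors.
  -- The reduction modulo c only makes the functions total; nothing wraps around for positions in
  -- use.
  armColor i := ⟨(2 + walkCode i) % c, Nat.mod_lt _ (by omega)⟩
  centerColor i := ⟨(2 + (c - 2) / 2 + walkCode (i + 1)) % c, Nat.mod_lt _ (by omega)⟩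
  leaf_ne_star := by simp
  arm_ne_leaf i hi := by
    have h := hK.resolve_left (by omega) i (by omega)
    rw [Ne, Fin.mk.injEq, Nat.mod_eq_of_lt (by omega)]
    omega
  arm_ne_star i hi := by
    have h := hK.resolve_left (by omega) i (by omega)
    rw [Ne, Fin.mk.injEq, Nat.mod_eq_of_lt (by omega)]
    omega
  center_ne_leaf i hi := by
    have h := hK.resolve_left (by omega) (i + 1) (by omega)
    rw [Ne, Fin.mk.injEq, Nat.mod_eq_of_lt (by omega)]
    omega
  center_ne_star i hi := by
    have h := hK.resolve_left (by omega) (i + 1) (by omega)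
    rw [Ne, Fin.mk.injEq, Nat.mod_eq_of_lt (by omega)]
    omega
  arm_ne_center i hi j hj := by
    have h := hK.resolve_left (by omega) i (by omega)
    have h' := hK.resolve_left (by omega) (j + 1) (by omega)
    rw [Ne, Fin.mk.injEq, Nat.mod_eq_of_lt (by omega), Nat.mod_eq_of_lt (by omega)]
    omega
  eq_of_consecutive i j hi hj h h' := by
    have hK := hK.resolve_left (by omega)
    have h1 := hK i (by omega)
    have h2 := hK j (by omega)
    have h3 := hK (i + 1) (by omega)
    have h4 := hK (j + 1) (by omega)
    rw [Fin.mk.injEq, Nat.mod_eq_of_lt (by omega), Nat.mod_eq_of_lt (by omega)] at h h'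
    exact eq_of_walkCode_eq (by omega) (by omega)
  not_reversed i j hi hj h h' := by
    have hK := hK.resolve_left (by omega)
    have h1 := hK i (by omega)
    have h2 := hK j (by omega)
    have h3 := hK (i + 1) (by omega)
    have h4 := hK (j + 1) (by omega)
    rw [Fin.mk.injEq, Nat.mod_eq_of_lt (by omega), Nat.mod_eq_of_lt (by omega)] at h h'
    exact walkCode_not_reversed (i := i) (j := j) (by omega) (by omega)
  eq_of_center i hi j hj h h' := by
    have hK := hK.resolve_left (by omega)
    have h1 := hK i (by omega)
    have h2 := hK j (by omega)
    have h3 := hK (i + 1) (by omega)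
    have h4 := hK (j + 1) (by omega)
    rw [Fin.mk.injEq, Nat.mod_eq_of_lt (by omega), Nat.mod_eq_of_lt (by omega)] at h h'
    exact eq_of_walkCode_eq (by omega) (by omega)

/-- The checker that accepts nothing. -/
def rejectAll (c d : ℕ) : LocalChecker c d := ⟨fun _ => False, fun _ _ _ => Iff.rfl⟩

theorem hasExactDiameter_rejectAll (c d : ℕ) (f : ℕ → ℕ) : (rejectAll c d).HasExactDiameter f := by
  intro n T hT
  have := T.isTree.connected.nonempty
  exact (hT (Classical.arbitrary T.V)).elim

theorem exists_checker_distance_one (c : ℕ) : ∃ n₀ : ℕ, ∀ f : ℕ → ℕ,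
    ∃ L : LocalChecker c 1, L.HasExactDiameter f ∧
      ∀ n : ℕ, n₀ ≤ n → 2 ≤ c → 2 ≤ f n → (f n : ℝ) ≤ max 2 (9 / 100000 * threshold c 1 n) →
        L.AcceptsOrder n := by
  by_cases hc : 2 ≤ c
  swap
  · exact ⟨0, fun f => ⟨_, hasExactDiameter_rejectAll c 1 f, fun n _ h => absurd h hc⟩⟩
  have key : ∃ K, (K = 0 ∨ ∀ i ≤ K, walkCode i < (c - 2) / 2) ∧
      ∀ m : ℕ, m * 100000 ≤ c ^ 2 → m ≤ max 2 (K + 1) := by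
    -- For smaller c the bound c²/100000 is below 3, so only diameter 2 is required and K = 0
    -- suffices.
    by_cases h : 500 ≤ c
    · refine ⟨c ^ 2 / 100000, Or.inr fun i hi => walkCode_lt_of_le h ?_ hi, fun m hm => ?_⟩
      · exact Nat.div_mul_le_self _ _
      · have := (Nat.le_div_iff_mul_le (by norm_num)).2 hm
        omega
    · refine ⟨0, Or.inl rfl, fun m hm => ?_⟩
      have : c ^ 2 ≤ 500 ^ 2 := Nat.pow_le_pow_left (by omega) 2
      omega
  obtain ⟨K, hK, hm⟩ := key
  refine ⟨K + 3, fun f => ?_⟩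
  obtain ⟨L, hL, hacc⟩ := (walkColoring hc hK).exists_checker f
  refine ⟨L, hL, fun n hn _ h2 hf => hacc n hn h2 ?_⟩
  rcases le_max_iff.1 hf with h | h
  · exact le_max_of_le_left (by exact_mod_cast h)
  · apply hm
    rw [threshold, if_pos le_rfl] at h
    have : (f n : ℝ) * 100000 ≤ (c : ℝ) ^ 2 := by linarith
    exact_mod_cast this

/-! ### Distance 2: multisets of colors -/

theorem eq_of_digits_eq {b l x y : ℕ} (hx : x < b ^ l) (hy : y < b ^ l)
    (h : ∀ a < l, x / b ^ a % b = y / b ^ a % b) : x = y := by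
  have : (⟨x, hx⟩ : Fin (b ^ l)) = ⟨y, hy⟩ := by
    apply finFunctionFinEquiv.symm.injective
    ext a
    simpa using h a a.2
  simpa using this

/-- The least number of bits of the digits such that `x` has at most `c` digits. -/
def digitBits (c x : ℕ) : ℕ := Nat.clog (2 ^ c) (x + 1)

theorem lt_pow_digitBits {c : ℕ} (hc : 1 ≤ c) (x : ℕ) : x < (2 ^ digitBits c x) ^ c := by
  have := Nat.le_pow_clog (Nat.one_lt_two_pow (by omega : c ≠ 0)) (x + 1)
  rw [pow_right_comm] at this
  exact this

theorem pow_digitBits_le {c : ℕ} (hc : 1 ≤ c) (x : ℕ) :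
    (2 ^ digitBits c x) ^ c ≤ 2 ^ c * (x + 1) := by
  rcases Nat.eq_zero_or_pos x with rfl | hx
  · simp [digitBits, Nat.one_le_two_pow]
  · have h1 := Nat.pow_pred_clog_lt_self (Nat.one_lt_two_pow (by omega : c ≠ 0))
      (by omega : 1 < x + 1)
    have h2 : 0 < Nat.clog (2 ^ c) (x + 1) :=
      Nat.clog_pos (Nat.one_lt_two_pow (by omega)) (by omega)
    rw [digitBits, pow_right_comm]
    obtain ⟨m, hm⟩ : ∃ m, Nat.clog (2 ^ c) (x + 1) = m + 1 := ⟨_, (Nat.succ_pred_eq_of_pos h2).symm⟩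
    rw [hm] at h1 ⊢
    rw [pow_succ, mul_comm]
    exact Nat.mul_le_mul_left _ h1.le

/-- How often a color occurs in the code of `x`. -/
def colorCount (c x a : ℕ) : ℕ :=
  x / (2 ^ digitBits c x) ^ a % 2 ^ digitBits c x + 2 ^ digitBits c x

theorem le_colorCount (c x a : ℕ) : 2 ^ digitBits c x ≤ colorCount c x a := Nat.le_add_left _ _

theorem colorCount_lt (c x a : ℕ) : colorCount c x a < 2 * 2 ^ digitBits c x := by
  have := Nat.mod_lt (x / (2 ^ digitBits c x) ^ a) (Nat.two_pow_pos (digitBits c x))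
  rw [colorCount]
  omega

/-- For digits of b bits all counts lie in [2^b, 2^(b+1)), so a single count reveals b; subtracting
2^b from the counts then gives the digits. -/
theorem eq_of_colorCount_eq {c x y : ℕ} (hc : 1 ≤ c)
    (h : ∀ a < c, colorCount c x a = colorCount c y a) : x = y := by
  have aux : ∀ x y : ℕ, colorCount c x 0 = colorCount c y 0 → digitBits c x ≤ digitBits c y := by
    intro x y h
    by_contra! hlt
    have h1 := le_colorCount c x 0
    have h2 := colorCount_lt c y 0
    have h3 : 2 ^ (digitBits c y + 1) ≤ 2 ^ digitBits c x := Nat.pow_le_pow_right (by norm_num) hlt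
    rw [pow_succ] at h3
    omega
  have hb : digitBits c x = digitBits c y :=
    le_antisymm (aux x y (h 0 (by omega))) (aux y x (h 0 (by omega)).symm)
  refine eq_of_digits_eq (lt_pow_digitBits hc x) (hb ▸ lt_pow_digitBits hc y) fun a ha => ?_
  have := h a ha
  rw [colorCount, colorCount, hb] at this
  rw [hb]
  omega

/-- The multiset of colors that encodes `x`. -/
def colorCode (c x : ℕ) : Multiset (Fin c) := ∑ a : Fin c, Multiset.replicate (colorCount c x a) a

theorem count_colorCode {c : ℕ} (x : ℕ) (a : Fin c) :
    (colorCode c x).count a = colorCount c x a := by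
  simp [colorCode, Multiset.count_sum', Multiset.count_replicate]

theorem colorCode_injective {c : ℕ} (hc : 1 ≤ c) : Function.Injective (colorCode c) := by
  intro x y h
  refine eq_of_colorCount_eq hc fun a ha => ?_
  rw [← count_colorCode x ⟨a, ha⟩, h, count_colorCode]

theorem card_colorCode_le (c x : ℕ) : (colorCode c x).card ≤ c * (2 * 2 ^ digitBits c x) := by
  rw [colorCode, Multiset.card_sum]
  refine (Finset.sum_le_card_nsmul univ _ (2 * 2 ^ digitBits c x) fun a _ => ?_).trans (by simp)
  simpa using (colorCount_lt c x a).le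

theorem card_colorCode_pow_le {c : ℕ} (hc : 1 ≤ c) (x : ℕ) :
    (colorCode c x).card ^ c ≤ (4 * c) ^ c * (x + 1) := by
  calc (colorCode c x).card ^ c ≤ (c * (2 * 2 ^ digitBits c x)) ^ c :=
        Nat.pow_le_pow_left (card_colorCode_le c x) c
    _ = (2 * c) ^ c * (2 ^ digitBits c x) ^ c := by rw [← mul_pow]; ring_nf
    _ ≤ (2 * c) ^ c * (2 ^ c * (x + 1)) := Nat.mul_le_mul_left _ (pow_digitBits_le hc x)
    _ = (4 * c) ^ c * (x + 1) := by rw [← mul_assoc, ← mul_pow]; ring_nf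

theorem one_le_card_colorCode {c : ℕ} (hc : 1 ≤ c) (x : ℕ) : 1 ≤ (colorCode c x).card := by
  refine le_trans ?_ (Multiset.count_le_card (⟨0, hc⟩ : Fin c) _)
  rw [count_colorCode]
  exact Nat.one_le_two_pow.trans (le_colorCount c x 0)

/-- Labels of single vertices, whose colors encode the position. -/
noncomputable def colorLabels {c : ℕ} (hc : 1 ≤ c) : LabelSystem c 0 :=
  have hs : ∀ i, (((colorCode c (walkCode i)).toList.map fun a => RTree.mk a []
      : List (RTree c)) : Multiset (RTree c)).map (RTree.shape 0) = colorCode c (walkCode i) := by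
    intro i
    rw [← Multiset.map_coe, Multiset.coe_toList, Multiset.map_map]
    exact Multiset.map_id _
  { label := fun i => (colorCode c (walkCode i)).toList.map fun a => RTree.mk a []
    color := ⟨0, hc⟩
    label_ne_nil := fun i h => by
      have h1 := one_le_card_colorCode hc (walkCode i)
      have h2 := congrArg List.length h
      rw [List.length_map, Multiset.length_toList] at h2
      simp only [List.length_nil] at h2
      omega
    height_eq := fun i s hs => by
      obtain ⟨a, -, rfl⟩ := List.mem_map.1 hs
      exact RTree.height_path a 0
    eq_of_consecutive := fun i j h h' => by
      rw [hs, hs] at h h'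
      exact eq_of_walkCode_eq (colorCode_injective hc h) (colorCode_injective hc h')
    not_reversed := fun i j h h' => by
      rw [hs, hs] at h h'
      exact walkCode_not_reversed (colorCode_injective hc h) (colorCode_injective hc h') }

theorem shapes_colorLabels {c : ℕ} (hc : 1 ≤ c) (i : ℕ) :
    (colorLabels hc).shapes i = colorCode c (walkCode i) := by
  rw [LabelSystem.shapes, colorLabels, ← Multiset.map_coe, Multiset.coe_toList, Multiset.map_map]
  exact Multiset.map_id _

theorem weight_colorLabels {c : ℕ} (hc : 1 ≤ c) (i : ℕ) :
    (colorLabels hc).weight i = (colorCode c (walkCode i)).card := by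
  have h : RTree.size ∘ (fun a : Fin c => RTree.mk a []) = fun _ => 1 := by
    funext a
    exact RTree.size_path a 0
  rw [LabelSystem.weight, colorLabels, List.map_map, h]
  simp

/-- The power 2c clears both roots: codes have order √k, and labels have the size of a c-th root.
The hypothesis compares codes, not positions, because validity also concerns positions beyond k that
share its label. -/
theorem weight_colorLabels_pow_le {c i k : ℕ} (hc : 1 ≤ c)
    (h : walkCode i ≤ 6 * walkCode k + 31) :
    (colorLabels hc).weight i ^ (2 * c) ≤ (4 * c) ^ (2 * c) * 20000 * (k + 1) := by
  have h1 : (walkCode i + 1) ^ 2 ≤ 20000 * (k + 1) := by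
    have h2 := walkCode_le k
    have h3 := Nat.sqrt_le (k / 4)
    have h4 : k / 4 * 4 ≤ k := Nat.div_mul_le_self _ _
    set s := Nat.sqrt (k / 4)
    have h5 : walkCode i + 1 ≤ 144 * s + 74 := by omega
    calc (walkCode i + 1) ^ 2 ≤ (144 * s + 74) ^ 2 := Nat.pow_le_pow_left h5 2
      _ ≤ 20000 * (k + 1) := by nlinarith [sq_nonneg ((s : ℤ) - 1), Nat.le_mul_self s]
  rw [weight_colorLabels, mul_comm 2 c, pow_mul, pow_mul, mul_assoc]
  calc ((colorCode c (walkCode i)).card ^ c) ^ 2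
      ≤ ((4 * c) ^ c * (walkCode i + 1)) ^ 2 :=
        Nat.pow_le_pow_left (card_colorCode_pow_le hc _) 2
    _ ≤ _ := by rw [mul_pow]; exact Nat.mul_le_mul_left _ h1

theorem LabelSystem.one_le_weight {c e : ℕ} (A : LabelSystem c e) (i : ℕ) : 1 ≤ A.weight i := by
  obtain ⟨s, l, h⟩ := List.exists_cons_of_ne_nil (A.label_ne_nil i)
  rw [weight, h, List.map_cons, List.sum_cons]
  have : 1 ≤ s.size := by
    cases s with
    | node col k ch => rw [RTree.size]; omega
  omega

theorem LabelSystem.size_le_of_weight_le {c e n k : ℕ} (A : LabelSystem c e)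
    (h : ∀ i ≤ k, 16 * (k + 1) * A.weight i ≤ n) :
    2 * (1 + ∑ i ∈ range (k + 1), (1 + 2 * A.weight i) + 2 * A.weight 0) ≤ n := by
  have h1 : ∑ i ∈ range (k + 1), 16 * (k + 1) * A.weight i ≤ (k + 1) * n := by
    simpa using Finset.sum_le_card_nsmul (range (k + 1)) _ n fun i hi =>
      h i (by simpa [Nat.lt_succ_iff] using hi)
  have h2 : 16 * ∑ i ∈ range (k + 1), A.weight i ≤ n := by
    rw [← Finset.mul_sum, mul_comm 16, mul_assoc] at h1
    exact Nat.le_of_mul_le_mul_left h1 (Nat.succ_pos k)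
  have h3 : ∑ i ∈ range (k + 1), (1 + 2 * A.weight i) ≤ ∑ i ∈ range (k + 1), 3 * A.weight i :=
    Finset.sum_le_sum fun i _ => by have := A.one_le_weight i; omega
  have h4 : A.weight 0 ≤ ∑ i ∈ range (k + 1), A.weight i :=
    Finset.single_le_sum (f := A.weight) (fun _ _ => Nat.zero_le _) (by simp)
  have h5 := A.one_le_weight 0
  rw [← Finset.mul_sum] at h3
  omega

theorem exists_checker_distance_two {c : ℕ} (hc : 1 ≤ c) : ∃ κ : ℝ, 0 < κ ∧ ∃ n₀ : ℕ,
    ∀ f : ℕ → ℕ, ∃ L : LocalChecker c 2, L.HasExactDiameter f ∧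
      ∀ n : ℕ, n₀ ≤ n → 2 ≤ f n → (f n : ℝ) ≤ κ * threshold c 2 n → L.AcceptsOrder n := by
  -- The factors come from the 16 in `size_le_of_weight_le`, from `weight_colorLabels_pow_le`, and
  -- from k + 1 ≤ 2k for k ≥ 1.
  set C : ℕ := 16 ^ (2 * c) * ((4 * c) ^ (2 * c) * 20000) * 2 ^ (2 * c + 1) with hC
  have hC1 : 1 ≤ C := Nat.one_le_iff_ne_zero.2 (by positivity)
  have hc0 : (1 : ℝ) ≤ c := by exact_mod_cast hc
  have hC0 : (1 : ℝ) ≤ C := by exact_mod_cast hC1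
  set κ : ℝ := 1 / (2 * C * c ^ 2) with hκ
  have hκ0 : 0 < κ := by positivity
  have hκ1 : κ ≤ 1 := by
    rw [hκ, div_le_one (by positivity)]
    nlinarith
  have hS : ∀ n : ℕ, threshold c 2 n ^ (2 * c + 1) = (c : ℝ) ^ 2 * n ^ (2 * c) := by
    intro n
    rw [threshold, if_neg (by norm_num), if_pos rfl, ← Real.rpow_natCast, ← Real.rpow_mul
      (by positivity)]
    push_cast
    rw [div_mul_cancel₀ _ (by positivity)]
    norm_cast
    ring
  have key : ∀ n k : ℕ, 2 * C + 3 ≤ n → (k : ℝ) ≤ κ * threshold c 2 n →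
      ∀ i, walkCode i ≤ 6 * walkCode k + 31 → 16 * (k + 1) * (colorLabels hc).weight i ≤ n := by
    intro n k hn hk i hi
    have hn1 : (2 * C + 3 : ℝ) ≤ n := by exact_mod_cast hn
    have hnpow : (2 * C : ℝ) ≤ (n : ℝ) ^ (2 * c) := by
      calc (2 * C : ℝ) ≤ n := by linarith
        _ ≤ (n : ℝ) ^ (2 * c) := le_self_pow₀ (by linarith) (by omega)
    have hk1 : (k : ℝ) ^ (2 * c + 1) ≤ κ * (c ^ 2 * n ^ (2 * c)) := by
      calc (k : ℝ) ^ (2 * c + 1) ≤ (κ * threshold c 2 n) ^ (2 * c + 1) :=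
            pow_le_pow_left₀ (by positivity) hk _
        _ = κ ^ (2 * c + 1) * (c ^ 2 * n ^ (2 * c)) := by rw [mul_pow, hS]
        _ ≤ κ * (c ^ 2 * n ^ (2 * c)) := by
            refine mul_le_mul_of_nonneg_right ?_ (by positivity)
            exact pow_le_of_le_one hκ0.le hκ1 (by omega)
    have hk2 : ((k : ℝ) + 1) ^ (2 * c + 1) ≤ 2 ^ (2 * c + 1) * (κ * (c ^ 2 * n ^ (2 * c)) + 1) := by
      rcases Nat.eq_zero_or_pos k with rfl | hk0
      · simp only [Nat.cast_zero, zero_add, one_pow]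
        have h1 : (1 : ℝ) ≤ 2 ^ (2 * c + 1) := one_le_pow₀ (by norm_num)
        have h2 : 0 ≤ κ * (c ^ 2 * (n : ℝ) ^ (2 * c)) := by positivity
        nlinarith
      · have hk0' : (1 : ℝ) ≤ k := by exact_mod_cast hk0
        calc ((k : ℝ) + 1) ^ (2 * c + 1) ≤ (2 * k) ^ (2 * c + 1) :=
              pow_le_pow_left₀ (by positivity) (by linarith) _
          _ = 2 ^ (2 * c + 1) * (k : ℝ) ^ (2 * c + 1) := mul_pow _ _ _
          _ ≤ _ := by
              refine mul_le_mul_of_nonneg_left ?_ (by positivity)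
              linarith
    have hw : ((colorLabels hc).weight i : ℝ) ^ (2 * c) ≤
        (4 * c) ^ (2 * c) * 20000 * ((k : ℝ) + 1) := by
      exact_mod_cast weight_colorLabels_pow_le hc hi
    have hmain : ((16 * ((k : ℝ) + 1)) * (colorLabels hc).weight i) ^ (2 * c) ≤
        (n : ℝ) ^ (2 * c) := by
      calc ((16 * ((k : ℝ) + 1)) * (colorLabels hc).weight i) ^ (2 * c)
          = 16 ^ (2 * c) * ((k : ℝ) + 1) ^ (2 * c) * ((colorLabels hc).weight i : ℝ) ^ (2 * c) := by
            rw [mul_pow, mul_pow]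
        _ ≤ 16 ^ (2 * c) * ((k : ℝ) + 1) ^ (2 * c) *
            ((4 * c) ^ (2 * c) * 20000 * ((k : ℝ) + 1)) :=
            mul_le_mul_of_nonneg_left hw (by positivity)
        _ = 16 ^ (2 * c) * ((4 * c) ^ (2 * c) * 20000) * ((k : ℝ) + 1) ^ (2 * c + 1) := by ring
        _ ≤ 16 ^ (2 * c) * ((4 * c) ^ (2 * c) * 20000) *
            (2 ^ (2 * c + 1) * (κ * (c ^ 2 * n ^ (2 * c)) + 1)) :=
            mul_le_mul_of_nonneg_left hk2 (by positivity)
        _ = C * κ * c ^ 2 * n ^ (2 * c) + C := by rw [hC]; push_cast; ring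
        _ = n ^ (2 * c) / 2 + C := by
            rw [hκ]
            field_simp
        _ ≤ (n : ℝ) ^ (2 * c) := by linarith
    have := le_of_pow_le_pow_left₀ (by omega : 2 * c ≠ 0) (by positivity) hmain
    exact_mod_cast this
  refine ⟨κ, hκ0, 2 * C + 3, (colorLabels hc).exists_checker (S := threshold c 2) (by omega) ?_ ?_⟩
  · intro n k hn hk
    refine (colorLabels hc).size_le_of_weight_le fun i hi => key n k hn hk i ?_
    exact walkCode_le_of_near (by omega)
  · intro n k N hn hk hN j j' hj _ hj'
    rw [shapes_colorLabels, shapes_colorLabels] at hj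
    have h1 := key n k hn hk j' (by
      rw [← colorCode_injective hc hj]
      exact walkCode_le_of_near hj')
    have h2 := (colorLabels hc).one_le_weight j'
    classical
    have h3 : ((colorLabels hc).shapes j').count ((colorLabels hc).leaf.shape 0) ≤
        (colorLabels hc).weight j' := by
      rw [weight_colorLabels, ← shapes_colorLabels hc]
      exact Multiset.count_le_card _ _
    have h4 : 16 * (colorLabels hc).weight j' ≤ n := by nlinarith
    omega

/-! ### Distance at least 3: encoding positions by trees -/

/-- The positions of the binary digits `1` of `i + 1`. -/
def bitSet (i : ℕ) : Finset ℕ := (range (i + 1)).filter fun j => (i + 1).testBit j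

theorem mem_bitSet {i j : ℕ} : j ∈ bitSet i ↔ (i + 1).testBit j = true := by
  rw [bitSet, mem_filter, mem_range, and_iff_right_iff_imp]
  intro h
  exact j.lt_two_pow_self.trans_le (Nat.ge_two_pow_of_testBit h)

theorem bitSet_injective : Function.Injective bitSet := by
  intro i j h
  suffices i + 1 = j + 1 by omega
  refine Nat.eq_of_testBit_eq fun l => ?_
  rw [Bool.eq_iff_iff, ← mem_bitSet, h, mem_bitSet]

/-- The shift from i to i + 1 secures a digit 1 even for i = 0; nonempty sets keep all encoding
trees at full height. -/
theorem bitSet_nonempty (i : ℕ) : (bitSet i).Nonempty := by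
  obtain ⟨j, hj, -⟩ := Nat.exists_most_significant_bit (Nat.succ_ne_zero i)
  exact ⟨j, mem_bitSet.2 hj⟩

theorem exists_lt_pow_pow (i : ℕ) : ∃ b : ℕ, i < (2 ^ b) ^ (2 ^ b) :=
  ⟨i, i.lt_two_pow_self.trans_le (Nat.le_self_pow (by positivity) _)⟩

/-- The least number `b` such that `i` has at most `2 ^ b` digits of `b` bits. -/
def blockBits (i : ℕ) : ℕ := Nat.find (exists_lt_pow_pow i)

theorem lt_pow_blockBits (i : ℕ) : i < (2 ^ blockBits i) ^ (2 ^ blockBits i) :=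
  Nat.find_spec (exists_lt_pow_pow i)

theorem blockBits_le {i b : ℕ} (h : i < (2 ^ b) ^ (2 ^ b)) : blockBits i ≤ b :=
  Nat.find_min' (exists_lt_pow_pow i) h

/-- The `j`-th digit of `i`, tagged with its position. -/
def taggedDigit (i j : ℕ) : ℕ :=
  j * 2 ^ blockBits i + i / (2 ^ blockBits i) ^ j % 2 ^ blockBits i

theorem taggedDigit_div (i j : ℕ) : taggedDigit i j / 2 ^ blockBits i = j := by
  rw [taggedDigit, mul_comm, Nat.mul_add_div (Nat.two_pow_pos _),
    Nat.div_eq_of_lt (Nat.mod_lt _ (Nat.two_pow_pos _)), add_zero]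

theorem taggedDigit_injective (i : ℕ) : Function.Injective (taggedDigit i) := fun j l h => by
  rw [← taggedDigit_div i j, h, taggedDigit_div]

theorem taggedDigit_lt {i j : ℕ} (hj : j < 2 ^ blockBits i) :
    taggedDigit i j < 2 ^ (2 * blockBits i) := by
  have h := Nat.mod_lt (i / (2 ^ blockBits i) ^ j) (Nat.two_pow_pos (blockBits i))
  rw [taggedDigit, two_mul, pow_add]
  nlinarith

/-- The set of tagged digits of `i`. -/
def digitSet (i : ℕ) : Finset ℕ := (range (2 ^ blockBits i)).image (taggedDigit i)

theorem card_digitSet (i : ℕ) : (digitSet i).card = 2 ^ blockBits i := by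
  rw [digitSet, card_image_of_injective _ (taggedDigit_injective i), card_range]

theorem digitSet_nonempty (i : ℕ) : (digitSet i).Nonempty := by
  rw [← card_pos, card_digitSet]
  positivity

/-- The cardinality 2^b reveals the block length; then division by 2^b separates each tag from its
digit. -/
theorem digitSet_injective : Function.Injective digitSet := by
  intro i i' h
  have hb : blockBits i = blockBits i' := by
    have := congrArg card h
    rw [card_digitSet, card_digitSet] at this
    exact Nat.pow_right_injective le_rfl this
  refine eq_of_digits_eq (lt_pow_blockBits i) (hb ▸ lt_pow_blockBits i') fun j hj => ?_
  have hm : taggedDigit i j ∈ digitSet i' := by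
    rw [← h]
    exact mem_image_of_mem _ (mem_range.2 hj)
  obtain ⟨l, -, hl⟩ := mem_image.1 hm
  have hlj : l = j := by rw [← taggedDigit_div i' l, hl, ← hb, taggedDigit_div]
  subst hlj
  rw [taggedDigit, taggedDigit, hb] at hl
  rw [hb]
  exact (Nat.add_left_cancel hl).symm

/-- Sets of numbers that encode numbers: binary digits at the first level, blocks of them at the
later ones. -/
def codeSet : ℕ → ℕ → Finset ℕ
  | 0 => bitSet
  | _ + 1 => digitSet

theorem codeSet_injective (e : ℕ) : Function.Injective (codeSet e) := by
  cases e with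
  | zero => exact bitSet_injective
  | succ e => exact digitSet_injective

theorem codeSet_nonempty (e i : ℕ) : (codeSet e i).Nonempty := by
  cases e with
  | zero => exact bitSet_nonempty i
  | succ e => exact digitSet_nonempty i

/-- Lists of trees of height `e` that encode numbers. -/
noncomputable def treeCode {c : ℕ} (a : Fin c) : ℕ → ℕ → List (RTree c)
  | 0, i => List.replicate (i + 1) (RTree.mk a [])
  | e + 1, i => (codeSet e i).toList.map fun j => RTree.mk a (treeCode a e j)

/-- The number of vertices of the trees that encode a number. -/
def codeWeight : ℕ → ℕ → ℕ
  | 0, i => i + 1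
  | e + 1, i => ∑ j ∈ codeSet e i, (1 + codeWeight e j)

section treeCode

variable {c : ℕ} (a : Fin c)

theorem sum_size_treeCode (e i : ℕ) : ((treeCode a e i).map RTree.size).sum = codeWeight e i := by
  induction e generalizing i with
  | zero =>
    have h : (RTree.mk a []).size = 1 := RTree.size_path a 0
    rw [treeCode, codeWeight, List.map_replicate, List.sum_replicate, h]
    simp
  | succ e ih =>
    rw [treeCode, codeWeight, List.map_map, ← Finset.sum_map_toList]
    congr 2
    funext j
    simp [RTree.size_mk, ih]

theorem treeCode_ne_nil (e i : ℕ) : treeCode a e i ≠ [] := by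
  cases e with
  | zero => simp [treeCode]
  | succ e => simpa [treeCode] using (codeSet_nonempty e i).ne_empty

theorem height_of_mem_treeCode {e i : ℕ} {s : RTree c} (hs : s ∈ treeCode a e i) :
    s.height = e := by
  induction e generalizing i s with
  | zero =>
    rw [treeCode] at hs
    rw [List.eq_of_mem_replicate hs]
    exact RTree.height_path a 0
  | succ e ih =>
    rw [treeCode] at hs
    obtain ⟨j, -, rfl⟩ := List.mem_map.1 hs
    obtain ⟨s, hs⟩ := List.exists_mem_of_ne_nil _ (treeCode_ne_nil a e j)
    exact RTree.height_mk_eq (fun s hs => (ih hs).le) ⟨s, hs, ih hs⟩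

theorem shapes_treeCode_injective (e : ℕ) : Function.Injective fun i =>
    (treeCode a e i : Multiset (RTree c)).map (RTree.shape e) := by
  induction e with
  | zero =>
    intro i j h
    have := congrArg Multiset.card h
    simpa [treeCode] using this
  | succ e ih =>
    intro i j h
    have hinj : Function.Injective fun l => (RTree.mk a (treeCode a e l)).shape (e + 1) := by
      intro l m hlm
      apply ih
      have := congrArg Prod.snd hlm
      simpa only [RTree.shape_succ, RTree.children_mk] using this
    apply codeSet_injective e
    apply Finset.val_injective
    apply Multiset.map_injective hinj
    simp only [treeCode, ← Multiset.map_coe, Finset.coe_toList, Multiset.map_map] at h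
    exact h

/-- Labels that encode the position at a single vertex. -/
noncomputable def codeLabels (e : ℕ) : LabelSystem c e where
  label := treeCode a e
  color := a
  label_ne_nil := treeCode_ne_nil a e
  height_eq i s hs := height_of_mem_treeCode a hs
  eq_of_consecutive i j h _ := shapes_treeCode_injective a e h
  not_reversed i j h h' := by
    have h1 := shapes_treeCode_injective a e h
    have h2 := shapes_treeCode_injective a e h'
    omega

theorem weight_codeLabels (e i : ℕ) : (codeLabels a e).weight i = codeWeight e i :=
  sum_size_treeCode a e i

/-- The roots of the label trees have children, so no label tree looks like a leaf. -/
theorem valid_codeLabels (e k : ℕ) {N : ℕ} (hN : 2 ≤ N) : (codeLabels a (e + 1)).Valid k N := by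
  classical
  intro j j' _ _ _
  have h : ((codeLabels a (e + 1)).shapes j').count ((codeLabels a (e + 1)).leaf.shape (e + 1)) =
      0 := by
    rw [Multiset.count_eq_zero]
    intro hmem
    obtain ⟨s, hs, hshape⟩ := Multiset.mem_map.1 hmem
    have hs' : s ∈ treeCode a (e + 1) j' := hs
    rw [treeCode] at hs'
    obtain ⟨l, -, rfl⟩ := List.mem_map.1 hs'
    have := congrArg (fun p => Multiset.card (Prod.snd p)) hshape
    simp only [LabelSystem.leaf, RTree.shape_succ, RTree.children_mk, Multiset.card_map,
      Multiset.coe_card, List.length_nil, List.length_eq_zero_iff] at this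
    exact treeCode_ne_nil a e l this
  omega

end treeCode

/-! ### Iterated logarithms and the threshold function -/

section iteratedLog

open Filter Real

theorem tendsto_iterate_log (k : ℕ) : Tendsto (log^[k]) atTop atTop := by
  induction k with
  | zero => exact tendsto_id
  | succ k ih =>
    rw [Function.iterate_succ]
    exact ih.comp tendsto_log_atTop

/-- Once log y ≥ 1, log a ≤ a - 1 ≤ (a - 1) log y, so the factor a survives each logarithm. For a =
1 this is eventual monotonicity. -/
theorem iterate_log_le_mul {a : ℝ} (ha : 1 ≤ a) (k : ℕ) : ∃ Y : ℝ, ∀ y z : ℝ, Y ≤ y → Y ≤ z →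
    z ≤ a * y → log^[k] z ≤ a * log^[k] y := by
  induction k with
  | zero => exact ⟨0, fun y z _ _ h => h⟩
  | succ k ih =>
    obtain ⟨Y, hY⟩ := ih
    refine ⟨exp (max 1 Y), fun y z hy hz h => ?_⟩
    have hy0 : 0 < y := (exp_pos _).trans_le hy
    have hz0 : 0 < z := (exp_pos _).trans_le hz
    have hly := (le_log_iff_exp_le hy0).2 hy
    have hlz := (le_log_iff_exp_le hz0).2 hz
    rw [Function.iterate_succ_apply, Function.iterate_succ_apply]
    refine hY _ _ ((le_max_right _ _).trans hly) ((le_max_right _ _).trans hlz) ?_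
    have h1 : log z ≤ log a + log y := by
      rw [← log_mul (by positivity) hy0.ne']
      exact log_le_log hz0 h
    have h2 := log_le_sub_one_of_pos (by linarith : 0 < a)
    have h3 := (le_max_left 1 Y).trans hly
    nlinarith

theorem iterate_log_le_self (k : ℕ) : ∀ᶠ y : ℝ in atTop, log^[k] y ≤ y := by
  induction k with
  | zero => exact Eventually.of_forall fun y => le_rfl
  | succ k ih =>
    filter_upwards [ih, (tendsto_iterate_log k).eventually_gt_atTop 0] with y hy hy0
    rw [Function.iterate_succ_apply']
    exact ((log_le_sub_one_of_pos hy0).trans (by linarith)).trans hy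

theorem iterate_log_succ_isLittleO (k : ℕ) : (log^[k + 1]) =o[atTop] (fun y : ℝ => y) := by
  refine Asymptotics.IsBigO.trans_isLittleO ?_ isLittleO_log_id_atTop
  refine Asymptotics.IsBigO.of_bound 1 ?_
  filter_upwards [tendsto_log_atTop.eventually (iterate_log_le_self k),
    (tendsto_iterate_log (k + 1)).eventually_ge_atTop 0, eventually_ge_atTop 1] with y h1 h2 h3
  rw [one_mul, norm_of_nonneg h2, norm_of_nonneg (log_nonneg h3)]
  exact h1

/-- Without boundedness the supremum in `gInv` would take its default value 0. -/
theorem bddAbove_div_iterate_log_le (k : ℕ) (y : ℝ) :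
    BddAbove {x : ℝ | x / log^[k + 1] x ≤ y} := by
  have h : ∀ᶠ x : ℝ in atTop, ¬ x / log^[k + 1] x ≤ y := by
    filter_upwards [(iterate_log_succ_isLittleO k).bound
      (by positivity : 0 < 1 / (2 * (|y| + 1))),
      (tendsto_iterate_log (k + 1)).eventually_gt_atTop 0, eventually_gt_atTop 0] with x h1 h2 h3
    rw [norm_of_nonneg h2.le, norm_of_nonneg h3.le, one_div, inv_mul_eq_div,
      le_div_iff₀ (by positivity)] at h1
    rw [not_le, lt_div_iff₀ h2]
    have := le_abs_self y
    have := abs_nonneg y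
    nlinarith
  obtain ⟨X, hX⟩ := eventually_atTop.1 h
  refine ⟨X, fun x hx => ?_⟩
  by_contra! hlt
  exact hX x hlt.le hx

/-- The number x = y log^(k+1) y belongs to the set in `gInv`, since x ≥ y and the iterated
logarithm is eventually monotone. -/
theorem mul_iterate_log_le_gInv (k : ℕ) :
    ∀ᶠ y : ℝ in atTop, y * log^[k + 1] y ≤ gInv (k + 4) y := by
  obtain ⟨Y, hY⟩ := iterate_log_le_mul le_rfl (k + 1)
  filter_upwards [eventually_ge_atTop Y, eventually_gt_atTop 0,
    (tendsto_iterate_log (k + 1)).eventually_ge_atTop 1] with y h1 h2 h3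
  refine le_csSup (bddAbove_div_iterate_log_le k y) ?_
  change y * log^[k + 1] y / log^[k + 1] (y * log^[k + 1] y) ≤ y
  have hle : y ≤ y * log^[k + 1] y := le_mul_of_one_le_right h2.le h3
  have h4 := hY (y * log^[k + 1] y) y (h1.trans hle) h1 (by rwa [one_mul])
  rw [one_mul] at h4
  rw [div_le_iff₀ (by linarith)]
  exact mul_le_mul_of_nonneg_left h4 h2.le

theorem threshold_le (c e : ℕ) : ∀ᶠ n : ℕ in atTop,
    threshold c (e + 3) n ≤ 36 * n / (log n * log^[e] (log n)) := by
  have hlog : Tendsto (fun n : ℕ => log (n : ℝ)) atTop atTop :=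
    tendsto_log_atTop.comp tendsto_natCast_atTop_atTop
  cases e with
  | zero =>
    refine Eventually.of_forall fun n => le_of_eq ?_
    rw [threshold, if_neg (by omega), if_neg (by omega), if_pos rfl, Function.iterate_zero, id, sq]
  | succ k =>
    filter_upwards [hlog.eventually (mul_iterate_log_le_gInv k), hlog.eventually_gt_atTop 0,
      hlog.eventually ((tendsto_iterate_log (k + 1)).eventually_gt_atTop 0)] with n h1 h2 h3
    rw [threshold, if_neg (by omega), if_neg (by omega), if_neg (by omega)]
    have h4 : (0 : ℝ) ≤ n := n.cast_nonneg
    gcongr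
    norm_num

end iteratedLog

/-! ### The size of the encoding trees -/

section codeWeight

open Filter Real

/-- At most x + 1 digit positions occur; position x occurs because i + 1 may equal 2^x. -/
theorem codeWeight_one_le {x i : ℕ} (hi : i < 2 ^ x) : codeWeight 1 i ≤ (x + 1) * (x + 2) := by
  have hsub : codeSet 0 i ⊆ range (x + 1) := by
    intro j hj
    have h := Nat.ge_two_pow_of_testBit (mem_bitSet.1 hj)
    rw [mem_range, Nat.lt_succ_iff]
    exact (Nat.pow_le_pow_iff_right (by norm_num : 1 < 2)).1 (h.trans hi)
  calc codeWeight 1 i ≤ ∑ j ∈ range (x + 1), (1 + codeWeight 0 j) := sum_le_sum_of_subset hsub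
    _ ≤ ∑ j ∈ range (x + 1), (x + 2) := sum_le_sum fun j hj => by
        rw [codeWeight]
        have := mem_range.1 hj
        omega
    _ = (x + 1) * (x + 2) := by simp

theorem codeWeight_le_of_forall {e b i W : ℕ} (hi : i < (2 ^ b) ^ (2 ^ b))
    (hW : ∀ j < 2 ^ (2 * b), codeWeight (e + 1) j ≤ W) :
    codeWeight (e + 2) i ≤ 2 ^ b * (1 + W) := by
  have hb := blockBits_le hi
  calc codeWeight (e + 2) i ≤ ∑ j ∈ digitSet i, (1 + W) := sum_le_sum fun j hj => by
        obtain ⟨l, hl, rfl⟩ := mem_image.1 hj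
        refine Nat.add_le_add_left (hW _ ?_) 1
        exact (taggedDigit_lt (mem_range.1 hl)).trans_le
          (Nat.pow_le_pow_right (by norm_num) (by omega))
    _ = 2 ^ blockBits i * (1 + W) := by rw [sum_const, card_digitSet, smul_eq_mul]
    _ ≤ 2 ^ b * (1 + W) := Nat.mul_le_mul_right _ (Nat.pow_le_pow_right (by norm_num) hb)

/-- The least b with x ≤ b · 2^b works: minimality gives the upper bounds. -/
theorem exists_blockLength (B : ℕ) : ∃ X : ℕ, ∀ x : ℕ, X ≤ x → ∃ b : ℕ, B ≤ b ∧
    x ≤ b * 2 ^ b ∧ b * 2 ^ b ≤ 4 * x ∧ (2 * b : ℝ) ≤ 6 * log x := by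
  refine ⟨(B + 2) * 2 ^ (B + 2) + 1, fun x hx => ?_⟩
  have hex : ∃ b, x ≤ b * 2 ^ b := ⟨x, Nat.le_mul_of_pos_right _ (by positivity)⟩
  have hspec := Nat.find_spec hex
  have hB : B + 2 < Nat.find hex := by
    by_contra! h
    have : Nat.find hex * 2 ^ Nat.find hex ≤ (B + 2) * 2 ^ (B + 2) :=
      Nat.mul_le_mul h (Nat.pow_le_pow_right (by norm_num) h)
    omega
  obtain ⟨m, hm⟩ : ∃ m, Nat.find hex = m + 1 := ⟨Nat.find hex - 1, by omega⟩
  have hmin : m * 2 ^ m < x := not_le.1 (Nat.find_min hex (by omega : m < Nat.find hex))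
  refine ⟨m + 1, by omega, hm ▸ hspec, ?_, ?_⟩
  · rw [pow_succ]
    nlinarith [Nat.two_pow_pos m]
  · have h1 : (2 : ℝ) ^ m ≤ x := by
      have : 2 ^ m ≤ x := (Nat.le_mul_of_pos_left _ (by omega)).trans hmin.le
      exact_mod_cast this
    have h2 := log_le_log (by positivity) h1
    rw [log_pow] at h2
    have h3 := log_two_gt_d9
    have h4 : (2 : ℝ) ≤ m := by exact_mod_cast (by omega : 2 ≤ m)
    push_cast
    nlinarith

/-- With b · 2^b of order x, there are 2^b tagged digits of 2b bits. By induction each costs O(b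
log^(e) b), in total O(x log^(e) b). Since b = O(log x), this adds one iteration of the logarithm.
-/
theorem exists_codeWeight_le (e : ℕ) : ∃ C : ℝ, 0 < C ∧ ∃ X : ℕ, ∀ x : ℕ, X ≤ x →
    ∀ i < 2 ^ x, (codeWeight (e + 1) i : ℝ) ≤ C * (x * log^[e] x) := by
  induction e with
  | zero =>
    refine ⟨6, by norm_num, 1, fun x hx i hi => ?_⟩
    have h1 : (codeWeight 1 i : ℝ) ≤ (x + 1) * (x + 2) := by exact_mod_cast codeWeight_one_le hi
    have h2 : (1 : ℝ) ≤ x := by exact_mod_cast hx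
    rw [Function.iterate_zero, id]
    nlinarith
  | succ e ih =>
    obtain ⟨C, hC, X₀, hX₀⟩ := ih
    obtain ⟨Y, hY⟩ := iterate_log_le_mul (by norm_num : (1 : ℝ) ≤ 6) e
    obtain ⟨X₁, hX₁⟩ := exists_blockLength (max (max X₀ ⌈Y⌉₊) 1)
    have hev : ∀ᶠ x : ℕ in atTop, Y ≤ log x ∧ 1 ≤ log^[e] (log x) :=
      (tendsto_log_atTop.comp tendsto_natCast_atTop_atTop).eventually
        ((eventually_ge_atTop Y).and ((tendsto_iterate_log e).eventually_ge_atTop 1))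
    obtain ⟨X₂, hX₂⟩ := eventually_atTop.1 hev
    refine ⟨4 + 48 * C, by positivity, max X₁ X₂, fun x hx i hi => ?_⟩
    obtain ⟨b, hb, hxb, hbx, hblog⟩ := hX₁ x ((le_max_left _ _).trans hx)
    obtain ⟨hYx, hL⟩ := hX₂ x ((le_max_right _ _).trans hx)
    have hbX : X₀ ≤ b := (le_max_left _ _).trans ((le_max_left _ _).trans hb)
    have hbY : Y ≤ b := (Nat.le_ceil Y).trans
      (by exact_mod_cast (le_max_right _ _).trans ((le_max_left _ _).trans hb))
    have hb1 : 1 ≤ b := (le_max_right _ _).trans hb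
    have hb1' : (1 : ℝ) ≤ b := by exact_mod_cast hb1
    rw [Function.iterate_succ_apply]
    set L := log^[e] (log (x : ℝ)) with hLdef
    have hlog : log^[e] (2 * b : ℝ) ≤ 6 * L := hY _ _ hYx (by linarith) hblog
    have hW : ∀ j < 2 ^ (2 * b), codeWeight (e + 1) j ≤ ⌊C * (2 * b * (6 * L))⌋₊ := by
      intro j hj
      refine Nat.le_floor ((hX₀ (2 * b) (by omega) j hj).trans ?_)
      push_cast
      gcongr
    have hi' : i < (2 ^ b) ^ (2 ^ b) := by
      rw [← pow_mul]
      exact hi.trans_le (Nat.pow_le_pow_right (by norm_num) hxb)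
    have h1 : (codeWeight (e + 2) i : ℝ) ≤ 2 ^ b * (1 + ⌊C * (2 * b * (6 * L))⌋₊) := by
      exact_mod_cast codeWeight_le_of_forall hi' hW
    have h2 : (b * 2 ^ b : ℝ) ≤ 4 * x := by exact_mod_cast hbx
    have h3 : (⌊C * (2 * b * (6 * L))⌋₊ : ℝ) ≤ C * (2 * b * (6 * L)) :=
      Nat.floor_le (by positivity)
    calc (codeWeight (e + 2) i : ℝ) ≤ 2 ^ b * (1 + ⌊C * (2 * b * (6 * L))⌋₊) := h1
      _ ≤ 2 ^ b * (b * L + C * (2 * b * (6 * L))) := by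
          gcongr
          nlinarith
      _ = (1 + 12 * C) * L * (b * 2 ^ b) := by ring
      _ ≤ (1 + 12 * C) * L * (4 * x) := by gcongr
      _ = (4 + 48 * C) * (x * L) := by ring

theorem exists_codeWeight_le_log (e : ℕ) : ∃ C : ℝ, 0 < C ∧ ∀ᶠ n : ℕ in atTop,
    ∀ i ≤ n, (codeWeight (e + 1) i : ℝ) ≤ C * (log n * log^[e] (log n)) := by
  obtain ⟨C, hC, X, hX⟩ := exists_codeWeight_le e
  obtain ⟨Y, hY⟩ := iterate_log_le_mul (by norm_num : (1 : ℝ) ≤ 3) e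
  have hlog : Tendsto (fun n : ℕ => log (n : ℝ)) atTop atTop :=
    tendsto_log_atTop.comp tendsto_natCast_atTop_atTop
  refine ⟨9 * C, by positivity, ?_⟩
  filter_upwards [hlog.eventually_ge_atTop (max (max X Y) 1), eventually_ge_atTop 1,
    hlog.eventually ((tendsto_iterate_log e).eventually_ge_atTop 0)] with n h1 h2 h4 i hi
  have hXn : (X : ℝ) ≤ log n := (le_max_left _ _).trans ((le_max_left _ _).trans h1)
  have hYn : Y ≤ log n := (le_max_right _ _).trans ((le_max_left _ _).trans h1)
  have h1n : 1 ≤ log n := (le_max_right _ _).trans h1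
  set x := Nat.log 2 n + 1 with hx
  have hlt : n < 2 ^ x := Nat.lt_pow_succ_log_self (by norm_num) n
  have hn0 : (0 : ℝ) < n := by exact_mod_cast h2
  have hlow : log n ≤ x := by
    have h5 : (n : ℝ) ≤ 2 ^ x := by exact_mod_cast hlt.le
    have h6 := log_le_log hn0 h5
    rw [log_pow] at h6
    have h7 := log_two_lt_d9
    have h8 : (0 : ℝ) ≤ x := x.cast_nonneg
    nlinarith
  have hup : (x : ℝ) ≤ 3 * log n := by
    have h5 : (2 : ℝ) ^ Nat.log 2 n ≤ n := by exact_mod_cast Nat.pow_log_le_self 2 (by omega)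
    have h6 := log_le_log (by positivity) h5
    rw [log_pow] at h6
    have h7 := log_two_gt_d9
    have h8 : (0 : ℝ) ≤ Nat.log 2 n := Nat.cast_nonneg _
    rw [hx]
    push_cast
    nlinarith
  have hiter := hY _ _ hYn (hYn.trans hlow) hup
  calc (codeWeight (e + 1) i : ℝ) ≤ C * (x * log^[e] x) :=
        hX x (by exact_mod_cast hXn.trans hlow) i (hi.trans_lt hlt)
    _ ≤ C * (3 * log n * (3 * log^[e] (log n))) := by
        refine mul_le_mul_of_nonneg_left ?_ hC.le
        calc (x : ℝ) * log^[e] x ≤ x * (3 * log^[e] (log n)) :=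
              mul_le_mul_of_nonneg_left hiter x.cast_nonneg
          _ ≤ 3 * log n * (3 * log^[e] (log n)) :=
              mul_le_mul_of_nonneg_right hup (by positivity)
    _ = 9 * C * (log n * log^[e] (log n)) := by ring

theorem exists_checker_distance_add_three {c : ℕ} (hc : 1 ≤ c) (e : ℕ) : ∃ κ : ℝ, 0 < κ ∧
    ∃ n₀ : ℕ, ∀ f : ℕ → ℕ, ∃ L : LocalChecker c (e + 3), L.HasExactDiameter f ∧
      ∀ n : ℕ, n₀ ≤ n → 2 ≤ f n → (f n : ℝ) ≤ κ * threshold c (e + 3) n → L.AcceptsOrder n := by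
  obtain ⟨C, hC, hweight⟩ := exists_codeWeight_le_log e
  have hlog : Tendsto (fun n : ℕ => log (n : ℝ)) atTop atTop :=
    tendsto_log_atTop.comp tendsto_natCast_atTop_atTop
  have hsmall : ∀ᶠ n : ℕ in atTop, log n * log^[e] (log n) ≤ (n : ℝ) / (32 * C) := by
    have h := (isLittleO_pow_log_id_atTop (n := 2)).comp_tendsto tendsto_natCast_atTop_atTop
    filter_upwards [h.bound (by positivity : 0 < 1 / (32 * C)), hlog.eventually_ge_atTop 0,
      hlog.eventually (iterate_log_le_self e)] with n h1 h2 h3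
    simp only [Function.comp_apply, id, norm_pow, norm_of_nonneg h2,
      norm_of_nonneg (Nat.cast_nonneg n : (0 : ℝ) ≤ n)] at h1
    calc log n * log^[e] (log n) ≤ log n * log n := mul_le_mul_of_nonneg_left h3 h2
      _ = log n ^ 2 := (sq _).symm
      _ ≤ 1 / (32 * C) * n := h1
      _ = (n : ℝ) / (32 * C) := by ring
  -- The first bound ensures k ≤ n, so that the weight bound applies to all positions. The second,
  -- with `hsmall`, bounds each of the two parts of 16(k + 1) · weight by n/2.
  set κ : ℝ := min (1 / 36) (1 / (1152 * C)) with hκ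
  have hκ0 : 0 < κ := by positivity
  have hκ1 : 36 * κ ≤ 1 := by
    have := min_le_left (1 / 36 : ℝ) (1 / (1152 * C))
    linarith
  have hκ2 : 1152 * C * κ ≤ 1 := by
    have := min_le_right (1 / 36 : ℝ) (1 / (1152 * C))
    rwa [← hκ, le_div_iff₀ (by positivity), mul_comm] at this
  have hev : ∀ᶠ n : ℕ in atTop, ∀ k : ℕ, (k : ℝ) ≤ κ * threshold c (e + 3) n →
      ∀ i ≤ k, 16 * (k + 1) * codeWeight (e + 1) i ≤ n := by
    filter_upwards [hweight, hsmall, threshold_le c e, hlog.eventually_ge_atTop 1,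
      hlog.eventually ((tendsto_iterate_log e).eventually_ge_atTop 1)] with n h1 h2 h3 h4 h5 k hk i hi
    set D := log n * log^[e] (log n) with hD
    have hD1 : 1 ≤ D := one_le_mul_of_one_le_of_one_le h4 h5
    have hn0 : (0 : ℝ) ≤ n := n.cast_nonneg
    have hkD : (k : ℝ) * D ≤ 36 * κ * n := by
      rw [← le_div_iff₀ (by linarith)]
      calc (k : ℝ) ≤ κ * (36 * n / D) := hk.trans (mul_le_mul_of_nonneg_left h3 hκ0.le)
        _ = 36 * κ * n / D := by ring
    have hkn : k ≤ n := by
      have : (k : ℝ) ≤ n := by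
        have : (k : ℝ) ≤ k * D := le_mul_of_one_le_right k.cast_nonneg hD1
        nlinarith
      exact_mod_cast this
    have hw := h1 i (hi.trans hkn)
    rw [le_div_iff₀ (by positivity)] at h2
    have : 16 * ((k : ℝ) + 1) * codeWeight (e + 1) i ≤ n := by
      calc 16 * ((k : ℝ) + 1) * codeWeight (e + 1) i ≤ 16 * ((k : ℝ) + 1) * (C * D) := by gcongr
        _ = 16 * C * (k * D) + D * (32 * C) / 2 := by ring
        _ ≤ 16 * C * (36 * κ * n) + n / 2 := by gcongr
        _ = (1152 * C * κ) * n / 2 + n / 2 := by ring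
        _ ≤ 1 * n / 2 + n / 2 := by gcongr
        _ = n := by ring
    exact_mod_cast this
  obtain ⟨n₀, hn₀⟩ := eventually_atTop.1 hev
  refine ⟨κ, hκ0, max n₀ (2 * e + 5), (codeLabels ⟨0, hc⟩ (e + 1)).exists_checker
    (S := threshold c (e + 3)) ?_ ?_ ?_⟩
  · have := le_max_right n₀ (2 * e + 5)
    omega
  · intro n k hn hk
    refine LabelSystem.size_le_of_weight_le _ fun i hi => ?_
    rw [weight_codeLabels]
    exact hn₀ n ((le_max_left _ _).trans hn) k hk i hi
  · intro n k N hn _ hN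
    have := (le_max_right n₀ (2 * e + 5)).trans hn
    exact valid_codeLabels _ e k (by omega)

end codeWeight

/-! ### The theorem -/

theorem theorem2 :
    (∃ κ : ℝ, 0 < κ ∧ ∀ c : ℕ, 1 ≤ c → ∃ n₀ : ℕ, ∀ f : ℕ → ℕ,
      (fun n => (f n : ℝ)) =O[Filter.atTop] (threshold c 1) →
      ∃ L : LocalChecker c 1, L.HasExactDiameter f ∧
        ∀ n : ℕ, n₀ ≤ n → 2 ≤ c → 2 ≤ f n → (f n : ℝ) ≤ max 2 (κ * threshold c 1 n) →
          L.AcceptsOrder n) ∧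
    (∀ c d : ℕ, 1 ≤ c → 2 ≤ d → ∃ κ : ℝ, 0 < κ ∧ ∃ n₀ : ℕ, ∀ f : ℕ → ℕ,
      (fun n => (f n : ℝ)) =O[Filter.atTop] (threshold c d) →
      ∃ L : LocalChecker c d, L.HasExactDiameter f ∧
        ∀ n : ℕ, n₀ ≤ n → 2 ≤ f n → (f n : ℝ) ≤ κ * threshold c d n →
          L.AcceptsOrder n) := by
  constructor
  · refine ⟨9 / 100000, by norm_num, fun c _ => ?_⟩
    obtain ⟨n₀, h⟩ := exists_checker_distance_one c
    exact ⟨n₀, fun f _ => h f⟩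
  · intro c d hc hd
    obtain ⟨e, rfl⟩ := Nat.exists_eq_add_of_le' hd
    cases e with
    | zero =>
      obtain ⟨κ, hκ, n₀, h⟩ := exists_checker_distance_two hc
      exact ⟨κ, hκ, n₀, fun f _ => h f⟩
    | succ e =>
      obtain ⟨κ, hκ, n₀, h⟩ := exists_checker_distance_add_three hc e
      exact ⟨κ, hκ, n₀, fun f _ => h f⟩
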